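/- Let $\mathbf{Mult}$ be the category of (symmetric) multicategories and multifunctors, and let $\mathbf{Sym}$ be the category of symmetric monoidal categories and lax symmetric monoidal functors. **The forgetful functor.** For every symmetric monoidal category $\mathcal C$, every $n\ge 0$ and every tuple $x=(x_1,\dots,x_n)$ of objects of $\mathcal C$, choose arbitrarily a way $\kappa(x)$ of multiplying $n$ objects, i.e. a parenthesized word in which each of the variables $1,\dots,n$ occurs exactly once, in any order, with any number of units inserted. Let $\bar\kappa x$ be the value of this word at $x$. The multicategory $U\mathcal C$ has the objects of $\mathcal C$ as objects and $U\mathcal C(x;y)=\mathcal C(\bar\kappa x,y)$; its identities, permutation actions and composition come from the canonical isomorphisms between different products of the same objects. A lax symmetric monoidal functor $F$ induces $UF$, which is $F$ on objects and sends $\varphi:\bar\kappa x\to y$ to the composite $\bar\kappa(Fx)\to F(\bar\kappa x)\to Fy$ of the map built from the canonical isomorphisms and the structure maps of $F$ with $F\varphi$. This gives a functor $U:\mathbf{Sym}\to\mathbf{Mult}$. **The functor $L$.** For a multicategory $M$, the objects of $LM$ are the finite lists of objects of $M$. A morphism $(x_1,\dots,x_j)\to(y_1,\dots,y_n)$ is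 a pair $(f,\langle\varphi_s\rangle)$ of a function $f:\{1,\dots,j\}\to\{1,\dots,n\}$ and multimorphisms $\varphi_s\in M(\langle x_r\rangle_{f(r)=s};y_s)$ for $1\le s\le n$. Composition is composition of functions together with composition in $M$, after rearranging the sources; the product is concatenation, and the unit is the empty list. A multifunctor is applied entrywise to objects and to the $\varphi_s$. **Theorem.** For every choice of $\kappa$, the constructions above are well defined functors $U:\mathbf{Sym}\to\mathbf{Mult}$ and $L:\mathbf{Mult}\to\mathbf{Sym}$; each $LM$ is permutative, and each $LF$ is a strict symmetric monoidal functor. The functor $L$ is a weak left adjoint of $U$, in the following sense. 1. There is a natural transformation $\eta:\mathrm{id}\to UL$, where $\eta_M$ sends an object $x$ to the list $(x)$ of length one, and a multimorphism $\varphi\in M(x_1,\dots,x_n;y)$ to the morphism $(x_1,\dots,x_n)\to(y)$ of $LM$ given by $\varphi$ and the only function $\{1,\dots,n\}\to\{1\}$ (precomposed with the canonical isomorphism from the chosen product of $(x_1),\dots,(x_n)$ to $(x_1,\dots,x_n)$). 2. For every symmetric monoidal category $\mathcal C$ there is a strong symmetric monoidal functor $\varepsilon_{\mathcal C}:LU\mathcal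 C\to\mathcal C$ that sends $(x_1,\dots,x_n)$ to $(\cdots(x_1\oplus x_2)\oplus\cdots)\oplus x_n$ (to the unit if $n=0$), and $(f,\langle\varphi_s\rangle)$ to the product of the $\varphi_s$, preceded by the canonical isomorphism that sorts the factors of the source according to the fibres of $f$. Its structure maps are the canonical isomorphisms. 3. Both triangle identities hold strictly: $U\varepsilon_{\mathcal C}\circ\eta_{U\mathcal C}=\mathrm{id}_{U\mathcal C}$ and $\varepsilon_{LM}\circ L\eta_M=\mathrm{id}_{LM}$. 4. The counit is natural up to a coherent natural transformation: for every lax symmetric monoidal functor $F:\mathcal C\to\mathcal D$, the maps $$(\cdots(Fx_1\oplus Fx_2)\oplus\cdots)\oplus Fx_n\to F\bigl((\cdots(x_1\oplus x_2)\oplus\cdots)\oplus x_n\bigr)$$ built from the lax structure maps of $F$ are the components of a monoidal natural transformation $\xi_F:\varepsilon_{\mathcal D}\circ LUF\to F\circ\varepsilon_{\mathcal C}$. Here $\xi_{\mathrm{id}}$ is the identity, and for $G:\mathcal D\to\mathcal E$ the transformation $\xi_{GF}$ is the pasting of $\xi_F$ and $\xi_G$, i.e. $(\xi_{GF})_x=G((\xi_F)_x)\circ(\xi_G)_{LUF(x)}$.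 If $F$ is strong, then $\xi_F$ is an isomorphism; if $F$ is strict, then the components of $\xi_F$ are identities. -/

import Mathlib

open CategoryTheory MonoidalCategory

noncomputable section

namespace SymMult

universe u v

/-! ### Symmetric monoidal categories and lax symmetric monoidal functors -/

set_option linter.checkUnivs false in
/-- A bundled symmetric monoidal category. -/
structure SymMonCat where
  carrier : Type u
  [cat : Category.{v} carrier]
  [mon : MonoidalCategory carrier]
  [sym : SymmetricCategory carrier]

instance : CoeSort SymMonCat.{u, v} (Type u) := ⟨SymMonCat.carrier⟩

attribute [instance] SymMonCat.cat SymMonCat.mon SymMonCat.sym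

/-- Lax symmetric monoidal functors with the same underlying functor are equal when their
structure maps are. -/
theorem laxBraided_ext {C D : SymMonCat.{u, v}} (F G : LaxBraidedFunctor C D)
    (hT : F.toFunctor = G.toFunctor)
    (hε : HEq (Functor.LaxMonoidal.ε F.toFunctor) (Functor.LaxMonoidal.ε G.toFunctor))
    (hμ : ∀ X Y, HEq (Functor.LaxMonoidal.μ F.toFunctor X Y)
      (Functor.LaxMonoidal.μ G.toFunctor X Y)) : F = G := by
  obtain ⟨T, @⟨⟨e₁, m₁, _, _, _, _, _⟩, _⟩⟩ := F
  obtain ⟨T', @⟨⟨e₂, m₂, _, _, _, _, _⟩, _⟩⟩ := G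
  dsimp at hT
  subst hT
  obtain rfl : e₁ = e₂ := eq_of_heq hε
  obtain rfl : m₁ = m₂ := funext fun X => funext fun Y => eq_of_heq (hμ X Y)
  rfl

/-- The category of symmetric monoidal categories and lax symmetric monoidal functors. -/
instance : Category SymMonCat.{u, v} where
  Hom C D := LaxBraidedFunctor C D
  id C := LaxBraidedFunctor.of (𝟭 C)
  comp F G := LaxBraidedFunctor.of (F.toFunctor ⋙ G.toFunctor)
  id_comp F := by
    refine laxBraided_ext _ _ rfl (heq_of_eq ?_) (fun X Y => heq_of_eq ?_)
    · exact (congrArg _ (F.toFunctor.map_id _)).trans (Category.comp_id _)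
    · exact (congrArg _ (F.toFunctor.map_id _)).trans (Category.comp_id _)
  comp_id F := by
    refine laxBraided_ext _ _ rfl (heq_of_eq ?_) (fun X Y => heq_of_eq ?_)
    · exact Category.id_comp _
    · exact Category.id_comp _
  assoc F G H := by
    refine laxBraided_ext _ _ rfl (heq_of_eq ?_) (fun X Y => heq_of_eq ?_)
    · exact (congrArg _ (H.toFunctor.map_comp _ _)).trans (Category.assoc _ _ _).symm
    · exact (congrArg _ (H.toFunctor.map_comp _ _)).trans (Category.assoc _ _ _).symm

/-- The lax symmetric monoidal functor `F` is strong: its structure maps are isomorphisms. -/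
def IsStrong {C D : SymMonCat.{u, v}} (F : LaxBraidedFunctor C D) : Prop :=
  IsIso (Functor.LaxMonoidal.ε F.toFunctor) ∧
    ∀ X Y : C, IsIso (Functor.LaxMonoidal.μ F.toFunctor X Y)

/-- The lax symmetric monoidal functor `F` is strict: its structure maps are identities. -/
def IsStrict {C D : SymMonCat.{u, v}} (F : LaxBraidedFunctor C D) : Prop :=
  (∃ h : 𝟙_ D = F.obj (𝟙_ C), Functor.LaxMonoidal.ε F.toFunctor = eqToHom h) ∧
    ∀ X Y : C, ∃ h : F.obj X ⊗ F.obj Y = F.obj (X ⊗ Y),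
      Functor.LaxMonoidal.μ F.toFunctor X Y = eqToHom h

/-- The symmetric monoidal category `C` is permutative: the product is strictly associative and
strictly unital, i.e. the associators and unitors are identities. -/
def IsPermutative (C : SymMonCat.{u, v}) : Prop :=
  (∀ X Y Z : C, ∃ h : (X ⊗ Y) ⊗ Z = X ⊗ (Y ⊗ Z), (α_ X Y Z).hom = eqToHom h) ∧
    (∀ X : C, ∃ h : 𝟙_ C ⊗ X = X, (λ_ X).hom = eqToHom h) ∧
      ∀ X : C, ∃ h : X ⊗ 𝟙_ C = X, (ρ_ X).hom = eqToHom h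

/-- In the presence of symmetry the first hexagon implies the second. -/
theorem hexagon_reverse_of_symm {C : Type u} [Category.{v} C] [MonoidalCategory C]
    (b : ∀ x y : C, x ⊗ y ≅ y ⊗ x) (hs : ∀ x y, (b x y).inv = (b y x).hom)
    (hex : ∀ x y z : C, (α_ x y z).hom ≫ (b x (y ⊗ z)).hom ≫ (α_ y z x).hom =
      ((b x y).hom ▷ z) ≫ (α_ y x z).hom ≫ (y ◁ (b x z).hom)) (x y z : C) :
    (α_ x y z).inv ≫ (b (x ⊗ y) z).hom ≫ (α_ z x y).inv =
      (x ◁ (b y z).hom) ≫ (α_ x z y).inv ≫ ((b x z).hom ▷ y) := by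
  have e : α_ z x y ≪≫ b z (x ⊗ y) ≪≫ α_ x y z =
      whiskerRightIso (b z x) y ≪≫ α_ x z y ≪≫ whiskerLeftIso x (b z y) :=
    Iso.ext (hex z x y)
  have e' := congrArg Iso.inv e
  simpa [hs] using e'

set_option linter.checkUnivs false in
/-- The operations of a symmetric monoidal category, without its laws. -/
structure SymMonData where
  Obj : Type u
  Hom : Obj → Obj → Type v
  id : ∀ x, Hom x x
  comp : ∀ {x y z}, Hom x y → Hom y z → Hom x z
  one : Obj
  tensor : Obj → Obj → Obj
  tensorHom : ∀ {x y x' y'}, Hom x y → Hom x' y' → Hom (tensor x x') (tensor y y')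
  assocHom : ∀ x y z, Hom (tensor (tensor x y) z) (tensor x (tensor y z))
  assocInv : ∀ x y z, Hom (tensor x (tensor y z)) (tensor (tensor x y) z)
  leftHom : ∀ x, Hom (tensor one x) x
  leftInv : ∀ x, Hom x (tensor one x)
  rightHom : ∀ x, Hom (tensor x one) x
  rightInv : ∀ x, Hom x (tensor x one)
  braid : ∀ x y, Hom (tensor x y) (tensor y x)

/-- The laws of a symmetric monoidal category. -/
structure SymMonData.Laws (A : SymMonData.{u, v}) : Prop where
  id_comp : ∀ {x y} (f : A.Hom x y), A.comp (A.id x) f = f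
  comp_id : ∀ {x y} (f : A.Hom x y), A.comp f (A.id y) = f
  assoc : ∀ {w x y z} (f : A.Hom w x) (g : A.Hom x y) (h : A.Hom y z),
    A.comp (A.comp f g) h = A.comp f (A.comp g h)
  tensor_id : ∀ x y, A.tensorHom (A.id x) (A.id y) = A.id (A.tensor x y)
  tensor_comp : ∀ {x y z x' y' z'} (f : A.Hom x y) (g : A.Hom y z) (f' : A.Hom x' y')
    (g' : A.Hom y' z'), A.tensorHom (A.comp f g) (A.comp f' g') =
      A.comp (A.tensorHom f f') (A.tensorHom g g')
  assoc_hom_inv : ∀ x y z, A.comp (A.assocHom x y z) (A.assocInv x y z) = A.id _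
  assoc_inv_hom : ∀ x y z, A.comp (A.assocInv x y z) (A.assocHom x y z) = A.id _
  left_hom_inv : ∀ x, A.comp (A.leftHom x) (A.leftInv x) = A.id _
  left_inv_hom : ∀ x, A.comp (A.leftInv x) (A.leftHom x) = A.id _
  right_hom_inv : ∀ x, A.comp (A.rightHom x) (A.rightInv x) = A.id _
  right_inv_hom : ∀ x, A.comp (A.rightInv x) (A.rightHom x) = A.id _
  assoc_nat : ∀ {x x' y y' z z'} (f : A.Hom x x') (g : A.Hom y y') (h : A.Hom z z'),
    A.comp (A.tensorHom (A.tensorHom f g) h) (A.assocHom x' y' z') =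
      A.comp (A.assocHom x y z) (A.tensorHom f (A.tensorHom g h))
  left_nat : ∀ {x y} (f : A.Hom x y),
    A.comp (A.tensorHom (A.id A.one) f) (A.leftHom y) = A.comp (A.leftHom x) f
  right_nat : ∀ {x y} (f : A.Hom x y),
    A.comp (A.tensorHom f (A.id A.one)) (A.rightHom y) = A.comp (A.rightHom x) f
  braid_nat : ∀ {x y x' y'} (f : A.Hom x y) (g : A.Hom x' y'),
    A.comp (A.tensorHom f g) (A.braid y y') = A.comp (A.braid x x') (A.tensorHom g f)
  pentagon : ∀ w x y z, A.comp (A.tensorHom (A.assocHom w x y) (A.id z))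
      (A.comp (A.assocHom w (A.tensor x y) z) (A.tensorHom (A.id w) (A.assocHom x y z))) =
    A.comp (A.assocHom (A.tensor w x) y z) (A.assocHom w x (A.tensor y z))
  triangle : ∀ x y, A.comp (A.assocHom x A.one y) (A.tensorHom (A.id x) (A.leftHom y)) =
    A.tensorHom (A.rightHom x) (A.id y)
  symmetry : ∀ x y, A.comp (A.braid x y) (A.braid y x) = A.id _
  hexagon : ∀ x y z,
    A.comp (A.assocHom x y z) (A.comp (A.braid x (A.tensor y z)) (A.assocHom y z x)) =
      A.comp (A.tensorHom (A.braid x y) (A.id z))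
        (A.comp (A.assocHom y x z) (A.tensorHom (A.id y) (A.braid x z)))

/-- The underlying category. -/
@[reducible] def SymMonData.category (A : SymMonData.{u, v}) (h : A.Laws) : Category.{v} A.Obj where
  Hom := A.Hom
  id := A.id
  comp := A.comp
  id_comp := h.id_comp
  comp_id := h.comp_id
  assoc := h.assoc

/-- The monoidal operations. -/
@[reducible] def SymMonData.monStruct (A : SymMonData.{u, v}) (h : A.Laws) :
    @MonoidalCategoryStruct A.Obj (A.category h) :=
  letI := A.category h
  { tensorObj := A.tensor
    whiskerLeft := fun x {_ _} f => A.tensorHom (A.id x) f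
    whiskerRight := fun f y => A.tensorHom f (A.id y)
    tensorHom := A.tensorHom
    tensorUnit := A.one
    associator := fun x y z =>
      ⟨A.assocHom x y z, A.assocInv x y z, h.assoc_hom_inv x y z, h.assoc_inv_hom x y z⟩
    leftUnitor := fun x => ⟨A.leftHom x, A.leftInv x, h.left_hom_inv x, h.left_inv_hom x⟩
    rightUnitor := fun x => ⟨A.rightHom x, A.rightInv x, h.right_hom_inv x, h.right_inv_hom x⟩ }

/-- The monoidal category. -/
@[reducible] def SymMonData.monoidal (A : SymMonData.{u, v}) (h : A.Laws) :
    @MonoidalCategory A.Obj (A.category h) :=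
  letI := A.category h
  letI := A.monStruct h
  MonoidalCategory.ofTensorHom (C := A.Obj) (id_tensorHom_id := h.tensor_id)
    (id_tensorHom := fun _ _ _ _ => rfl) (tensorHom_id := fun _ _ => rfl)
    (tensorHom_comp_tensorHom := fun f₁ f₂ g₁ g₂ => (h.tensor_comp f₁ g₁ f₂ g₂).symm)
    (associator_naturality := h.assoc_nat) (leftUnitor_naturality := h.left_nat)
    (rightUnitor_naturality := h.right_nat) (pentagon := h.pentagon) (triangle := h.triangle)

/-- The symmetric monoidal category with given operations satisfying the laws. -/
def SymMonData.toSymMonCat (A : SymMonData.{u, v}) (h : A.Laws) : SymMonCat.{u, v} :=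
  letI := A.category h
  letI := A.monoidal h
  { carrier := A.Obj
    cat := A.category h
    mon := A.monoidal h
    sym :=
      { braiding := fun x y => ⟨A.braid x y, A.braid y x, h.symmetry x y, h.symmetry y x⟩
        braiding_naturality_right := fun x _ _ f => h.braid_nat (A.id x) f
        braiding_naturality_left := fun f z => h.braid_nat f (A.id z)
        hexagon_forward := h.hexagon
        hexagon_reverse := hexagon_reverse_of_symm (C := A.Obj)
          (fun x y => ⟨A.braid x y, A.braid y x, h.symmetry x y, h.symmetry y x⟩)
          (fun _ _ => rfl) h.hexagon
        symmetry := h.symmetry } }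

/-- The data of a lax symmetric monoidal functor, without its laws. -/
structure LaxData (C D : SymMonCat.{u, v}) where
  obj : C → D
  map : ∀ {x y : C}, (x ⟶ y) → (obj x ⟶ obj y)
  unit : 𝟙_ D ⟶ obj (𝟙_ C)
  mul : ∀ x y : C, obj x ⊗ obj y ⟶ obj (x ⊗ y)

/-- The laws of a lax symmetric monoidal functor. -/
structure LaxData.Laws {C D : SymMonCat.{u, v}} (F : LaxData C D) : Prop where
  map_id : ∀ x : C, F.map (𝟙 x) = 𝟙 (F.obj x)
  map_comp : ∀ {x y z : C} (f : x ⟶ y) (g : y ⟶ z), F.map (f ≫ g) = F.map f ≫ F.map g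
  mul_nat : ∀ {x y x' y' : C} (f : x ⟶ y) (g : x' ⟶ y'),
    (F.map f ⊗ₘ F.map g) ≫ F.mul y y' = F.mul x x' ≫ F.map (f ⊗ₘ g)
  assoc : ∀ x y z : C, (F.mul x y ⊗ₘ 𝟙 (F.obj z)) ≫ F.mul (x ⊗ y) z ≫ F.map (α_ x y z).hom =
    (α_ (F.obj x) (F.obj y) (F.obj z)).hom ≫ (𝟙 (F.obj x) ⊗ₘ F.mul y z) ≫ F.mul x (y ⊗ z)
  left_unit : ∀ x : C,
    (λ_ (F.obj x)).hom = (F.unit ⊗ₘ 𝟙 (F.obj x)) ≫ F.mul (𝟙_ C) x ≫ F.map (λ_ x).hom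
  right_unit : ∀ x : C,
    (ρ_ (F.obj x)).hom = (𝟙 (F.obj x) ⊗ₘ F.unit) ≫ F.mul x (𝟙_ C) ≫ F.map (ρ_ x).hom
  braided : ∀ x y : C,
    F.mul x y ≫ F.map (β_ x y).hom = (β_ (F.obj x) (F.obj y)).hom ≫ F.mul y x

/-- The underlying functor. -/
def LaxData.functor {C D : SymMonCat.{u, v}} (F : LaxData C D) (h : F.Laws) : C ⥤ D where
  obj := F.obj
  map := F.map
  map_id := h.map_id
  map_comp := h.map_comp

/-- The lax symmetric monoidal functor with given data satisfying the laws. -/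
def LaxData.toHom {C D : SymMonCat.{u, v}} (F : LaxData C D) (h : F.Laws) : C ⟶ D :=
  { toFunctor := F.functor h
    laxBraided :=
      { toLaxMonoidal := Functor.LaxMonoidal.ofTensorHom (F := F.functor h) F.unit F.mul
          (μ_natural := h.mul_nat) (associativity := h.assoc) (left_unitality := h.left_unit)
          (right_unitality := h.right_unit)
        braided := h.braided } }

/-! ### Parenthesized words and the canonical isomorphisms between their values -/

/-- Formal products (with units) of letters from `α`. -/
inductive Word (α : Type) : Type
  | unit : Word α
  | leaf (a : α) : Word α
  | tensor (s t : Word α) : Word α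

namespace Word

/-- The letters of a word, from left to right. -/
def leaves {α : Type} : Word α → List α
  | unit => []
  | leaf a => [a]
  | tensor s t => s.leaves ++ t.leaves

/-- Substitution of words for letters. -/
def bind {α β : Type} : Word α → (α → Word β) → Word β
  | unit, _ => unit
  | leaf a, g => g a
  | tensor s t, g => tensor (s.bind g) (t.bind g)

/-- Relabelling of letters. -/
def map {α β : Type} (w : Word α) (f : α → β) : Word β := w.bind fun a => leaf (f a)

/-- The word `((l₀ ⊗ l₁) ⊗ l₂) ⊗ ⋯`, with all parentheses to the left. -/
def std {α : Type} : (n : ℕ) → (Fin n → α) → Word α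
  | 0, _ => unit
  | 1, l => leaf (l 0)
  | n + 2, l => tensor (std (n + 1) fun i => l i.castSucc) (leaf (l (Fin.last (n + 1))))

/-- Formal composites of the structure isomorphisms of a symmetric monoidal category. -/
inductive Path {α : Type} : Word α → Word α → Type
  | id (s) : Path s s
  | comp {s t r} : Path s t → Path t r → Path s r
  | tensor {s t s' t'} : Path s t → Path s' t' → Path (tensor s s') (tensor t t')
  | assoc (r s t) : Path (tensor (tensor r s) t) (tensor r (tensor s t))
  | assocInv (r s t) : Path (tensor r (tensor s t)) (tensor (tensor r s) t)
  | left (s) : Path (tensor unit s) s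
  | leftInv (s) : Path s (tensor unit s)
  | right (s) : Path (tensor s unit) s
  | rightInv (s) : Path s (tensor s unit)
  | braid (s t) : Path (tensor s t) (tensor t s)

/-- The right-parenthesized word on a list. -/
def ofList {α : Type} : List α → Word α
  | [] => unit
  | a :: l => tensor (leaf a) (ofList l)

theorem path_ofList_append {α : Type} (l m : List α) :
    Nonempty (Path (ofList (l ++ m)) (tensor (ofList l) (ofList m))) ∧
      Nonempty (Path (tensor (ofList l) (ofList m)) (ofList (l ++ m))) := by
  induction l with
  | nil => exact ⟨⟨Path.leftInv _⟩, ⟨Path.left _⟩⟩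
  | cons a l ih =>
    obtain ⟨⟨p⟩, ⟨q⟩⟩ := ih
    exact ⟨⟨.comp (.tensor (.id _) p) (.assocInv _ _ _)⟩,
      ⟨.comp (.assoc _ _ _) (.tensor (.id _) q)⟩⟩

theorem path_leaves {α : Type} (w : Word α) :
    Nonempty (Path w (ofList w.leaves)) ∧ Nonempty (Path (ofList w.leaves) w) := by
  induction w with
  | unit => exact ⟨⟨.id _⟩, ⟨.id _⟩⟩
  | leaf a => exact ⟨⟨.rightInv _⟩, ⟨.right _⟩⟩
  | tensor s t hs ht =>
    obtain ⟨⟨p⟩, ⟨p'⟩⟩ := hs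
    obtain ⟨⟨q⟩, ⟨q'⟩⟩ := ht
    obtain ⟨⟨r⟩, ⟨r'⟩⟩ := path_ofList_append s.leaves t.leaves
    exact ⟨⟨.comp (.tensor p q) r'⟩, ⟨.comp r (.tensor p' q')⟩⟩

theorem path_of_perm {α : Type} {l m : List α} (h : l.Perm m) :
    Nonempty (Path (ofList l) (ofList m)) := by
  induction h with
  | nil => exact ⟨.id _⟩
  | cons a _ ih => exact ih.elim fun p => ⟨.tensor (.id _) p⟩
  | swap a b l =>
    exact ⟨.comp (.assocInv _ _ _) (.comp (.tensor (.braid _ _) (.id _)) (.assoc _ _ _))⟩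
  | trans _ _ h₁ h₂ => exact h₁.elim fun p => h₂.elim fun q => ⟨.comp p q⟩

/-- Words with the same letters up to order are connected by structure isomorphisms. -/
theorem exists_path {α : Type} {w w' : Word α} (h : w.leaves.Perm w'.leaves) :
    Nonempty (Path w w') := by
  obtain ⟨⟨p⟩, -⟩ := path_leaves w
  obtain ⟨-, ⟨q⟩⟩ := path_leaves w'
  obtain ⟨r⟩ := path_of_perm h
  exact ⟨.comp p (.comp r q)⟩

theorem leaves_bind {α β : Type} (w : Word α) (g : α → Word β) :
    (w.bind g).leaves = w.leaves.flatMap fun a => (g a).leaves := by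
  induction w with
  | unit => rfl
  | leaf a => simp [bind, leaves]
  | tensor s t hs ht => simp [bind, leaves, hs, ht]

theorem leaves_map {α β : Type} (w : Word α) (f : α → β) :
    (w.map f).leaves = w.leaves.map f := by
  simp only [map, leaves_bind, leaves]
  induction w.leaves with
  | nil => rfl
  | cons a l ih => simp [ih]

theorem leaves_std {α : Type} (n : ℕ) (l : Fin n → α) : (std n l).leaves = List.ofFn l := by
  induction n with
  | zero => simp [std, leaves]
  | succ n ih =>
    cases n with
    | zero => simp [std, leaves]
    | succ n => rw [std, leaves, ih, List.ofFn_succ' l, leaves, List.concat_eq_append]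

section Eval

variable {C : Type u} [Category.{v} C] [MonoidalCategory C]

/-- The object obtained from a word by putting objects of `C` for the letters. -/
def eval {α : Type} : Word α → (α → C) → C
  | unit, _ => 𝟙_ C
  | leaf a, X => X a
  | tensor s t, X => s.eval X ⊗ t.eval X

/-- Words act as functors. -/
def evalMap {α : Type} : (w : Word α) → {X Z : α → C} → (∀ a, X a ⟶ Z a) → (w.eval X ⟶ w.eval Z)
  | unit, _, _, _ => 𝟙 _
  | leaf a, _, _, φ => φ a
  | tensor s t, _, _, φ => s.evalMap φ ⊗ₘ t.evalMap φ

/-- The value of a substituted word. All components of this isomorphism are identities. -/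
def bindIso {α β : Type} : (w : Word α) → (g : α → Word β) → (Z : β → C) →
    ((w.bind g).eval Z ≅ w.eval fun a => (g a).eval Z)
  | unit, _, _ => Iso.refl _
  | leaf _, _, _ => Iso.refl _
  | tensor s t, g, Z => s.bindIso g Z ⊗ᵢ t.bindIso g Z

/-- The value of a relabelled word. All components of this isomorphism are identities. -/
def mapIso {α β : Type} (w : Word α) (f : α → β) (Z : β → C) :
    (w.map f).eval Z ≅ w.eval fun a => Z (f a) :=
  w.bindIso (fun a => leaf (f a)) Z

/-- The isomorphism in `C` given by a formal composite of structure isomorphisms. -/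
def Path.eval {α : Type} [BraidedCategory C] : {w w' : Word α} → Path w w' → (X : α → C) →
    (w.eval X ⟶ w'.eval X)
  | _, _, .id _, _ => 𝟙 _
  | _, _, .comp p q, X => p.eval X ≫ q.eval X
  | _, _, .tensor p q, X => p.eval X ⊗ₘ q.eval X
  | _, _, .assoc r s t, X => (α_ (r.eval X) (s.eval X) (t.eval X)).hom
  | _, _, .assocInv r s t, X => (α_ (r.eval X) (s.eval X) (t.eval X)).inv
  | _, _, .left s, X => (λ_ (s.eval X)).hom
  | _, _, .leftInv s, X => (λ_ (s.eval X)).inv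
  | _, _, .right s, X => (ρ_ (s.eval X)).hom
  | _, _, .rightInv s, X => (ρ_ (s.eval X)).inv
  | _, _, .braid s t, X => (β_ (s.eval X) (t.eval X)).hom

end Eval

/-- The map `w(F X) ⟶ F (w X)` built from the structure maps of a lax monoidal functor. -/
def lax {C D : SymMonCat.{u, v}} {α : Type} (F : LaxBraidedFunctor C D) :
    (w : Word α) → (X : α → C) → ((w.eval fun a => F.obj (X a)) ⟶ F.obj (w.eval X))
  | unit, _ => Functor.LaxMonoidal.ε F.toFunctor
  | leaf a, X => 𝟙 (F.obj (X a))
  | tensor s t, X =>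
    (lax F s X ⊗ₘ lax F t X) ≫ Functor.LaxMonoidal.μ F.toFunctor (s.eval X) (t.eval X)

end Word

/-- Ways of multiplying a family of objects indexed by `α`: words in which every letter occurs
exactly once (units may occur any number of times). For `α = Fin n` these are the objects of the
component `Y(n)` of the categorical operad whose algebras are symmetric monoidal categories. -/
structure LinWord (α : Type) where
  word : Word α
  nodup : word.leaves.Nodup
  mem : ∀ a, a ∈ word.leaves

namespace LinWord

/-- Relabelling along a bijection. -/
def map {α β : Type} (w : LinWord α) (e : α ≃ β) : LinWord β where
  word := w.word.map e
  nodup := by rw [Word.leaves_map]; exact w.nodup.map e.injective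
  mem b := by
    rw [Word.leaves_map]
    exact List.mem_map.2 ⟨e.symm b, w.mem _, e.apply_symm_apply b⟩

/-- The product of a single letter. -/
def one : LinWord (Fin 1) where
  word := .leaf 0
  nodup := by simp [Word.leaves]
  mem a := by simp [Word.leaves, Subsingleton.elim a 0]

/-- The left-parenthesized product of `n` letters. -/
def std (n : ℕ) : LinWord (Fin n) where
  word := .std n id
  nodup := by rw [Word.leaves_std]; exact List.nodup_ofFn.2 Function.injective_id
  mem a := by rw [Word.leaves_std]; exact (List.mem_ofFn' _ _).2 ⟨a, rfl⟩

/-- The product of two words in disjoint letters. -/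
def tensor {α β : Type} (s : LinWord α) (t : LinWord β) : LinWord (α ⊕ β) where
  word := .tensor (s.word.map Sum.inl) (t.word.map Sum.inr)
  nodup := by
    rw [Word.leaves, Word.leaves_map, Word.leaves_map]
    refine (s.nodup.map Sum.inl_injective).append (t.nodup.map Sum.inr_injective) ?_
    intro a h₁ h₂
    simp only [List.mem_map] at h₁ h₂
    obtain ⟨_, _, rfl⟩ := h₁
    obtain ⟨_, _, h⟩ := h₂
    cases h
  mem a := by
    rw [Word.leaves, Word.leaves_map, Word.leaves_map]
    rcases a with a | b
    · simp [s.mem a]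
    · simp [t.mem b]

/-- Operadic substitution of words in disjoint letters. -/
def sub {β : Type} {γ : β → Type} (w : LinWord β) (g : ∀ b, LinWord (γ b)) :
    LinWord (Σ b, γ b) where
  word := w.word.bind fun b => (g b).word.map (Sigma.mk b)
  nodup := by
    rw [Word.leaves_bind, List.nodup_flatMap]
    refine ⟨fun b _ => ?_, w.nodup.imp ?_⟩
    · rw [Word.leaves_map]; exact (g b).nodup.map sigma_mk_injective
    · intro b b' hb a h₁ h₂
      simp only [Word.leaves_map, List.mem_map] at h₁ h₂
      obtain ⟨_, _, rfl⟩ := h₁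
      obtain ⟨_, _, h⟩ := h₂
      exact hb (congrArg Sigma.fst h).symm
  mem a := by
    rw [Word.leaves_bind, List.mem_flatMap]
    exact ⟨a.1, w.mem _, by rw [Word.leaves_map]; exact List.mem_map.2 ⟨a.2, (g _).mem _, rfl⟩⟩

theorem perm {α : Type} (w w' : LinWord α) : w.word.leaves.Perm w'.word.leaves :=
  (List.perm_ext_iff_of_nodup w.nodup w'.nodup).2 fun a => iff_of_true (w.mem a) (w'.mem a)

section Canon

variable {C : Type u} [Category.{v} C] [MonoidalCategory C] [SymmetricCategory C]

/-- The value of a product. -/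
abbrev eval {α : Type} (w : LinWord α) (X : α → C) : C := w.word.eval X

/-- The canonical isomorphism between two products of the same objects. Any two formal composites
of structure isomorphisms between the two words have the same value, by coherence, so that it does
not matter which one is used. The bijection `e` matches the letters of the two words. -/
def canon {α β : Type} (w : LinWord α) (w' : LinWord β) (e : α ≃ β) {X : α → C} {Z : β → C}
    (h : ∀ a, X a = Z (e a)) : w.eval X ⟶ w'.eval Z :=
  w.word.evalMap (fun a => eqToHom (h a)) ≫ (w.word.mapIso e Z).inv ≫
    (Classical.choice (Word.exists_path (perm (w.map e) w'))).eval Z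

/-- The value of a substituted word, followed by maps from the values of the inner words. -/
def subMap {β : Type} {γ : β → Type} (w : LinWord β) (g : ∀ b, LinWord (γ b))
    {Z : (Σ b, γ b) → C} {Y : β → C} (φ : ∀ b, (g b).eval (fun c => Z ⟨b, c⟩) ⟶ Y b) :
    (w.sub g).eval Z ⟶ w.eval Y :=
  (w.word.bindIso _ Z).hom ≫ w.word.evalMap fun b => ((g b).word.mapIso (Sigma.mk b) Z).hom ≫ φ b

/-- The value of the product of two words. -/
def tensorIso {α β : Type} (s : LinWord α) (t : LinWord β) (X : α → C) (Y : β → C) :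
    (s.tensor t).eval (Sum.elim X Y) ≅ s.eval X ⊗ t.eval Y :=
  s.word.mapIso Sum.inl (Sum.elim X Y) ⊗ᵢ t.word.mapIso Sum.inr (Sum.elim X Y)

end Canon

end LinWord

/-! ### Multicategories -/

/-- Concatenation of tuples. -/
def concat {O : Type u} {n : ℕ} {j : Fin n → ℕ} (x : ∀ s, Fin (j s) → O) : Fin (∑ s, j s) → O :=
  fun k => x (finSigmaFinEquiv.symm k).1 (finSigmaFinEquiv.symm k).2

/-- The bijection of positions in concatenated tuples given by a bijection of pairs (block,
position in the block); `finSigmaFinEquiv` orders such pairs lexicographically. -/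
def blockEquiv {n m : ℕ} {j : Fin n → ℕ} {k : Fin m → ℕ}
    (e : (Σ s, Fin (j s)) ≃ Σ t, Fin (k t)) : Fin (∑ s, j s) ≃ Fin (∑ t, k t) :=
  finSigmaFinEquiv.symm.trans (e.trans finSigmaFinEquiv)

theorem concat_mk {O : Type u} {n : ℕ} {j : Fin n → ℕ} (x : ∀ s, Fin (j s) → O)
    (p : Σ s, Fin (j s)) : concat x (finSigmaFinEquiv p) = x p.1 p.2 :=
  congrArg (fun p : Σ s, Fin (j s) => x p.1 p.2) (finSigmaFinEquiv.symm_apply_apply p)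

theorem concat_block {O : Type u} {n m : ℕ} {j : Fin n → ℕ} {k : Fin m → ℕ}
    {x : ∀ s, Fin (j s) → O} {x' : ∀ t, Fin (k t) → O}
    (e : (Σ s, Fin (j s)) ≃ Σ t, Fin (k t)) (h : ∀ p, x p.1 p.2 = x' (e p).1 (e p).2)
    (i : Fin (∑ s, j s)) : concat x i = concat x' (blockEquiv e i) :=
  (h _).trans (concat_mk x' _).symm

set_option linter.checkUnivs false in
/-- The operations of a (symmetric) multicategory, without its laws: multimorphisms with a finite
list of sources and one target, identities, the action of permutations, and composition.

The map `perm σ h` is the action of `σ`, from the multimorphisms with source `x` to those with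
source `x ∘ σ`. A bijection from `Fin n` to `Fin m` forces `n = m`; the two arities and the two
expressions `x'` and `x ∘ σ` for the new source are only kept apart so that they need not be
syntactically the same. In particular, if `σ` preserves the order, `perm σ h` is the transport
along an equality of sources. -/
structure MultiData where
  Obj : Type u
  Hom : ∀ {n : ℕ}, (Fin n → Obj) → Obj → Type v
  id : ∀ a : Obj, Hom (fun _ : Fin 1 => a) a
  perm : ∀ {m n : ℕ} {x : Fin m → Obj} {x' : Fin n → Obj} {y : Obj} (σ : Fin n ≃ Fin m)
    (_ : ∀ i, x' i = x (σ i)), Hom x y → Hom x' y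
  comp : ∀ {n : ℕ} {j : Fin n → ℕ} {x : ∀ s, Fin (j s) → Obj} {y : Fin n → Obj} {z : Obj},
    Hom y z → (∀ s, Hom (x s) (y s)) → Hom (concat x) z

/-- The laws of a multicategory: the permutations act, composition is unital and associative (up to
the order preserving identification of the sources), and composition is equivariant, both in the
outer multimorphism and in the inner ones. -/
structure MultiData.Laws (M : MultiData.{u, v}) : Prop where
  perm_refl : ∀ {n : ℕ} {x : Fin n → M.Obj} {y : M.Obj} (φ : M.Hom x y),
    M.perm (Equiv.refl _) (fun _ => rfl) φ = φ
  perm_perm : ∀ {l m n : ℕ} {x : Fin l → M.Obj} {x' : Fin m → M.Obj} {x'' : Fin n → M.Obj}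
    {y : M.Obj} (σ : Fin m ≃ Fin l) (τ : Fin n ≃ Fin m) (h : ∀ i, x' i = x (σ i))
    (h' : ∀ i, x'' i = x' (τ i)) (φ : M.Hom x y),
    M.perm τ h' (M.perm σ h φ) = M.perm (τ.trans σ) (fun i => (h' i).trans (h (τ i))) φ
  comp_id : ∀ {n : ℕ} {y : Fin n → M.Obj} {z : M.Obj} (ψ : M.Hom y z),
    M.comp ψ (fun s => M.id (y s)) =
      M.perm (finSigmaFinEquiv.symm.trans (Equiv.sigmaUnique (Fin n) fun _ => Fin 1))
        (fun _ => rfl) ψ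
  id_comp : ∀ {n : ℕ} {x : Fin n → M.Obj} {z : M.Obj} (φ : M.Hom x z),
    M.comp (M.id z) (fun _ => φ) =
      M.perm (x' := concat fun _ : Fin 1 => x)
        (finSigmaFinEquiv.symm.trans
          ((Equiv.sigmaEquivProd (Fin 1) (Fin n)).trans (Equiv.uniqueProd (Fin n) (Fin 1))))
        (fun _ => rfl) φ
  assoc : ∀ {n : ℕ} {j : Fin n → ℕ} {i : ∀ s, Fin (j s) → ℕ}
    {x : ∀ s t, Fin (i s t) → M.Obj} {y : ∀ s, Fin (j s) → M.Obj} {z : Fin n → M.Obj} {w : M.Obj}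
    (ψ : M.Hom z w) (φ : ∀ s, M.Hom (y s) (z s)) (χ : ∀ s t, M.Hom (x s t) (y s t)),
    M.comp (M.comp ψ φ)
        (fun k => χ (finSigmaFinEquiv.symm k).1 (finSigmaFinEquiv.symm k).2) =
      M.perm (blockEquiv ((Equiv.sigmaCongrLeft (β := fun p : Σ s, Fin (j s) => Fin (i p.1 p.2))
          finSigmaFinEquiv.symm).trans ((Equiv.sigmaAssoc fun s t => Fin (i s t)).trans
            (Equiv.sigmaCongrRight fun _ => finSigmaFinEquiv))))
        (concat_block _ fun p => (concat_mk (x (finSigmaFinEquiv.symm p.1).1)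
          ⟨(finSigmaFinEquiv.symm p.1).2, p.2⟩).symm)
        (M.comp ψ fun s => M.comp (φ s) (χ s))
  outer_equivariant : ∀ {m n : ℕ} {j : Fin m → ℕ} {x : ∀ s, Fin (j s) → M.Obj}
    {y : Fin m → M.Obj} {z : M.Obj} (σ : Fin n ≃ Fin m) (ψ : M.Hom y z)
    (φ : ∀ s, M.Hom (x s) (y s)),
    M.comp (M.perm (x' := fun i => y (σ i)) σ (fun _ => rfl) ψ) (fun i => φ (σ i)) =
      M.perm (blockEquiv (Equiv.sigmaCongrLeft (β := fun s => Fin (j s)) σ))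
        (concat_block _ fun _ => rfl) (M.comp ψ φ)
  inner_equivariant : ∀ {n : ℕ} {j j' : Fin n → ℕ} {x : ∀ s, Fin (j s) → M.Obj}
    {y : Fin n → M.Obj} {z : M.Obj} (ψ : M.Hom y z) (τ : ∀ s, Fin (j' s) ≃ Fin (j s))
    (φ : ∀ s, M.Hom (x s) (y s)),
    M.comp ψ (fun s => M.perm (x' := fun i => x s (τ s i)) (τ s) (fun _ => rfl) (φ s)) =
      M.perm (blockEquiv (Equiv.sigmaCongrRight τ))
        (concat_block _ fun _ => rfl) (M.comp ψ φ)

set_option linter.checkUnivs false in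
/-- A multicategory. -/
structure Multicat extends MultiData.{u, v} where
  laws : toMultiData.Laws

/-- The data of a multifunctor, without its laws. -/
structure MultifunctorData (M N : MultiData.{u, v}) where
  obj : M.Obj → N.Obj
  map : ∀ {n : ℕ} {x : Fin n → M.Obj} {y : M.Obj},
    M.Hom x y → N.Hom (fun i => obj (x i)) (obj y)

/-- The laws of a multifunctor. -/
structure MultifunctorData.Laws {M N : MultiData.{u, v}} (F : MultifunctorData M N) : Prop where
  map_id : ∀ a : M.Obj, F.map (M.id a) = N.id (F.obj a)
  map_perm : ∀ {m n : ℕ} {x : Fin m → M.Obj} {x' : Fin n → M.Obj} {y : M.Obj} (σ : Fin n ≃ Fin m)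
    (h : ∀ i, x' i = x (σ i)) (φ : M.Hom x y),
    F.map (M.perm σ h φ) = N.perm σ (fun i => congrArg F.obj (h i)) (F.map φ)
  map_comp : ∀ {n : ℕ} {j : Fin n → ℕ} {x : ∀ s, Fin (j s) → M.Obj} {y : Fin n → M.Obj}
    {z : M.Obj} (ψ : M.Hom y z) (φ : ∀ s, M.Hom (x s) (y s)),
    F.map (M.comp ψ φ) = N.comp (F.map ψ) fun s => F.map (φ s)

/-- A multifunctor. -/
@[ext] structure Multifunctor (M N : MultiData.{u, v}) extends MultifunctorData M N where
  laws : toMultifunctorData.Laws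

/-- The category of multicategories and multifunctors. -/
instance : Category Multicat.{u, v} where
  Hom M N := Multifunctor M.toMultiData N.toMultiData
  id M :=
    { obj := fun x => x
      map := fun φ => φ
      laws := ⟨fun _ => rfl, fun _ _ _ => rfl, fun _ _ => rfl⟩ }
  comp {M N P} F G :=
    { obj := fun x => G.obj (F.obj x)
      map := fun φ => G.map (F.map φ)
      laws :=
        ⟨fun a => (congrArg G.map (F.laws.map_id a)).trans (G.laws.map_id _),
          fun σ h φ => (congrArg G.map (F.laws.map_perm σ h φ)).trans (G.laws.map_perm _ _ _),
          fun ψ φ => (congrArg G.map (F.laws.map_comp ψ φ)).trans (G.laws.map_comp _ _)⟩ }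

/-! ### The underlying multicategory of a symmetric monoidal category -/

set_option linter.checkUnivs false in
/-- A choice, for every symmetric monoidal category `C` and every tuple of objects of `C`, of a way
of multiplying this tuple. The choices need not be related to each other in any way. -/
def Choices : Type (max (u + 1) (v + 1)) :=
  ∀ (C : SymMonCat.{u, v}) (n : ℕ), (Fin n → C) → LinWord (Fin n)

/-- The product of a tuple of objects that has been chosen. -/
abbrev Choices.prod (κ : Choices.{u, v}) (C : SymMonCat.{u, v}) {n : ℕ} (x : Fin n → C) : C :=
  (κ C n x).eval x

/-- The operations of the underlying multicategory: a multimorphism from `x` to `y` is a morphism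
from the chosen product of `x` to `y`. -/
def underlyingData (κ : Choices.{u, v}) (C : SymMonCat.{u, v}) : MultiData.{u, v} where
  Obj := C
  Hom x y := κ.prod C x ⟶ y
  id a := (κ C 1 fun _ => a).canon LinWord.one (Equiv.refl _) (X := fun _ => a) (Z := fun _ => a)
    fun _ => rfl
  perm {m n x x' _} σ h φ := (κ C n x').canon (κ C m x) σ h ≫ φ
  comp {n j x y _} ψ φ :=
    (κ C (∑ s, j s) (concat x)).canon ((κ C n y).sub fun s => κ C (j s) (x s))
        finSigmaFinEquiv.symm (Z := fun p : Σ s, Fin (j s) => x p.1 p.2) (fun _ => rfl) ≫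
      (κ C n y).subMap (fun s => κ C (j s) (x s)) φ ≫ ψ

/-- The multifunctor given by a lax symmetric monoidal functor `F`: a morphism `φ` from the product
of `x` to `y` goes to the composite of `F φ` with the map to `F` of the product of `x` from the
product of the `F (x i)`. -/
def underlyingMapData (κ : Choices.{u, v}) {C D : SymMonCat.{u, v}} (F : LaxBraidedFunctor C D) :
    MultifunctorData (underlyingData κ C) (underlyingData κ D) where
  obj x := F.obj x
  map {n x _} φ :=
    (κ D n fun i => F.obj (x i)).canon (κ C n x) (Equiv.refl _) (fun _ => rfl) ≫
      (κ C n x).word.lax F x ≫ F.map φ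

/-- The underlying multicategories are multicategories, and this is functorial. -/
structure UnderlyingLaws (κ : Choices.{u, v}) : Prop where
  obj : ∀ C : SymMonCat.{u, v}, (underlyingData κ C).Laws
  map : ∀ {C D : SymMonCat.{u, v}} (F : C ⟶ D), (underlyingMapData κ F).Laws
  map_id : ∀ C : SymMonCat.{u, v}, underlyingMapData κ (𝟙 C) = ⟨fun x => x, fun φ => φ⟩
  map_comp : ∀ {C D E : SymMonCat.{u, v}} (F : C ⟶ D) (G : D ⟶ E),
    underlyingMapData κ (F ≫ G) =
      ⟨fun x => (underlyingMapData κ G).obj ((underlyingMapData κ F).obj x),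
        fun φ => (underlyingMapData κ G).map ((underlyingMapData κ F).map φ)⟩

/-- The forgetful functor from symmetric monoidal categories and lax symmetric monoidal functors to
multicategories and multifunctors. -/
def underlying (κ : Choices.{u, v}) (h : UnderlyingLaws κ) :
    SymMonCat.{u, v} ⥤ Multicat.{u, v} where
  obj C := ⟨underlyingData κ C, h.obj C⟩
  map F := ⟨underlyingMapData κ F, h.map F⟩
  map_id C := Multifunctor.ext (congrArg MultifunctorData.obj (h.map_id C))
    (congr_arg_heq (fun d : MultifunctorData _ _ => @d.map) (h.map_id C))
  map_comp F G := Multifunctor.ext (congrArg MultifunctorData.obj (h.map_comp F G))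
    (congr_arg_heq (fun d : MultifunctorData _ _ => @d.map) (h.map_comp F G))

/-! ### The symmetric monoidal category generated by a multicategory -/

/-- The bijection that enumerates a fibre of `f` in increasing order. -/
def fibEnum {j n : ℕ} (f : Fin j → Fin n) (s : Fin n) :
    Fin (Finset.univ.filter fun r => f r = s).card ≃ {r // f r = s} :=
  ((Finset.univ.filter fun r => f r = s).orderIsoOfFin rfl).toEquiv.trans
    (Equiv.subtypeEquivRight fun r => by simp)

/-- The subtuple of `x` consisting of the entries with index in a fibre of `f`. -/
def fibTuple {O : Type u} {j n : ℕ} (x : Fin j → O) (f : Fin j → Fin n) (s : Fin n) :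
    Fin (Finset.univ.filter fun r => f r = s).card → O :=
  fun k => x (fibEnum f s k).1

/-- A fibre of a composite function is the disjoint union of fibres. -/
def fibComp {j n p : ℕ} (f : Fin j → Fin n) (g : Fin n → Fin p) (t : Fin p) :
    Fin (Finset.univ.filter fun r => g (f r) = t).card ≃
      Σ k : Fin (Finset.univ.filter fun s => g s = t).card,
        Fin (Finset.univ.filter fun r => f r = (fibEnum g t k).1).card :=
  (fibEnum (fun r => g (f r)) t).trans
    ((Equiv.sigmaSubtypeFiberEquivSubtype (p := fun r => g (f r) = t) (q := fun s => g s = t) f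
        fun _ => Iff.rfl).symm.trans
      ((Equiv.sigmaCongrLeft (β := fun s : {s // g s = t} => {r // f r = s.1})
          (fibEnum g t)).symm.trans
        (Equiv.sigmaCongrRight fun k => (fibEnum f (fibEnum g t k).1).symm)))

theorem fibComp_spec {j n p : ℕ} (f : Fin j → Fin n) (g : Fin n → Fin p) (t : Fin p)
    (k : Fin (Finset.univ.filter fun r => g (f r) = t).card) :
    (fibEnum f _ (fibComp f g t k).2).1 = (fibEnum (fun r => g (f r)) t k).1 := by
  obtain ⟨q, rfl⟩ := (fibComp f g t).symm.surjective k
  have h₁ := congrArg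
    (fun q : Σ k : Fin (Finset.univ.filter fun s => g s = t).card,
      Fin (Finset.univ.filter fun r => f r = (fibEnum g t k).1).card => (fibEnum f _ q.2).1)
    ((fibComp f g t).apply_symm_apply q)
  have h₂ : (fibComp f g t).symm q = (fibEnum (fun r => g (f r)) t).symm
      ⟨(fibEnum f (fibEnum g t q.1).1 q.2).1,
        (congrArg g (fibEnum f (fibEnum g t q.1).1 q.2).2).trans (fibEnum g t q.1).2⟩ := rfl
  rw [h₂, Equiv.apply_symm_apply, ← h₂]
  exact h₁

/-- Transport of a multimorphism along a map of indices that is bijective between two fibres. -/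
def fibTransport (M : MultiData.{u, v}) {a b c d : ℕ} {x : Fin a → M.Obj} {x' : Fin b → M.Obj}
    {f : Fin a → Fin c} {f' : Fin b → Fin d} {s : Fin c} {s' : Fin d} {y : M.Obj}
    (i : Fin a → Fin b) (hi : Set.BijOn i {r | f r = s} {r | f' r = s'})
    (hx : ∀ r, x' (i r) = x r) (φ : M.Hom (fibTuple x f s) y) : M.Hom (fibTuple x' f' s') y :=
  M.perm ((fibEnum f' s').trans ((Set.BijOn.equiv i hi).symm.trans (fibEnum f s).symm))
    (fun k => by
      obtain ⟨k, rfl⟩ := (fibEnum f' s').symm.surjective k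
      obtain ⟨r, rfl⟩ := (Set.BijOn.equiv i hi).surjective k
      rw [fibTuple, fibTuple, Equiv.trans_apply, Equiv.trans_apply, Equiv.apply_symm_apply,
        Equiv.symm_apply_apply, Equiv.apply_symm_apply]
      exact hx r.1) φ

/-- The block sum of functions. -/
def sumFn {a b c d : ℕ} (f : Fin a → Fin c) (g : Fin b → Fin d) : Fin (a + b) → Fin (c + d) :=
  Fin.addCases (fun r => Fin.castAdd d (f r)) fun r => Fin.natAdd c (g r)

theorem sumFn_left {a b c d : ℕ} (f : Fin a → Fin c) (g : Fin b → Fin d) (s : Fin c) :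
    Set.BijOn (Fin.castAdd b) {r | f r = s} {r | sumFn f g r = Fin.castAdd d s} := by
  refine ⟨fun r hr => ?_, fun r _ r' _ h => Fin.castAdd_injective _ _ h, fun r hr => ?_⟩
  · have : f r = s := hr
    simp [sumFn, this]
  · induction r using Fin.addCases with
    | left r => exact ⟨r, by simpa [sumFn] using hr, rfl⟩
    | right r =>
      have h : Fin.natAdd c (g r) = Fin.castAdd d s := by simpa [sumFn] using hr
      have := congrArg Fin.val h
      simp only [Fin.val_natAdd, Fin.val_castAdd] at this
      omega

theorem sumFn_right {a b c d : ℕ} (f : Fin a → Fin c) (g : Fin b → Fin d) (s : Fin d) :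
    Set.BijOn (Fin.natAdd a) {r | g r = s} {r | sumFn f g r = Fin.natAdd c s} := by
  refine ⟨fun r hr => ?_, fun r _ r' _ h => Fin.natAdd_injective _ _ h, fun r hr => ?_⟩
  · have : g r = s := hr
    simp [sumFn, this]
  · induction r using Fin.addCases with
    | right r => exact ⟨r, by simpa [sumFn] using hr, rfl⟩
    | left r =>
      have h : Fin.castAdd d (f r) = Fin.natAdd c s := by simpa [sumFn] using hr
      have := congrArg Fin.val h
      simp only [Fin.val_natAdd, Fin.val_castAdd] at this
      omega

/-- Transport of a multimorphism along an equality of targets. -/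
def castTarget (M : MultiData.{u, v}) {n : ℕ} {x : Fin n → M.Obj} {y y' : M.Obj} (h : y = y')
    (φ : M.Hom x y) : M.Hom x y' :=
  h ▸ φ

/-- Tuples of objects of `M`. -/
abbrev FreeObj (M : MultiData.{u, v}) : Type u := Σ n : ℕ, Fin n → M.Obj

/-- A morphism of tuples from `x` to `y`: a function `f` of indices and, for every index `s` of
`y`, a multimorphism to `y s` from the subtuple of `x` given by the fibre of `f` over `s`. -/
@[ext] structure FreeHom (M : MultiData.{u, v}) (x y : FreeObj M) : Type v where
  fn : Fin x.1 → Fin y.1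
  mor : ∀ s, M.Hom (fibTuple x.2 fn s) (y.2 s)

namespace FreeHom

variable {M : MultiData.{u, v}}

/-- The morphism that only rearranges the entries of a tuple by a bijection. -/
def ofEquiv {x y : FreeObj M} (e : Fin x.1 ≃ Fin y.1) (h : ∀ r, x.2 r = y.2 (e r)) :
    FreeHom M x y where
  fn := e
  mor s := M.perm (m := 1)
    ((fibEnum e s).trans (@Equiv.ofUnique _ _ ⟨⟨⟨e.symm s, e.apply_symm_apply s⟩⟩,
      fun r => Subtype.ext (by simp [← r.2])⟩ _))
    (fun k => (h _).trans (congrArg y.2 (fibEnum e s k).2)) (M.id (y.2 s))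

/-- The identity. -/
def id (x : FreeObj M) : FreeHom M x x := ofEquiv (Equiv.refl _) fun _ => rfl

/-- Composition. -/
def comp {x y z : FreeObj M} (φ : FreeHom M x y) (ψ : FreeHom M y z) : FreeHom M x z where
  fn r := ψ.fn (φ.fn r)
  mor t := M.perm ((fibComp φ.fn ψ.fn t).trans finSigmaFinEquiv)
    (fun k => by
      rw [Equiv.trans_apply, concat_mk, fibTuple, fibTuple, fibComp_spec])
    (M.comp (ψ.mor t) fun k => φ.mor (fibEnum ψ.fn t k).1)

/-- The concatenation of tuples. -/
def append (x y : FreeObj M) : FreeObj M := ⟨x.1 + y.1, Fin.append x.2 y.2⟩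

/-- The concatenation of morphisms. -/
def tensorHom {x y x' y' : FreeObj M} (φ : FreeHom M x y) (ψ : FreeHom M x' y') :
    FreeHom M (append x x') (append y y') where
  fn := sumFn φ.fn ψ.fn
  mor := Fin.addCases
    (fun s => castTarget M (Fin.append_left y.2 y'.2 s).symm
      (fibTransport M (Fin.castAdd x'.1) (sumFn_left _ _ s) (fun r => Fin.append_left x.2 x'.2 r) (φ.mor s)))
    (fun s => castTarget M (Fin.append_right y.2 y'.2 s).symm
      (fibTransport M (Fin.natAdd x.1) (sumFn_right _ _ s) (fun r => Fin.append_right x.2 x'.2 r) (ψ.mor s)))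

/-- The morphism to a tuple of length one given by a multimorphism. -/
def ofMulti {n : ℕ} {x : Fin n → M.Obj} {y : M.Obj} (φ : M.Hom x y) :
    FreeHom M ⟨n, x⟩ ⟨1, fun _ => y⟩ where
  fn _ := 0
  mor s := M.perm ((fibEnum (fun _ => 0) s).trans
    (Equiv.subtypeUnivEquiv fun _ => Subsingleton.elim _ _)) (fun _ => rfl) φ

/-- The effect of a multifunctor. -/
def mapMulti {N : MultiData.{u, v}} (F : MultifunctorData M N) {x y : FreeObj M}
    (φ : FreeHom M x y) :
    FreeHom N ⟨x.1, fun i => F.obj (x.2 i)⟩ ⟨y.1, fun i => F.obj (y.2 i)⟩ where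
  fn := φ.fn
  mor s := F.map (φ.mor s)

end FreeHom

/-- The operations of the symmetric monoidal category generated by a multicategory: the product is
concatenation, the unit is the empty tuple, associators and unitors do not move any entries, and
the symmetry exchanges the two parts of a concatenation. -/
def freeData (M : MultiData.{u, v}) : SymMonData.{u, v} where
  Obj := FreeObj M
  Hom := FreeHom M
  id := FreeHom.id
  comp := FreeHom.comp
  one := ⟨0, Fin.elim0⟩
  tensor := FreeHom.append
  tensorHom := FreeHom.tensorHom
  assocHom x y z := .ofEquiv (finCongr (Nat.add_assoc x.1 y.1 z.1)) fun r =>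
    congrFun (Fin.append_assoc x.2 y.2 z.2) r
  assocInv x y z := .ofEquiv (finCongr (Nat.add_assoc x.1 y.1 z.1).symm) fun r =>
    (congrFun (Fin.append_assoc x.2 y.2 z.2) (Fin.cast (Nat.add_assoc x.1 y.1 z.1).symm r)).symm
  leftHom x := .ofEquiv (finCongr (Nat.zero_add x.1)) fun r =>
    congrFun (Fin.elim0_append x.2) r
  leftInv x := .ofEquiv (finCongr (Nat.zero_add x.1).symm) fun r =>
    (congrFun (Fin.elim0_append x.2) (Fin.cast (Nat.zero_add x.1).symm r)).symm
  rightHom x := .ofEquiv (finCongr (Nat.add_zero x.1)) fun r =>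
    congrFun (Fin.append_elim0 x.2) r
  rightInv x := .ofEquiv (finCongr (Nat.add_zero x.1).symm) fun r =>
    (congrFun (Fin.append_elim0 x.2) (Fin.cast (Nat.add_zero x.1).symm r)).symm
  braid x y := .ofEquiv finAddFlip fun r => by
    induction r using Fin.addCases with
    | left r =>
      exact (Fin.append_left x.2 y.2 r).trans
        ((Fin.append_right y.2 x.2 r).symm.trans
          (congrArg (Fin.append y.2 x.2) (finAddFlip_apply_castAdd r y.1).symm))
    | right r =>
      exact (Fin.append_right x.2 y.2 r).trans
        ((Fin.append_left y.2 x.2 r).symm.trans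
          (congrArg (Fin.append y.2 x.2) (finAddFlip_apply_natAdd r x.1).symm))

/-- The symmetric monoidal category generated by a multicategory. -/
def freeObj (h : ∀ M : Multicat.{u, v}, (freeData M.toMultiData).Laws) (M : Multicat.{u, v}) :
    SymMonCat.{u, v} :=
  (freeData M.toMultiData).toSymMonCat (h M)

/-- The symmetric monoidal functor given by a multifunctor, with structure maps that do not move
any entries. -/
def freeMapData (h : ∀ M : Multicat.{u, v}, (freeData M.toMultiData).Laws)
    {M N : Multicat.{u, v}} (F : MultifunctorData M.toMultiData N.toMultiData) :
    LaxData (freeObj h M) (freeObj h N) where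
  obj (x : FreeObj M.toMultiData) :=
    (⟨x.1, fun i => F.obj (x.2 i)⟩ : FreeObj N.toMultiData)
  map φ := FreeHom.mapMulti F φ
  unit := FreeHom.ofEquiv (x := ⟨0, Fin.elim0⟩) (Equiv.refl (Fin 0)) fun r => r.elim0
  mul (x y : FreeObj M.toMultiData) :=
    FreeHom.ofEquiv (x := FreeHom.append ⟨x.1, fun i => F.obj (x.2 i)⟩ ⟨y.1, fun i => F.obj (y.2 i)⟩)
      (y := ⟨x.1 + y.1, fun i => F.obj (Fin.append x.2 y.2 i)⟩) (Equiv.refl (Fin (x.1 + y.1)))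
      fun r => by
        induction r using Fin.addCases with
        | left r =>
          exact (Fin.append_left (fun i => F.obj (x.2 i)) (fun i => F.obj (y.2 i)) r).trans
            (congrArg F.obj (Fin.append_left x.2 y.2 r).symm)
        | right r =>
          exact (Fin.append_right (fun i => F.obj (x.2 i)) (fun i => F.obj (y.2 i)) r).trans
            (congrArg F.obj (Fin.append_right x.2 y.2 r).symm)

/-- The symmetric monoidal categories generated by multicategories are symmetric monoidal
categories, and this is functorial. -/
structure FreeLaws : Prop where
  obj : ∀ M : Multicat.{u, v}, (freeData M.toMultiData).Laws
  map : ∀ {M N : Multicat.{u, v}} (F : M ⟶ N), (freeMapData obj F.toMultifunctorData).Laws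
  map_id : ∀ M : Multicat.{u, v}, LaxData.toHom _ (map (𝟙 M)) = 𝟙 (freeObj obj M)
  map_comp : ∀ {M N P : Multicat.{u, v}} (F : M ⟶ N) (G : N ⟶ P),
    LaxData.toHom _ (map (F ≫ G)) = LaxData.toHom _ (map F) ≫ LaxData.toHom _ (map G)

/-- The functor from multicategories to symmetric monoidal categories that sends a multicategory to
the symmetric monoidal category generated by it. -/
def free (h : FreeLaws.{u, v}) : Multicat.{u, v} ⥤ SymMonCat.{u, v} where
  obj := freeObj h.obj
  map F := LaxData.toHom _ (h.map F)
  map_id := h.map_id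
  map_comp := h.map_comp

/-! ### Unit and counit -/

section UnitCounit

variable (κ : Choices.{u, v})

/-- In the generated symmetric monoidal category a tuple is the product of its entries. -/
theorem eval_std_single (h : FreeLaws.{u, v}) (M : Multicat.{u, v}) {α : Type} (n : ℕ)
    (l : Fin n → α) (X : α → (free h).obj M) (x : Fin n → M.Obj)
    (hX : ∀ i, X (l i) = (⟨1, fun _ => x i⟩ : FreeObj M.toMultiData)) :
    (Word.std n l).eval (C := (free h).obj M) X = (⟨n, x⟩ : FreeObj M.toMultiData) := by
  induction n with
  | zero => exact congrArg (Sigma.mk 0) (Subsingleton.elim _ _)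
  | succ n ih =>
    cases n with
    | zero =>
      refine (hX 0).trans (congrArg (Sigma.mk 1) (funext fun i => ?_))
      rw [Subsingleton.elim i 0]
    | succ n =>
      have h₁ := ih (fun i => l i.castSucc) (fun i => x i.castSucc) fun i => hX _
      have h₂ : (Word.std (n + 2) l).eval (C := (free h).obj M) X = FreeHom.append (M := M.toMultiData)
          ((Word.std (n + 1) fun i => l i.castSucc).eval (C := (free h).obj M) X) (X (l (Fin.last (n + 1)))) := rfl
      rw [h₂, h₁, hX]
      refine congrArg (Sigma.mk (n + 2)) (funext fun i => ?_)
      induction i using Fin.lastCases with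
      | last => exact Fin.append_right _ _ 0
      | cast i => exact Fin.append_left _ _ i

variable (hU : UnderlyingLaws κ) (hL : FreeLaws.{u, v})

/-- The unit: an object goes to the tuple of length one, and a multimorphism to the corresponding
morphism from the tuple of its sources (which is the product of the tuples of length one) to the
tuple of length one of its target. -/
def unitData (M : Multicat.{u, v}) :
    MultifunctorData M.toMultiData (underlyingData κ ((free hL).obj M)) where
  obj x := (⟨1, fun _ => x⟩ : FreeObj M.toMultiData)
  map {n x _} φ :=
    (κ ((free hL).obj M) n fun i => (⟨1, fun _ => x i⟩ : FreeObj M.toMultiData)).canon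
        (LinWord.std n) (Equiv.refl _) (fun _ => rfl) ≫
      eqToHom (eval_std_single hL M n (_root_.id : Fin n → Fin n)
          (fun i => (⟨1, fun _ => x i⟩ : FreeObj M.toMultiData)) x fun _ => rfl) ≫
        (FreeHom.ofMulti φ : FreeHom M.toMultiData _ _)

/-- The counit: a tuple goes to the left-parenthesized product of its entries, and a morphism
`(f, φ)` to the product of the `φ s`, preceded by the canonical isomorphism that sorts the factors
according to the fibres of `f`. The structure maps are canonical isomorphisms. -/
def counitData (C : SymMonCat.{u, v}) :
    LaxData ((free hL).obj ((underlying κ hU).obj C)) C where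
  obj (x : FreeObj (underlyingData κ C)) := (LinWord.std x.1).eval (C := C) x.2
  map {x y} (φ : FreeHom (underlyingData κ C) x y) :=
    (LinWord.std x.1).canon (C := C)
        ((LinWord.std y.1).sub fun s => κ C _ (fibTuple (O := C) x.2 φ.fn s))
        ((Equiv.sigmaFiberEquiv φ.fn).symm.trans
          (Equiv.sigmaCongrRight fun s => (fibEnum φ.fn s).symm))
        (Z := fun p => fibTuple (O := C) x.2 φ.fn p.1 p.2)
        (fun r => congrArg x.2 (congrArg Subtype.val
          ((fibEnum φ.fn (φ.fn r)).apply_symm_apply ⟨r, rfl⟩)).symm) ≫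
      (LinWord.std y.1).subMap (C := C) (fun s => κ C _ (fibTuple (O := C) x.2 φ.fn s)) φ.mor
  unit := 𝟙 (𝟙_ C)
  mul (x y : FreeObj (underlyingData κ C)) :=
    ((LinWord.std x.1).tensorIso (LinWord.std y.1) (C := C) x.2 y.2).inv ≫
      ((LinWord.std x.1).tensor (LinWord.std y.1)).canon (C := C) (LinWord.std (x.1 + y.1))
        finSumFinEquiv (Z := Fin.append (α := C) x.2 y.2) (fun r => match r with
          | .inl r => (Fin.append_left (α := C) x.2 y.2 r).symm
          | .inr r => (Fin.append_right (α := C) x.2 y.2 r).symm)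

/-- The units are multifunctors, and they are natural. -/
structure UnitLaws : Prop where
  obj : ∀ M : Multicat.{u, v}, (unitData κ hL M).Laws
  natural : ∀ {M N : Multicat.{u, v}} (F : M ⟶ N),
    (F ≫ (⟨unitData κ hL N, obj N⟩ : N ⟶ (underlying κ hU).obj ((free hL).obj N))) =
      (⟨unitData κ hL M, obj M⟩ : M ⟶ (underlying κ hU).obj ((free hL).obj M)) ≫
        (underlying κ hU).map ((free hL).map F)

/-- The unit as a natural transformation. -/
def unit (h : UnitLaws κ hU hL) : 𝟭 Multicat.{u, v} ⟶ free hL ⋙ underlying κ hU where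
  app M := ⟨unitData κ hL M, h.obj M⟩
  naturality _ _ F := h.natural F

variable (hε : ∀ C : SymMonCat.{u, v}, (counitData κ hU hL C).Laws)

/-- The counit at a symmetric monoidal category. -/
def counit (C : SymMonCat.{u, v}) : (free hL).obj ((underlying κ hU).obj C) ⟶ C :=
  (counitData κ hU hL C).toHom (hε C)

/-- The map that compares the two ways around the naturality square of the counit for `F`: on the
tuple `x` it is the map from the left-parenthesized product of the `F (x i)` to `F` of the
left-parenthesized product of `x` that is built from the lax structure maps of `F`. -/
def comparisonApp {C D : SymMonCat.{u, v}} (F : LaxBraidedFunctor C D)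
    (x : (free hL).obj ((underlying κ hU).obj C)) :
    (counit κ hU hL hε D).obj (((free hL).map ((underlying κ hU).map F)).obj x) ⟶
      F.obj ((counit κ hU hL hε C).obj x) :=
  Word.lax F (LinWord.std x.1).word (x.2 : Fin x.1 → C)

/-- The comparison maps are natural. -/
def ComparisonLaws : Prop :=
  ∀ {C D : SymMonCat.{u, v}} (F : LaxBraidedFunctor C D)
    {x y : (free hL).obj ((underlying κ hU).obj C)} (φ : x ⟶ y),
    (counit κ hU hL hε D).map (((free hL).map ((underlying κ hU).map F)).map φ) ≫
        comparisonApp κ hU hL hε F y =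
      comparisonApp κ hU hL hε F x ≫ F.map ((counit κ hU hL hε C).map φ)

/-- The comparison as a natural transformation. -/
def comparison (h : ComparisonLaws κ hU hL hε) {C D : SymMonCat.{u, v}} (F : C ⟶ D) :
    LaxBraidedFunctor.toFunctor ((free hL).map ((underlying κ hU).map F) ≫ counit κ hU hL hε D) ⟶
      LaxBraidedFunctor.toFunctor (counit κ hU hL hε C ≫ F) where
  app := comparisonApp κ hU hL hε F
  naturality _ _ φ := h F φ

end UnitCounit

/-- The functor `L` is a weak left adjoint of `U`, with unit `η`, weak counit `ε` and comparison
`ξ`: the unit is natural, both triangle identities hold strictly, and the counit is natural up to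
the monoidal natural transformations `ξ F`, which are coherent. -/
structure IsWeakAdjunction (L : Multicat.{u, v} ⥤ SymMonCat.{u, v})
    (U : SymMonCat.{u, v} ⥤ Multicat.{u, v}) (η : 𝟭 Multicat.{u, v} ⟶ L ⋙ U)
    (ε : ∀ C : SymMonCat.{u, v}, L.obj (U.obj C) ⟶ C)
    (ξ : ∀ {C D : SymMonCat.{u, v}} (F : C ⟶ D),
      LaxBraidedFunctor.toFunctor (L.map (U.map F) ≫ ε D) ⟶
        LaxBraidedFunctor.toFunctor (ε C ≫ F)) : Prop where
  left_triangle : ∀ M, L.map (η.app M) ≫ ε (L.obj M) = 𝟙 (L.obj M)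
  right_triangle : ∀ C, η.app (U.obj C) ≫ U.map (ε C) = 𝟙 (U.obj C)
  comparison_monoidal : ∀ {C D : SymMonCat.{u, v}} (F : C ⟶ D), NatTrans.IsMonoidal (ξ F)
  comparison_id : ∀ (C : SymMonCat.{u, v}) (x : L.obj (U.obj C)),
    (ξ (𝟙 C)).app x =
      eqToHom (by rw [U.map_id, L.map_id, Category.id_comp, Category.comp_id])
  comparison_comp : ∀ {C D E : SymMonCat.{u, v}} (F : C ⟶ D) (G : D ⟶ E) (x : L.obj (U.obj C)),
    (ξ (F ≫ G)).app x =
      eqToHom (by rw [U.map_comp, L.map_comp, Category.assoc]; rfl) ≫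
        (ξ G).app ((LaxBraidedFunctor.toFunctor (L.map (U.map F))).obj x) ≫
          (LaxBraidedFunctor.toFunctor G).map ((ξ F).app x)

end SymMult

end

open SymMult

universe u v

open CategoryTheory MonoidalCategory

noncomputable section

namespace SymMult

/-! ### Coherence for symmetric monoidal categories -/

section Exchange

variable {C : Type u} [Category.{v} C] [MonoidalCategory C]

/-! The proof rests on coherence for symmetric monoidal categories, in the form `Path.eval_eq`: if
every letter occurs exactly once in a word, any two formal composites of structure isomorphisms from
it to another word have the same value. Instead of rewriting to normal forms, the proof removes one
object at a time. Pulling a letter `a` to the front gives an isomorphism from the value of a word to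
`X a ⊗ -`, where `a` now carries the unit object; this conjugates the value of a path to `X a ◁ -`
of its value for the new family (`Path.eval_pull`). When all objects are units, every structure
isomorphism commutes with the collapse to the unit (`Path.eval_collapse`), so nothing is left to
compare.

Coherence is then turned into a calculus. A canonical map consists of maps of letters, a relabelling
and a path. Such maps are closed under composition, tensor product and substitution, and between
linear words they are determined by the bijection and the maps of letters (`eq_shuffle`). An
equation of canonical maps is therefore checked on bijections of finite sets. Once naturality and
associativity of substitution (`shuffle_subMap`, `subMap_subMap`) have moved the given
multimorphisms out of the way, the laws of `U C` are such equations, and the choices `κ` play no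
role. For a lax symmetric monoidal functor, the comparison `Word.lax` commutes with paths, canonical
maps and substitution, because each generator of paths corresponds to one axiom; this makes `U F` a
multifunctor.

For `L M` the difficulty is that components of morphisms refer to the increasing enumeration of
fibres. The predicate `IsAt` describes a component with respect to any enumeration, and `ext_isAt`
and `IsAt.comp` reduce every law to following entries. Structure morphisms only move entries
(`Moves`), so naturality and coherence in `L M` come down to arithmetic of positions.

The unit sends `φ` to the morphism that represents `φ`, and a representing morphism is unique
(`Represents.eq`). The laws of `η` say that permutations, composition and `L F` preserve
representation. For the counit, `counitMap_eq` computes its value from arbitrary enumerations of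
fibres and an arbitrary product of the targets; choosing these well turns functoriality into
associativity of substitution, and monoidality into distribution of substitution over a product of
two words. The comparison `ξ` is `Word.lax` on the left-parenthesized word, so its properties are
those of `Word.lax`.

Finally, `U ε ∘ η` is the identity since the structure maps of `ε` are identities along the
left-parenthesized product of singletons, and the two canonical maps that remain are inverse to each
other. In the other triangle both sides are strict functors, so only the underlying functors must
agree, and there the components are compared entry by entry. -/

theorem tensorHom_congr_comm {X X' Y Y' Z Z' W W' : C} {f : X ⟶ Y} {g : Y ⟶ W} {h : X ⟶ Z}
    {k : Z ⟶ W} {f' : X' ⟶ Y'} {g' : Y' ⟶ W'} {h' : X' ⟶ Z'} {k' : Z' ⟶ W'}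
    (e : f ≫ g = h ≫ k) (e' : f' ≫ g' = h' ≫ k') :
    (f ⊗ₘ f') ≫ (g ⊗ₘ g') = (h ⊗ₘ h') ≫ (k ⊗ₘ k') := by
  rw [tensorHom_comp_tensorHom, tensorHom_comp_tensorHom, e, e']

/-- On a word `tensor unit s`, both `evalMap` and `keep` unfold to `𝟙 ⊗ₘ f` and not to a whiskering,
hence the form of this and the next three lemmas. -/
theorem leftUnitor_naturality' {X Y : C} (f : X ⟶ Y) :
    (𝟙 (𝟙_ C) ⊗ₘ f) ≫ (λ_ Y).hom = (λ_ X).hom ≫ f := by simp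

theorem leftUnitor_inv_naturality' {X Y : C} (f : X ⟶ Y) :
    f ≫ (λ_ Y).inv = (λ_ X).inv ≫ (𝟙 (𝟙_ C) ⊗ₘ f) := by simp

theorem rightUnitor_naturality' {X Y : C} (f : X ⟶ Y) :
    (f ⊗ₘ 𝟙 (𝟙_ C)) ≫ (ρ_ Y).hom = (ρ_ X).hom ≫ f := by simp

theorem rightUnitor_inv_naturality' {X Y : C} (f : X ⟶ Y) :
    f ≫ (ρ_ Y).inv = (ρ_ X).inv ≫ (f ⊗ₘ 𝟙 (𝟙_ C)) := by simp

/-- Together with the lemmas below whose names contain `pull`, this supplies the cases of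
`Path.eval_pull`, one for each generator of paths and each place where the letter can sit. Here the
path is a tensor product and the letter lies in the left factor. -/
theorem tensor_pull_left {A R R' S S' P P' Q Q' : C} {p : R ⟶ P} {q : S ⟶ Q} {p' : R' ⟶ P'}
    {q' : S' ⟶ Q'} {f : R ⟶ A ⊗ R'} {g : P ⟶ A ⊗ P'} {h : S ⟶ S'} {k : Q ⟶ Q'}
    (e : p ≫ g = f ≫ A ◁ p') (e' : q ≫ k = h ≫ q') :
    (p ⊗ₘ q) ≫ (g ⊗ₘ k) ≫ (α_ A P' Q').hom =
      ((f ⊗ₘ h) ≫ (α_ A R' S').hom) ≫ A ◁ (p' ⊗ₘ q') := by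
  simp only [tensorHom_comp_tensorHom_assoc, e, e', ← id_tensorHom, Category.assoc,
    ← associator_naturality]

theorem assoc_pull_left {A R R' S S' T T' : C} (f : R ⟶ A ⊗ R') (g : S ⟶ S') (h : T ⟶ T') :
    (α_ R S T).hom ≫ (f ⊗ₘ (g ⊗ₘ h)) ≫ (α_ A R' (S' ⊗ T')).hom =
      (((f ⊗ₘ g) ≫ (α_ A R' S').hom) ⊗ₘ h) ≫ (α_ A (R' ⊗ S') T').hom ≫
        A ◁ (α_ R' S' T').hom := by
  have : (((f ⊗ₘ g) ≫ (α_ A R' S').hom) ⊗ₘ h) = ((f ⊗ₘ g) ⊗ₘ h) ≫ (α_ A R' S').hom ▷ T' := by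
    rw [← tensorHom_id, tensorHom_comp_tensorHom, Category.comp_id]
  rw [this, Category.assoc, ← associator_naturality_assoc]
  simp

theorem isIso_tensorHom_comp {X X' Y Y' Z : C} (f : X ⟶ Y) (g : X' ⟶ Y') (h : Y ⊗ Y' ⟶ Z)
    [IsIso f] [IsIso g] [IsIso h] : IsIso ((f ⊗ₘ g) ≫ h) :=
  inferInstance

/-- The lemmas named `collapse` are the cases of `Path.eval_collapse`. Those for the right unitor
and the braiding use that the two unitors of the unit object agree. -/
theorem tensor_collapse {X X' Y Y' : C} {p : X ⟶ Y} {p' : X' ⟶ Y'} {f : X ⟶ 𝟙_ C}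
    {f' : X' ⟶ 𝟙_ C} {g : Y ⟶ 𝟙_ C} {g' : Y' ⟶ 𝟙_ C} (e : p ≫ g = f) (e' : p' ≫ g' = f') :
    (p ⊗ₘ p') ≫ (g ⊗ₘ g') ≫ (λ_ (𝟙_ C)).hom = (f ⊗ₘ f') ≫ (λ_ (𝟙_ C)).hom := by
  rw [tensorHom_comp_tensorHom_assoc, e, e']

theorem assoc_collapse {X Y Z : C} (f : X ⟶ 𝟙_ C) (g : Y ⟶ 𝟙_ C) (h : Z ⟶ 𝟙_ C) :
    (α_ X Y Z).hom ≫ (f ⊗ₘ ((g ⊗ₘ h) ≫ (λ_ (𝟙_ C)).hom)) ≫ (λ_ (𝟙_ C)).hom =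
      (((f ⊗ₘ g) ≫ (λ_ (𝟙_ C)).hom) ⊗ₘ h) ≫ (λ_ (𝟙_ C)).hom := by
  simp only [MonoidalCategory.tensorHom_def]
  monoidal

theorem right_pull {A R R' : C} (f : R ⟶ A ⊗ R') :
    (ρ_ R).hom ≫ f = ((f ⊗ₘ 𝟙 (𝟙_ C)) ≫ (α_ A R' (𝟙_ C)).hom) ≫ A ◁ (ρ_ R').hom := by
  simp

theorem right_collapse {X : C} (f : X ⟶ 𝟙_ C) :
    (ρ_ X).hom ≫ f = (f ⊗ₘ 𝟙 (𝟙_ C)) ≫ (λ_ (𝟙_ C)).hom := by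
  rw [unitors_equal]
  simp

variable [SymmetricCategory C]

theorem braid_collapse {X Y : C} (f : X ⟶ 𝟙_ C) (g : Y ⟶ 𝟙_ C) :
    (β_ X Y).hom ≫ (g ⊗ₘ f) ≫ (λ_ (𝟙_ C)).hom = (f ⊗ₘ g) ≫ (λ_ (𝟙_ C)).hom := by
  rw [← BraidedCategory.braiding_naturality_assoc, braiding_leftUnitor, unitors_equal]

/-- Moving the second factor in front of the first. -/
def exchange (X A Y : C) : X ⊗ (A ⊗ Y) ⟶ A ⊗ (X ⊗ Y) :=
  (α_ X A Y).inv ≫ (β_ X A).hom ▷ Y ≫ (α_ A X Y).hom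

instance isIso_exchange (X A Y : C) : IsIso (exchange X A Y) := by
  unfold exchange
  infer_instance

theorem exchange_natural {X X' A Y Y' : C} (f : X ⟶ X') (g : Y ⟶ Y') :
    (f ⊗ₘ (A ◁ g)) ≫ exchange X' A Y' = exchange X A Y ≫ A ◁ (f ⊗ₘ g) := by
  simp only [exchange, ← id_tensorHom, ← tensorHom_id, Category.assoc, ← associator_naturality,
    associator_inv_naturality_assoc, tensorHom_comp_tensorHom_assoc]
  simp [MonoidalCategory.tensorHom_def]

theorem tensor_pull_right {A R R' S S' P P' Q Q' : C} {p : R ⟶ P} {q : S ⟶ Q} {p' : R' ⟶ P'}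
    {q' : S' ⟶ Q'} {f : R ⟶ R'} {g : P ⟶ P'} {h : S ⟶ A ⊗ S'} {k : Q ⟶ A ⊗ Q'}
    (e : p ≫ g = f ≫ p') (e' : q ≫ k = h ≫ A ◁ q') :
    (p ⊗ₘ q) ≫ (g ⊗ₘ k) ≫ exchange P' A Q' =
      ((f ⊗ₘ h) ≫ exchange R' A S') ≫ A ◁ (p' ⊗ₘ q') := by
  simp only [tensorHom_comp_tensorHom_assoc, e, e', Category.assoc, ← exchange_natural]

/-- Exchanging with the unit object involves only unitors, since the braiding with the unit does. -/
theorem left_pull {A R R' : C} (f : R ⟶ A ⊗ R') :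
    (λ_ R).hom ≫ f = ((𝟙 (𝟙_ C) ⊗ₘ f) ≫ exchange (𝟙_ C) A R') ≫ A ◁ (λ_ R').hom := by
  simp [exchange, braiding_tensorUnit_left]

theorem assoc_pull_middle {A R R' S S' T T' : C} (f : R ⟶ R') (g : S ⟶ A ⊗ S') (h : T ⟶ T') :
    (α_ R S T).hom ≫ (f ⊗ₘ ((g ⊗ₘ h) ≫ (α_ A S' T').hom)) ≫ exchange R' A (S' ⊗ T') =
      (((f ⊗ₘ g) ≫ exchange R' A S') ⊗ₘ h) ≫ (α_ A (R' ⊗ S') T').hom ≫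
        A ◁ (α_ R' S' T').hom := by
  have h₁ : (f ⊗ₘ ((g ⊗ₘ h) ≫ (α_ A S' T').hom)) =
      (f ⊗ₘ (g ⊗ₘ h)) ≫ R' ◁ (α_ A S' T').hom := by
    simp [← id_tensorHom]
  have h₂ : (((f ⊗ₘ g) ≫ exchange R' A S') ⊗ₘ h) = ((f ⊗ₘ g) ⊗ₘ h) ≫ exchange R' A S' ▷ T' := by
    rw [← tensorHom_id, tensorHom_comp_tensorHom, Category.comp_id]
  rw [h₁, h₂, Category.assoc, Category.assoc, ← associator_naturality_assoc]
  -- With `f`, `g`, `h` stripped off, both sides contain the single braiding of `R'` and `A`, and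
  -- only associators differ.
  congr 1
  simp only [exchange]
  monoidal

/-- By the hexagon, moving `A` past `R' ⊗ S'` is moving it past `S'` and then past `R'`. -/
theorem assoc_pull_right {A R R' S S' T T' : C} (f : R ⟶ R') (g : S ⟶ S') (h : T ⟶ A ⊗ T') :
    (α_ R S T).hom ≫ (f ⊗ₘ ((g ⊗ₘ h) ≫ exchange S' A T')) ≫ exchange R' A (S' ⊗ T') =
      ((f ⊗ₘ g) ⊗ₘ h) ≫ exchange (R' ⊗ S') A T' ≫ A ◁ (α_ R' S' T').hom := by
  have h₁ : (f ⊗ₘ ((g ⊗ₘ h) ≫ exchange S' A T')) =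
      (f ⊗ₘ (g ⊗ₘ h)) ≫ R' ◁ exchange S' A T' := by
    simp [← id_tensorHom]
  rw [h₁, Category.assoc, ← associator_naturality_assoc]
  congr 1
  simp only [exchange, BraidedCategory.braiding_tensor_left_hom]
  monoidal

/-- This case needs symmetry and not just a braiding: the hexagon produces the braiding of `A` with
`S'`, and the exchange map then braids `S'` back with `A`. -/
theorem braid_pull_left {A R R' S S' : C} (f : R ⟶ A ⊗ R') (g : S ⟶ S') :
    (β_ R S).hom ≫ (g ⊗ₘ f) ≫ exchange S' A R' =
      ((f ⊗ₘ g) ≫ (α_ A R' S').hom) ≫ A ◁ (β_ R' S').hom := by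
  rw [← BraidedCategory.braiding_naturality_assoc, Category.assoc]
  congr 1
  simp only [exchange, BraidedCategory.braiding_tensor_left_hom]
  simp [← comp_whiskerRight_assoc]

theorem braid_pull_right {A R R' S S' : C} (f : R ⟶ R') (g : S ⟶ A ⊗ S') :
    (β_ R S).hom ≫ (g ⊗ₘ f) ≫ (α_ A S' R').hom =
      ((f ⊗ₘ g) ≫ exchange R' A S') ≫ A ◁ (β_ R' S').hom := by
  rw [← BraidedCategory.braiding_naturality_assoc, Category.assoc]
  congr 1
  simp only [exchange, BraidedCategory.braiding_tensor_right_hom]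
  simp

end Exchange

/-! ### Pulling one letter to the front, and coherence for words. -/

namespace Word

variable {α : Type}

theorem Path.leaves_perm {w w' : Word α} (p : Path w w') : w.leaves.Perm w'.leaves := by
  induction p with
  | id => rfl
  | comp _ _ hp hq => exact hp.trans hq
  | tensor _ _ hp hq => exact hp.append hq
  | assoc r s t => simp [leaves]
  | assocInv r s t => simp [leaves]
  | left s => simp [leaves]
  | leftInv s => simp [leaves]
  | right s => simp [leaves]
  | rightInv s => simp [leaves]
  | braid s t => exact List.perm_append_comm

/-- Occurrences of a letter in a word in which it occurs exactly once. -/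
inductive Sole (a : α) : Word α → Type
  | leaf : Sole a (leaf a)
  | left {s t : Word α} : Sole a s → a ∉ t.leaves → Sole a (tensor s t)
  | right {s t : Word α} : a ∉ s.leaves → Sole a t → Sole a (tensor s t)

theorem Sole.mem {a : α} {w : Word α} (o : Sole a w) : a ∈ w.leaves := by
  induction o with
  | leaf => simp [leaves]
  | left _ _ h => simp [leaves, h]
  | right _ _ h => simp [leaves, h]

theorem exists_sole {a : α} {w : Word α} (h : w.leaves.Nodup) (ha : a ∈ w.leaves) :
    Nonempty (Sole a w) := by
  induction w with
  | unit => simp [leaves] at ha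
  | leaf b =>
    obtain rfl : a = b := by simpa [leaves] using ha
    exact ⟨.leaf⟩
  | tensor s t hs ht =>
    have h' := List.disjoint_of_nodup_append h
    obtain ⟨h₁, h₂, -⟩ := List.nodup_append.1 h
    rcases List.mem_append.1 ha with ha | ha
    · exact (hs h₁ ha).map fun o => .left o (h' ha)
    · exact (ht h₂ ha).map fun o => .right (fun h => h' h ha) o

/-- Supplies the occurrence in the intermediate word when a path is a composite. -/
theorem Sole.of_path {a : α} {w w' : Word α} (p : Path w w') (o : Sole a w) :
    Nonempty (Sole a w') := by
  induction p with
  | id => exact ⟨o⟩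
  | comp p q hp hq => exact (hp o).elim hq
  | tensor p q hp hq =>
    cases o with
    | left o h => exact (hp o).map fun o => .left o (mt q.leaves_perm.mem_iff.2 h)
    | right h o => exact (hq o).map fun o => .right (mt p.leaves_perm.mem_iff.2 h) o
  | assoc r s t =>
    cases o with
    | left o h =>
      cases o with
      | left o h' => exact ⟨.left o (by simp_all [leaves])⟩
      | right h' o => exact ⟨.right h' (.left o h)⟩
    | right h o =>
      have h : a ∉ r.leaves ∧ a ∉ s.leaves := by simpa [leaves] using h
      exact ⟨.right h.1 (.right h.2 o)⟩
  | assocInv r s t =>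
    cases o with
    | left o h =>
      have h : a ∉ s.leaves ∧ a ∉ t.leaves := by simpa [leaves] using h
      exact ⟨.left (.left o h.1) h.2⟩
    | right h o =>
      cases o with
      | left o h' => exact ⟨.left (.right h o) h'⟩
      | right h' o => exact ⟨.right (by simp_all [leaves]) o⟩
  | left s =>
    cases o with
    | left o h => cases o
    | right h o => exact ⟨o⟩
  | leftInv s => exact ⟨.right (by simp [leaves]) o⟩
  | right s =>
    cases o with
    | left o h => exact ⟨o⟩
    | right h o => cases o
  | rightInv s => exact ⟨.left o (by simp [leaves])⟩
  | braid s t =>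
    cases o with
    | left o h => exact ⟨.right h o⟩
    | right h o => exact ⟨.left o h⟩

-- An occurrence in one factor excludes any in the other, so the shape of the word fixes it.
-- Consequently `pull` depends only on the word, and case analysis may replace a given occurrence in
-- the target by the expected one.
instance {a : α} (w : Word α) : Subsingleton (Sole a w) := by
  refine ⟨fun o o' => ?_⟩
  induction o with
  | leaf => cases o'; rfl
  | left o h ih =>
    cases o' with
    | left o' h' => rw [ih o']
    | right h' o' => exact absurd o.mem h'
  | right h o ih =>
    cases o' with
    | left o' h' => exact absurd o.mem h'
    | right h' o' => rw [ih o']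

section Coherence

variable {C : Type u} [Category.{v} C] [MonoidalCategory C]

/-- The map of values given by maps for all letters but one, for a word that does not contain
this letter. -/
def keep {a : α} {X X' : α → C} (g : ∀ b, b ≠ a → (X b ⟶ X' b)) :
    (w : Word α) → a ∉ w.leaves → (w.eval X ⟶ w.eval X')
  | unit, _ => 𝟙 _
  | leaf b, h => g b fun hb => h (by simp [leaves, hb])
  | tensor s t, h => s.keep g (fun h' => h (List.mem_append_left _ h')) ⊗ₘ
      t.keep g (fun h' => h (List.mem_append_right _ h'))

theorem isIso_keep {a : α} {X X' : α → C} (g : ∀ b, b ≠ a → (X b ⟶ X' b))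
    (hg : ∀ b h, IsIso (g b h)) (w : Word α) (h : a ∉ w.leaves) : IsIso (w.keep g h) := by
  induction w with
  | unit => exact inferInstanceAs (IsIso (𝟙 _))
  | leaf b => exact hg b _
  | tensor s t hs ht =>
    have := hs (fun h' => h (List.mem_append_left _ h'))
    have := ht (fun h' => h (List.mem_append_right _ h'))
    exact inferInstanceAs (IsIso (_ ⊗ₘ _))

variable [SymmetricCategory C]

/-- Naturality of paths for a family of maps that is undefined at the letter `a`; it treats the
factor of a tensor product from which nothing is pulled. -/
theorem Path.eval_keep {a : α} {X X' : α → C} (g : ∀ b, b ≠ a → (X b ⟶ X' b)) {w w' : Word α}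
    (p : Path w w') (h : a ∉ w.leaves) (h' : a ∉ w'.leaves) :
    p.eval X ≫ w'.keep g h' = w.keep g h ≫ p.eval X' := by
  induction p with
  | id => exact (Category.id_comp _).trans (Category.comp_id _).symm
  | comp p q hp hq =>
    have h₁ := mt p.leaves_perm.mem_iff.2 h
    simp [Path.eval, hq h₁, reassoc_of% (hp h h₁)]
  | tensor p q hp hq =>
    have h₁ := hp (fun h' => h (List.mem_append_left _ h')) fun h => h' (List.mem_append_left _ h)
    have h₂ := hq (fun h' => h (List.mem_append_right _ h')) fun h => h' (List.mem_append_right _ h)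
    exact tensorHom_congr_comm h₁ h₂
  | assoc r s t => exact (associator_naturality _ _ _).symm
  | assocInv r s t => exact (associator_inv_naturality _ _ _).symm
  | left s => exact ((leftUnitor_naturality' _)).symm
  | leftInv s => exact (leftUnitor_inv_naturality' _).symm
  | right s => exact (rightUnitor_naturality' _).symm
  | rightInv s => exact (rightUnitor_inv_naturality' _).symm
  | braid s t => exact (BraidedCategory.braiding_naturality _ _).symm

/-- Moving a letter to the front of a word in which it occurs exactly once. -/
def pull {a : α} {A : C} {X X' : α → C} (k : X a ⟶ A ⊗ X' a) (g : ∀ b, b ≠ a → (X b ⟶ X' b)) :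
    {w : Word α} → Sole a w → (w.eval X ⟶ A ⊗ w.eval X')
  | _, .leaf => k
  | _, .left o h => (pull k g o ⊗ₘ keep g _ h) ≫ (α_ _ _ _).hom
  | _, .right h o => (keep g _ h ⊗ₘ pull k g o) ≫ exchange _ _ _

theorem isIso_pull {a : α} {A : C} {X X' : α → C} (k : X a ⟶ A ⊗ X' a)
    (g : ∀ b, b ≠ a → (X b ⟶ X' b)) (hk : IsIso k) (hg : ∀ b h, IsIso (g b h)) {w : Word α}
    (o : Sole a w) : IsIso (pull k g o) := by
  induction o with
  | leaf => exact hk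
  | left o h ih =>
    have := isIso_keep g hg _ h
    have := isIso_tensorHom_comp (pull k g o) (keep g _ h) (α_ _ _ _).hom
    exact this
  | right h o ih =>
    have := isIso_keep g hg _ h
    have := isIso_tensorHom_comp (keep g _ h) (pull k g o) (exchange _ _ _)
    exact this

theorem eval_assoc_pull {a : α} {A : C} {X X' : α → C} (k : X a ⟶ A ⊗ X' a)
    (g : ∀ b, b ≠ a → (X b ⟶ X' b)) {r s t : Word α} (o : Sole a (tensor (tensor r s) t))
    (o' : Sole a (tensor r (tensor s t))) :
    (Path.assoc r s t).eval X ≫ pull k g o' = pull k g o ≫ A ◁ (Path.assoc r s t).eval X' := by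
  cases o with
  | left o h =>
    cases o with
    | left o h₁ =>
      rw [Subsingleton.elim o' (.left o (by simp_all [leaves]))]
      exact (assoc_pull_left _ _ _).trans (Category.assoc _ _ _).symm
    | right h₁ o =>
      rw [Subsingleton.elim o' (.right h₁ (.left o h))]
      exact (assoc_pull_middle _ _ _).trans (Category.assoc _ _ _).symm
  | right h o =>
    have h' : a ∉ r.leaves ∧ a ∉ s.leaves := by simpa [leaves] using h
    rw [Subsingleton.elim o' (.right h'.1 (.right h'.2 o))]
    exact (assoc_pull_right _ _ _).trans (Category.assoc _ _ _).symm

theorem eval_left_pull {a : α} {A : C} {X X' : α → C} (k : X a ⟶ A ⊗ X' a)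
    (g : ∀ b, b ≠ a → (X b ⟶ X' b)) {s : Word α} (o : Sole a (tensor unit s)) (o' : Sole a s) :
    (Path.left s).eval X ≫ pull k g o' = pull k g o ≫ A ◁ (Path.left s).eval X' := by
  rw [Subsingleton.elim o (.right (by simp [leaves]) o')]
  exact left_pull _

theorem eval_right_pull {a : α} {A : C} {X X' : α → C} (k : X a ⟶ A ⊗ X' a)
    (g : ∀ b, b ≠ a → (X b ⟶ X' b)) {s : Word α} (o : Sole a (tensor s unit)) (o' : Sole a s) :
    (Path.right s).eval X ≫ pull k g o' = pull k g o ≫ A ◁ (Path.right s).eval X' := by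
  rw [Subsingleton.elim o (.left o' (by simp [leaves]))]
  exact right_pull _

/-- The heart of coherence: once a letter stands in front, a path acts only on the remaining word.
Induction on the path, one lemma for each generator; the inverse generators follow by cancelling
isomorphisms. -/
theorem Path.eval_pull {a : α} {A : C} {X X' : α → C} (k : X a ⟶ A ⊗ X' a)
    (g : ∀ b, b ≠ a → (X b ⟶ X' b)) {w w' : Word α} (p : Path w w') (o : Sole a w)
    (o' : Sole a w') :
    p.eval X ≫ pull k g o' = pull k g o ≫ A ◁ p.eval X' := by
  induction p with
  | id =>
    rw [Subsingleton.elim o o']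
    simp [Path.eval]
  | comp p q hp hq =>
    obtain ⟨o''⟩ := o.of_path p
    simp [Path.eval, hq o'' o', reassoc_of% (hp o o'')]
  | tensor p q hp hq =>
    cases o with
    | left o h =>
      cases o' with
      | left o' h' => exact tensor_pull_left (hp o o') (q.eval_keep g h h')
      | right h' o' => exact absurd (p.leaves_perm.mem_iff.1 o.mem) h'
    | right h o =>
      cases o' with
      | left o' h' => exact absurd (q.leaves_perm.mem_iff.1 o.mem) h'
      | right h' o' => exact tensor_pull_right (p.eval_keep g h h') (hq o o')
  | assoc r s t => exact eval_assoc_pull k g o o'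
  | assocInv r s t =>
    -- The identity for the associator, conjugated by the associators on both sides.
    have := eval_assoc_pull k g o' o
    refine (Iso.inv_comp_eq (α_ (r.eval X) (s.eval X) (t.eval X))).2 ?_
    refine (Iso.eq_comp_inv (whiskerLeftIso A (α_ (r.eval X') (s.eval X') (t.eval X')))).2
      this.symm |>.trans ?_
    exact Category.assoc _ _ _
  | left s => exact eval_left_pull k g o o'
  | leftInv s =>
    have := eval_left_pull k g o' o
    refine (Iso.inv_comp_eq (λ_ (s.eval X))).2 ?_
    refine (Iso.eq_comp_inv (whiskerLeftIso A (λ_ (s.eval X')))).2 this.symm |>.trans ?_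
    exact Category.assoc _ _ _
  | right s => exact eval_right_pull k g o o'
  | rightInv s =>
    have := eval_right_pull k g o' o
    refine (Iso.inv_comp_eq (ρ_ (s.eval X))).2 ?_
    refine (Iso.eq_comp_inv (whiskerLeftIso A (ρ_ (s.eval X')))).2 this.symm |>.trans ?_
    exact Category.assoc _ _ _
  | braid s t =>
    cases o with
    | left o h =>
      rw [Subsingleton.elim o' (.right h o)]
      exact braid_pull_left _ _
    | right h o =>
      rw [Subsingleton.elim o' (.left o h)]
      exact braid_pull_right _ _

/-- The isomorphism from the value of a word of units to the unit. -/
def collapse : (w : Word α) → (w.eval (fun _ => 𝟙_ C) ≅ 𝟙_ C)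
  | unit => Iso.refl _
  | leaf _ => Iso.refl _
  | tensor s t => (s.collapse ⊗ᵢ t.collapse) ≪≫ λ_ (𝟙_ C)

/-- Every structure isomorphism between products of units is compatible with the multiplication `𝟙_
C ⊗ 𝟙_ C ≅ 𝟙_ C`, so a path between such products is forced by its ends. -/
theorem Path.eval_collapse {w w' : Word α} (p : Path w w') :
    p.eval (fun _ => 𝟙_ C) ≫ w'.collapse.hom = w.collapse.hom := by
  induction p with
  | id => exact Category.id_comp _
  | comp p q hp hq => simp [Path.eval, hq, hp]
  | tensor p q hp hq => exact tensor_collapse hp hq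
  | assoc r s t => exact assoc_collapse _ _ _
  | assocInv r s t => exact (Iso.inv_comp_eq _).2 (assoc_collapse _ _ _).symm
  | left s => exact (leftUnitor_naturality' _).symm
  | leftInv s => exact (Iso.inv_comp_eq _).2 (leftUnitor_naturality' _)
  | right s => exact right_collapse _
  | rightInv s => exact (Iso.inv_comp_eq _).2 (right_collapse _).symm
  | braid s t => exact braid_collapse _ _

/-- Induction on a list containing all letters that may carry an object other than the unit; each
step turns one more object into the unit. -/
theorem Path.eval_eq_of_forall {w w' : Word α} (hw : w.leaves.Nodup) (p q : Path w w')
    (l : List α) (X : α → C) (hX : ∀ a, a ∉ l → X a = 𝟙_ C) : p.eval X = q.eval X := by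
  classical
  induction l generalizing X with
  | nil =>
    obtain rfl : X = fun _ => 𝟙_ C := funext fun a => hX a List.not_mem_nil
    rw [← cancel_mono w'.collapse.hom, p.eval_collapse, q.eval_collapse]
  | cons a l ih =>
    let X' := Function.update X a (𝟙_ C)
    have ih := ih X' fun b hb => by
      by_cases h : b = a
      · subst h; exact Function.update_self _ _ _
      · exact (Function.update_of_ne h _ _).trans (hX b (by simp [h, hb]))
    let g : ∀ b, b ≠ a → (X b ⟶ X' b) := fun b hb => eqToHom (Function.update_of_ne hb _ _).symm
    have hg : ∀ b h, IsIso (g b h) := fun b h => inferInstanceAs (IsIso (eqToHom _))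
    by_cases ha : a ∈ w.leaves
    -- At the letter itself the object `X a` is split off and the unit stays behind. This is an
    -- isomorphism, so `pull` is one, and two paths can be compared after it.
    · let k : X a ⟶ X a ⊗ X' a :=
        (ρ_ (X a)).inv ≫ X a ◁ eqToHom (Function.update_self a (𝟙_ C) X).symm
      obtain ⟨o⟩ := exists_sole hw ha
      obtain ⟨o'⟩ := o.of_path p
      have := isIso_pull k g inferInstance hg o'
      rw [← cancel_mono (pull k g o'), p.eval_pull k g o o', q.eval_pull k g o o', ih]
    -- If `a` does not occur, replacing its object changes neither value, up to the isomorphisms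
    -- `keep`.
    · have ha' := mt p.leaves_perm.mem_iff.2 ha
      have := isIso_keep g hg _ ha'
      rw [← cancel_mono (w'.keep g ha'), p.eval_keep g ha ha', q.eval_keep g ha ha', ih]

/-- Coherence: parallel formal composites of structure isomorphisms have the same value if no
letter occurs twice and all letters occur. -/
theorem Path.eval_eq {w w' : Word α} (hw : w.leaves.Nodup) (hm : ∀ a, a ∈ w.leaves)
    (p q : Path w w') (X : α → C) : p.eval X = q.eval X :=
  Path.eval_eq_of_forall hw p q w.leaves X fun a h => absurd (hm a) h

end Coherence

end Word

/-! ### The calculus of canonical maps -/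

namespace Word

variable {α β γ : Type}

/-- Substitution in formal composites of structure isomorphisms. -/
def Path.bind : {w w' : Word α} → Path w w' → (g : α → Word β) → Path (w.bind g) (w'.bind g)
  | _, _, .id _, _ => .id _
  | _, _, .comp p q, g => .comp (p.bind g) (q.bind g)
  | _, _, .tensor p q, g => .tensor (p.bind g) (q.bind g)
  | _, _, .assoc _ _ _, _ => .assoc _ _ _
  | _, _, .assocInv _ _ _, _ => .assocInv _ _ _
  | _, _, .left _, _ => .left _
  | _, _, .leftInv _, _ => .leftInv _
  | _, _, .right _, _ => .right _
  | _, _, .rightInv _, _ => .rightInv _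
  | _, _, .braid _ _, _ => .braid _ _

/-- Substitution of formal composites of structure isomorphisms for letters. -/
def Path.inner : (w : Word α) → {g g' : α → Word β} → (∀ a, Path (g a) (g' a)) →
    Path (w.bind g) (w.bind g')
  | .unit, _, _, _ => .id _
  | .leaf a, _, _, q => q a
  | .tensor s t, _, _, q => .tensor (Path.inner s q) (Path.inner t q)

/-- Relabelling in formal composites of structure isomorphisms. -/
def Path.map {w w' : Word α} (p : Path w w') (e : α → β) : Path (w.map e) (w'.map e) :=
  p.bind fun a => leaf (e a)

/-- Composition of relabellings. -/
def Path.mapMap : (w : Word α) → (e : α → β) → (e' : β → γ) →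
    Path ((w.map e).map e') (w.map fun a => e' (e a))
  | .unit, _, _ => .id _
  | .leaf _, _, _ => .id _
  | .tensor s t, e, e' => .tensor (Path.mapMap s e e') (Path.mapMap t e e')

/-- Composition of relabellings. -/
def Path.mapMapInv : (w : Word α) → (e : α → β) → (e' : β → γ) →
    Path (w.map fun a => e' (e a)) ((w.map e).map e')
  | .unit, _, _ => .id _
  | .leaf _, _, _ => .id _
  | .tensor s t, e, e' => .tensor (Path.mapMapInv s e e') (Path.mapMapInv t e e')

/-- Substitution in a relabelled word. -/
def Path.mapBindInv : (w : Word α) → (e : α → β) → (g : β → Word γ) →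
    Path (w.bind fun a => g (e a)) ((w.map e).bind g)
  | .unit, _, _ => .id _
  | .leaf _, _, _ => .id _
  | .tensor s t, e, g => .tensor (Path.mapBindInv s e g) (Path.mapBindInv t e g)

/-- Relabelling of a substituted word. -/
def Path.bindMap : (w : Word α) → (g : α → Word β) → (e : β → γ) →
    Path ((w.bind g).map e) (w.bind fun a => (g a).map e)
  | .unit, _, _ => .id _
  | .leaf _, _, _ => .id _
  | .tensor s t, g, e => .tensor (Path.bindMap s g e) (Path.bindMap t g e)

/-- Relabelling by the identity. -/
def Path.mapId : (w : Word α) → Path (w.map fun a => a) w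
  | .unit => .id _
  | .leaf _ => .id _
  | .tensor s t => .tensor (Path.mapId s) (Path.mapId t)

section Eval

variable {C : Type u} [Category.{v} C] [MonoidalCategory C]

theorem evalMap_id (w : Word α) (X : α → C) : w.evalMap (fun a => 𝟙 (X a)) = 𝟙 (w.eval X) := by
  induction w with
  | unit => rfl
  | leaf a => rfl
  | tensor s t hs ht => rw [evalMap, hs, ht]; exact id_tensorHom_id _ _

theorem evalMap_comp (w : Word α) {X Y Z : α → C} (f : ∀ a, X a ⟶ Y a) (g : ∀ a, Y a ⟶ Z a) :
    w.evalMap f ≫ w.evalMap g = w.evalMap fun a => f a ≫ g a := by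
  induction w with
  | unit => exact Category.comp_id _
  | leaf a => rfl
  | tensor s t hs ht =>
    rw [evalMap, evalMap, evalMap, ← hs, ← ht]
    exact tensorHom_comp_tensorHom _ _ _ _

/-- The components of `bindIso` are identities, but for a variable word its two ends are not
definitionally equal. It must therefore be carried through all the identities about substitution. -/
theorem evalMap_bindIso (w : Word α) (g : α → Word β) {X Z : β → C} (f : ∀ b, X b ⟶ Z b) :
    (w.bind g).evalMap f ≫ (w.bindIso g Z).hom =
      (w.bindIso g X).hom ≫ w.evalMap fun a => (g a).evalMap f := by
  induction w with
  | unit => rfl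
  | leaf a => exact (Category.comp_id _).trans (Category.id_comp _).symm
  | tensor s t hs ht => exact tensorHom_congr_comm hs ht

theorem evalMap_mapIso (w : Word α) (e : α → β) {X Z : β → C} (f : ∀ b, X b ⟶ Z b) :
    (w.map e).evalMap f ≫ (w.mapIso e Z).hom =
      (w.mapIso e X).hom ≫ w.evalMap fun a => f (e a) :=
  evalMap_bindIso _ _ _

variable [SymmetricCategory C]

theorem Path.eval_natural {w w' : Word α} (p : Path w w') {X Z : α → C} (f : ∀ a, X a ⟶ Z a) :
    p.eval X ≫ w'.evalMap f = w.evalMap f ≫ p.eval Z := by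
  induction p with
  | id => exact (Category.id_comp _).trans (Category.comp_id _).symm
  | comp p q hp hq => simp [Path.eval, hq, reassoc_of% hp]
  | tensor p q hp hq => exact tensorHom_congr_comm hp hq
  | assoc r s t => exact (associator_naturality _ _ _).symm
  | assocInv r s t => exact (associator_inv_naturality _ _ _).symm
  | left s => exact (leftUnitor_naturality' _).symm
  | leftInv s => exact (leftUnitor_inv_naturality' _).symm
  | right s => exact (rightUnitor_naturality' _).symm
  | rightInv s => exact (rightUnitor_inv_naturality' _).symm
  | braid s t => exact (BraidedCategory.braiding_naturality _ _).symm

theorem Path.eval_bind {w w' : Word α} (p : Path w w') (g : α → Word β) (Z : β → C) :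
    (p.bind g).eval Z ≫ (w'.bindIso g Z).hom =
      (w.bindIso g Z).hom ≫ p.eval fun a => (g a).eval Z := by
  induction p with
  | id => exact (Category.id_comp _).trans (Category.comp_id _).symm
  | comp p q hp hq => simp [Path.bind, Path.eval, hq, reassoc_of% hp]
  | tensor p q hp hq => exact tensorHom_congr_comm hp hq
  | assoc r s t => exact (associator_naturality _ _ _).symm
  | assocInv r s t => exact (associator_inv_naturality _ _ _).symm
  | left s => exact (leftUnitor_naturality' _).symm
  | leftInv s => exact (leftUnitor_inv_naturality' _).symm
  | right s => exact (rightUnitor_naturality' _).symm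
  | rightInv s => exact (rightUnitor_inv_naturality' _).symm
  | braid s t => exact (BraidedCategory.braiding_naturality _ _).symm

theorem Path.eval_inner (w : Word α) {g g' : α → Word β} (q : ∀ a, Path (g a) (g' a))
    (Z : β → C) :
    (Path.inner w q).eval Z ≫ (w.bindIso g' Z).hom =
      (w.bindIso g Z).hom ≫ w.evalMap fun a => (q a).eval Z := by
  induction w with
  | unit => exact (Category.id_comp _).trans (Category.comp_id _).symm
  | leaf a => exact (Category.comp_id _).trans (Category.id_comp _).symm
  | tensor s t hs ht => exact tensorHom_congr_comm hs ht

theorem Path.eval_map {w w' : Word α} (p : Path w w') (e : α → β) (Z : β → C) :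
    p.eval (fun a => Z (e a)) ≫ (w'.mapIso e Z).inv = (w.mapIso e Z).inv ≫ (p.map e).eval Z := by
  rw [Iso.comp_inv_eq, Category.assoc, Iso.eq_inv_comp]
  exact (p.eval_bind (fun a => leaf (e a)) Z).symm

theorem Path.eval_mapMapInv (w : Word α) (e : α → β) (e' : β → γ) (Z : γ → C) :
    (w.mapIso (fun a => e' (e a)) Z).inv ≫ (Path.mapMapInv w e e').eval Z =
      (w.mapIso e fun b => Z (e' b)).inv ≫ ((w.map e).mapIso e' Z).inv := by
  induction w with
  | unit => rfl
  | leaf a => rfl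
  | tensor s t hs ht => exact tensorHom_congr_comm hs ht

theorem Path.eval_mapMap (w : Word α) (e : α → β) (e' : β → γ) (Z : γ → C) :
    (Path.mapMap w e e').eval Z ≫ (w.mapIso (fun a => e' (e a)) Z).hom =
      ((w.map e).mapIso e' Z).hom ≫ (w.mapIso e fun b => Z (e' b)).hom := by
  induction w with
  | unit => rfl
  | leaf a => rfl
  | tensor s t hs ht => exact tensorHom_congr_comm hs ht

theorem Path.eval_mapBindInv (w : Word α) (e : α → β) (g : β → Word γ) (Z : γ → C) :
    (Path.mapBindInv w e g).eval Z ≫ ((w.map e).bindIso g Z).hom =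
      (w.bindIso (fun a => g (e a)) Z).hom ≫ (w.mapIso e fun b => (g b).eval Z).inv := by
  induction w with
  | unit => rfl
  | leaf a => rfl
  | tensor s t hs ht => exact tensorHom_congr_comm hs ht

theorem Path.eval_bindMap (w : Word α) (g : α → Word β) (e : β → γ) (Z : γ → C) :
    (Path.bindMap w g e).eval Z ≫ (w.bindIso (fun a => (g a).map e) Z).hom =
      (((w.bind g).mapIso e Z).hom ≫ (w.bindIso g fun b => Z (e b)).hom) ≫
        w.evalMap (fun a => ((g a).mapIso e Z).inv) := by
  induction w with
  | unit => exact (Category.comp_id (𝟙 (𝟙_ C) ≫ 𝟙 (𝟙_ C))).symm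
  | leaf a =>
    refine (Category.id_comp _).trans ?_
    refine Eq.trans ?_ (congrArg (· ≫ ((g a).mapIso e Z).inv) (Category.comp_id _).symm)
    exact ((g a).mapIso e Z).hom_inv_id.symm
  | tensor s t hs ht =>
    refine (tensorHom_congr_comm hs ht).trans (congrArg (· ≫ _) ?_)
    exact (tensorHom_comp_tensorHom _ _ _ _).symm

theorem Path.eval_mapId (w : Word α) (Z : α → C) :
    (Path.mapId w).eval Z = (w.mapIso (fun a => a) Z).hom := by
  induction w with
  | unit => rfl
  | leaf a => rfl
  | tensor s t hs ht => exact congrArg₂ (· ⊗ₘ ·) hs ht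

/-- The map is the canonical map given by maps of letters along a relabelling of letters. -/
def IsCanon (w : Word α) (w' : Word β) (e : α → β) {X : α → C} {Z : β → C}
    (f : ∀ a, X a ⟶ Z (e a)) (m : w.eval X ⟶ w'.eval Z) : Prop :=
  ∃ p : Path (w.map e) w', m = w.evalMap f ≫ (w.mapIso e Z).inv ≫ p.eval Z

namespace IsCanon

theorem path {w w' : Word α} (p : Path w w') (X : α → C) :
    IsCanon w w' (fun a => a) (fun a => 𝟙 (X a)) (p.eval X) := by
  refine ⟨.comp (.mapId w) p, ?_⟩
  rw [evalMap_id, Category.id_comp, Path.eval, Path.eval_mapId, Iso.inv_hom_id_assoc]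

theorem evalMap (w : Word α) {X Z : α → C} (f : ∀ a, X a ⟶ Z a) :
    IsCanon w w (fun a => a) f (w.evalMap f) := by
  refine ⟨.mapId w, ?_⟩
  rw [Path.eval_mapId, Iso.inv_hom_id, Category.comp_id]

/-- The maps of letters of the second factor move left past the first path and the first relabelling
by naturality; the first path is then relabelled along `e'`, and the two paths compose. -/
theorem comp {w : Word α} {w' : Word β} {w'' : Word γ} {e : α → β} {e' : β → γ} {X : α → C}
    {Y : β → C} {Z : γ → C} {f : ∀ a, X a ⟶ Y (e a)} {f' : ∀ b, Y b ⟶ Z (e' b)}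
    {m : w.eval X ⟶ w'.eval Y} {m' : w'.eval Y ⟶ w''.eval Z} (h : IsCanon w w' e f m)
    (h' : IsCanon w' w'' e' f' m') :
    IsCanon w w'' (fun a => e' (e a)) (fun a => f a ≫ f' (e a)) (m ≫ m') := by
  obtain ⟨p, rfl⟩ := h
  obtain ⟨p', rfl⟩ := h'
  refine ⟨.comp (.mapMapInv w e e') (.comp (p.map e') p'), ?_⟩
  have h : (w.mapIso e Y).inv ≫ (w.map e).evalMap f' =
      (w.evalMap fun a => f' (e a)) ≫ (w.mapIso e fun b => Z (e' b)).inv := by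
    rw [Iso.inv_comp_eq, ← Category.assoc, Iso.eq_comp_inv]
    exact evalMap_mapIso w e f'
  simp only [Path.eval, Category.assoc]
  rw [reassoc_of% @Path.eval_natural, reassoc_of% @Path.eval_map, reassoc_of% h, reassoc_of% @Path.eval_mapMapInv,
    ← evalMap_comp, Category.assoc]

theorem congr {w : Word α} {w' : Word β} {e e' : α → β} {X : α → C} {Z : β → C}
    {f : ∀ a, X a ⟶ Z (e a)} {f' : ∀ a, X a ⟶ Z (e' a)} {m m' : w.eval X ⟶ w'.eval Z}
    (h : IsCanon w w' e f m) (he : ∀ a, e a = e' a)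
    (hf : ∀ a, f a ≫ eqToHom (congrArg Z (he a)) = f' a) (hm : m = m') :
    IsCanon w w' e' f' m' := by
  obtain rfl : e = e' := funext he
  obtain rfl : f = f' := funext fun a => by rw [← hf a]; simp
  rwa [← hm]

theorem mapIso_inv (w : Word α) (e : α → β) (Z : β → C) :
    IsCanon w (w.map e) e (fun a => 𝟙 (Z (e a))) (w.mapIso e Z).inv := by
  refine ⟨.id _, ?_⟩
  rw [evalMap_id, Category.id_comp, Path.eval, Category.comp_id]

/-- For maps out of a relabelled word. The family `f` is given on all of `β` because `k` will be an
inclusion such as `Sum.inl` or `Sigma.mk b`, and words with different inclusions are afterwards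
combined into one. -/
theorem mapIso_comp {w : Word α} {w' : Word γ} {k : α → β} {e : β → γ} {X : β → C} {Z : γ → C}
    {f : ∀ b, X b ⟶ Z (e b)} {m : w.eval (fun a => X (k a)) ⟶ w'.eval Z}
    (h : IsCanon w w' (fun a => e (k a)) (fun a => f (k a)) m) :
    IsCanon (w.map k) w' e f ((w.mapIso k X).hom ≫ m) := by
  obtain ⟨p, rfl⟩ := h
  refine ⟨.comp (.mapMap w k e) p, ?_⟩
  have h : (Path.mapMap w k e).eval Z = ((w.map k).mapIso e Z).hom ≫
      (w.mapIso k fun b => Z (e b)).hom ≫ (w.mapIso (fun a => e (k a)) Z).inv := by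
    rw [← Category.assoc, Iso.eq_comp_inv, Path.eval_mapMap]
  rw [← reassoc_of% @evalMap_mapIso, Path.eval, h]
  simp only [Category.assoc, Iso.inv_hom_id_assoc]

theorem tensor {w v : Word α} {w' v' : Word β} {e : α → β} {X : α → C} {Z : β → C}
    {f : ∀ a, X a ⟶ Z (e a)} {m : w.eval X ⟶ w'.eval Z} {n : v.eval X ⟶ v'.eval Z}
    (h : IsCanon w w' e f m) (h' : IsCanon v v' e f n) :
    IsCanon (.tensor w v) (.tensor w' v') e f (m ⊗ₘ n) := by
  obtain ⟨p, rfl⟩ := h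
  obtain ⟨q, rfl⟩ := h'
  refine ⟨.tensor p q, ?_⟩
  refine (tensorHom_comp_tensorHom _ _ _ _).symm.trans (congrArg (_ ≫ ·) ?_)
  exact (tensorHom_comp_tensorHom _ _ _ _).symm

/-- Canonical maps form an operad: relabelling inside, then the inner paths, then the outer path
with words substituted for its letters, make up one path. -/
theorem bind {w : Word α} {w' : Word β} {e : α → β} {γ δ : Type} {g : α → Word γ}
    {g' : β → Word δ} {k : γ → δ} {X : γ → C} {Z : δ → C} {f : ∀ c, X c ⟶ Z (k c)}
    {φ : ∀ a, (g a).eval X ⟶ (g' (e a)).eval Z}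
    {m : w.eval (fun a => (g a).eval X) ⟶ w'.eval (fun b => (g' b).eval Z)}
    (h : IsCanon w w' e φ m) (h' : ∀ a, IsCanon (g a) (g' (e a)) k f (φ a)) :
    IsCanon (w.bind g) (w'.bind g') k f
      ((w.bindIso g X).hom ≫ m ≫ (w'.bindIso g' Z).inv) := by
  obtain ⟨p, rfl⟩ := h
  choose q hq using h'
  refine ⟨.comp (.bindMap w g k) (.comp (.inner w q) (.comp (.mapBindInv w e g') (p.bind g'))), ?_⟩
  have h : w.evalMap φ = w.evalMap (fun a => (g a).evalMap f) ≫
      w.evalMap (fun a => ((g a).mapIso k Z).inv) ≫ w.evalMap fun a => (q a).eval Z := by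
    rw [evalMap_comp, evalMap_comp]
    exact congrArg w.evalMap (funext hq)
  rw [← cancel_mono (w'.bindIso g' Z).hom]
  simp only [Path.eval, Category.assoc, Iso.inv_hom_id, Category.comp_id]
  rw [Path.eval_bind, reassoc_of% @Path.eval_mapBindInv, reassoc_of% @Path.eval_inner, reassoc_of% @Path.eval_bindMap,
    Iso.inv_hom_id_assoc, reassoc_of% @evalMap_bindIso, h]
  simp only [Category.assoc]

end IsCanon

end Eval

end Word

/-! ### Substitution of words in disjoint letters, and its associativity. -/

namespace Word

variable {α β : Type}

section SubIso

variable {C : Type u} [Category.{v} C] [MonoidalCategory C]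

/-- The value of a word with words in disjoint letters substituted in it. -/
def subIso {γ : β → Type} (w : Word β) (g : ∀ b, Word (γ b)) (Z : (Σ b, γ b) → C) :
    (w.bind fun b => (g b).map (Sigma.mk b)).eval Z ≅
      w.eval fun b => (g b).eval fun c => Z ⟨b, c⟩ where
  hom := (w.bindIso _ Z).hom ≫ w.evalMap fun b => ((g b).mapIso (Sigma.mk b) Z).hom
  inv := w.evalMap (fun b => ((g b).mapIso (Sigma.mk b) Z).inv) ≫ (w.bindIso _ Z).inv
  hom_inv_id := by
    rw [Category.assoc, ← Category.assoc (w.evalMap _), Word.evalMap_comp]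
    simp only [Iso.hom_inv_id, Word.evalMap_id, Category.id_comp]
  inv_hom_id := by
    rw [Category.assoc, Iso.inv_hom_id_assoc, Word.evalMap_comp]
    simp only [Iso.inv_hom_id, Word.evalMap_id]

theorem evalMap_subIso {γ : β → Type} (w : Word β) (g : ∀ b, Word (γ b)) {X Z : (Σ b, γ b) → C}
    (f : ∀ p, X p ⟶ Z p) :
    (w.bind fun b => (g b).map (Sigma.mk b)).evalMap f ≫ (w.subIso g Z).hom =
      (w.subIso g X).hom ≫ w.evalMap fun b => (g b).evalMap fun c => f ⟨b, c⟩ := by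
  simp only [subIso, reassoc_of% @evalMap_bindIso, evalMap_comp, evalMap_mapIso, Category.assoc]

variable [SymmetricCategory C]

/-- The inner maps have letters in different types; tagging these by `Sigma.mk` puts them into one
alphabet, where `IsCanon.bind` applies. -/
theorem IsCanon.sub {β' : Type} {γ : β → Type} {γ' : β' → Type} {w : Word β}
    {w' : Word β'} {g : ∀ b, Word (γ b)} {g' : ∀ b, Word (γ' b)} {e : β → β'}
    {k : ∀ b, γ b → γ' (e b)} {X : (Σ b, γ b) → C} {Z : (Σ b, γ' b) → C}
    {f : ∀ p : Σ b, γ b, X p ⟶ Z ⟨e p.1, k p.1 p.2⟩}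
    {φ : ∀ b, ((g b).eval fun c => X ⟨b, c⟩) ⟶ (g' (e b)).eval fun c => Z ⟨e b, c⟩}
    {m : w.eval (fun b => (g b).eval fun c => X ⟨b, c⟩) ⟶
      w'.eval (fun b => (g' b).eval fun c => Z ⟨b, c⟩)} (h : IsCanon w w' e φ m)
    (h' : ∀ b, IsCanon (g b) (g' (e b)) (k b) (fun c => f ⟨b, c⟩) (φ b)) :
    IsCanon (w.bind fun b => (g b).map (Sigma.mk b)) (w'.bind fun b => (g' b).map (Sigma.mk b))
      (fun p => ⟨e p.1, k p.1 p.2⟩) f ((w.subIso g X).hom ≫ m ≫ (w'.subIso g' Z).inv) := by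
  have h₁ (b) : IsCanon ((g b).map (Sigma.mk b)) ((g' (e b)).map (Sigma.mk (e b)))
      (fun p => (⟨e p.1, k p.1 p.2⟩ : Σ b, γ' b)) f
      (((g b).mapIso (Sigma.mk b) X).hom ≫ φ b ≫ ((g' (e b)).mapIso (Sigma.mk (e b)) Z).inv) := by
    have h := (h' b).comp (IsCanon.mapIso_inv _ (Sigma.mk (e b)) Z)
    simp only [Category.comp_id] at h
    exact IsCanon.mapIso_comp (k := Sigma.mk b) (f := f) h
  have h₂ := (IsCanon.evalMap w fun b => ((g b).mapIso (Sigma.mk b) X).hom).comp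
    (h.comp (IsCanon.evalMap w' fun b => ((g' b).mapIso (Sigma.mk b) Z).inv))
  have h₃ := h₂.bind h₁
  simpa only [subIso, Category.assoc] using h₃

section Assoc

/-- The triples with given first two entries. -/
abbrev nest {γ : β → Type} {δ : ∀ b, γ b → Type} (p : Σ b, γ b) (d : δ p.1 p.2) :
    Σ p : Σ b, γ b, δ p.1 p.2 :=
  ⟨p, d⟩

variable {γ : β → Type} {δ : ∀ b, γ b → Type} (k : ∀ p : Σ b, γ b, Word (δ p.1 p.2))
  (Z : (Σ b, Σ c, δ b c) → C)

/-- Regrouping of triples. -/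
abbrev regroup (q : Σ p : Σ b, γ b, δ p.1 p.2) : Σ b, Σ c, δ b c := ⟨q.1.1, q.1.2, q.2⟩

/-- Regrouping of substituted words. -/
def bindMapMap (b : β) (v : Word (γ b)) :
    ((v.map (Sigma.mk b)).bind fun p => (k p).map (nest p)).eval
        (fun q => Z (regroup q)) ⟶
      ((v.bind fun c => (k ⟨b, c⟩).map (Sigma.mk c)).map (Sigma.mk b)).eval Z :=
  ((v.map (Sigma.mk b)).bindIso _ _).hom ≫ (v.mapIso (Sigma.mk b) _).hom ≫
    v.evalMap (fun c => ((k ⟨b, c⟩).mapIso (nest ⟨b, c⟩)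
      (fun q => Z (regroup q))).hom) ≫
    v.evalMap (fun c => ((k ⟨b, c⟩).mapIso (Sigma.mk c) (fun q => Z ⟨b, q⟩)).inv) ≫
    (v.bindIso _ (fun q => Z ⟨b, q⟩)).inv ≫ ((v.bind _).mapIso (Sigma.mk b) Z).inv

/-- Regrouping of substituted words. -/
def bindBindMap (w : Word β) (g : ∀ b, Word (γ b)) :
    ((w.bind fun b => (g b).map (Sigma.mk b)).bind fun p => (k p).map (nest p)).eval
        (fun q => Z (regroup q)) ⟶
      (w.bind fun b =>
        ((g b).bind fun c => (k ⟨b, c⟩).map (Sigma.mk c)).map (Sigma.mk b)).eval Z :=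
  ((w.bind _).bindIso _ _).hom ≫ (w.bindIso _ _).hom ≫
    w.evalMap (fun b => (((g b).map (Sigma.mk b)).bindIso _ _).inv ≫ bindMapMap k Z b (g b)) ≫
      (w.bindIso _ Z).inv

theorem bindBindMap_leaf (b : β) (g : ∀ b, Word (γ b)) :
    bindBindMap k Z (.leaf b) g = bindMapMap k Z b (g b) := by
  refine (congrArg (_ ≫ ·) ((Category.id_comp _).trans (Category.comp_id _))).trans ?_
  exact Iso.hom_inv_id_assoc _ _

/-- Induction on the word: at a leaf the map is two successive relabellings, and on a tensor product
it splits by the interchange law. -/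
theorem isCanon_bindMapMap (b : β) (v : Word (γ b)) :
    IsCanon ((v.map (Sigma.mk b)).bind fun p => (k p).map (nest p))
      ((v.bind fun c => (k ⟨b, c⟩).map (Sigma.mk c)).map (Sigma.mk b))
      regroup (fun _ => 𝟙 _) (bindMapMap k Z b v) := by
  induction v with
  | unit =>
    refine ⟨.id _, ?_⟩
    change 𝟙 (𝟙_ C) ≫ 𝟙 (𝟙_ C) ≫ 𝟙 (𝟙_ C) ≫ 𝟙 (𝟙_ C) ≫ 𝟙 (𝟙_ C) ≫ 𝟙 (𝟙_ C) =
      𝟙 (𝟙_ C) ≫ 𝟙 (𝟙_ C) ≫ 𝟙 (𝟙_ C)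
    simp
  | leaf c =>
    have h := (IsCanon.mapIso_inv (k ⟨b, c⟩) (Sigma.mk c) fun q => Z ⟨b, q⟩).comp
      (IsCanon.mapIso_inv ((k ⟨b, c⟩).map (Sigma.mk c))
        (fun q => (⟨b, q⟩ : Σ b, Σ c, δ b c)) Z)
    have h' := IsCanon.mapIso_comp (w := k ⟨b, c⟩) (k := nest ⟨b, c⟩) (e := regroup)
      (X := fun q => Z (regroup q)) (f := fun _ => 𝟙 _)
      (h.congr (fun _ => rfl) (fun _ => by simp) rfl)
    refine h'.congr (fun _ => rfl) (fun _ => by simp) ?_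
    refine ((Category.id_comp _).trans ((Category.id_comp _).trans (congrArg (_ ≫ ·) ?_))).symm
    exact congrArg (_ ≫ ·) (Category.id_comp _)
  | tensor s t hs ht =>
    have : bindMapMap k Z b (.tensor s t) = bindMapMap k Z b s ⊗ₘ bindMapMap k Z b t := by
      simp only [bindMapMap, ← tensorHom_comp_tensorHom]
      rfl
    rw [this]
    exact hs.tensor ht

theorem isCanon_bindBindMap (w : Word β) (g : ∀ b, Word (γ b)) :
    IsCanon ((w.bind fun b => (g b).map (Sigma.mk b)).bind fun p => (k p).map (nest p))
      (w.bind fun b => ((g b).bind fun c => (k ⟨b, c⟩).map (Sigma.mk c)).map (Sigma.mk b))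
      regroup (fun _ => 𝟙 _) (bindBindMap k Z w g) := by
  induction w with
  | unit =>
    refine ⟨.id _, ?_⟩
    change 𝟙 (𝟙_ C) ≫ 𝟙 (𝟙_ C) ≫ 𝟙 (𝟙_ C) ≫ 𝟙 (𝟙_ C) = 𝟙 (𝟙_ C) ≫ 𝟙 (𝟙_ C) ≫ 𝟙 (𝟙_ C)
    simp
  | leaf b =>
    rw [bindBindMap_leaf]
    exact isCanon_bindMapMap k Z b (g b)
  | tensor s t hs ht =>
    have : bindBindMap k Z (.tensor s t) g = bindBindMap k Z s g ⊗ₘ bindBindMap k Z t g := by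
      simp only [bindBindMap, ← tensorHom_comp_tensorHom]
      rfl
    rw [this]
    exact hs.tensor ht

/-- The regrouping map intertwines the two ways of evaluating a double substitution, as all
relabellings cancel. Being canonical, it is later identified with `canon` for `Equiv.sigmaAssoc`,
which gives `subMap_subMap`. -/
theorem bindBindMap_subIso (w : Word β) (g : ∀ b, Word (γ b)) :
    bindBindMap k Z w g ≫ (w.subIso (fun b => (g b).bind fun c =>
        (k ⟨b, c⟩).map (Sigma.mk c)) Z).hom ≫ w.evalMap (fun b => ((g b).subIso
          (fun c => k ⟨b, c⟩) fun q => Z ⟨b, q⟩).hom) =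
      ((w.bind fun b => (g b).map (Sigma.mk b)).subIso k
          fun q => Z (regroup q)).hom ≫
        (w.subIso g fun p => (k p).eval fun d => Z (regroup (nest p d))).hom := by
  simp only [bindBindMap, bindMapMap, subIso, Category.assoc, Iso.inv_hom_id_assoc, evalMap_comp]
  rw [reassoc_of% @evalMap_bindIso, evalMap_comp]
  refine congrArg (_ ≫ ·) (congrArg (_ ≫ ·) (congrArg w.evalMap (funext fun b => ?_)))
  rw [evalMap_mapIso]
  refine congrArg (_ ≫ ·) (congrArg (g b).evalMap (funext fun c => ?_))
  rw [Iso.inv_hom_id]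
  exact Category.comp_id _

end Assoc

theorem isCanon_bindIso_leaf (w : Word β) (Y : β → C) :
    IsCanon (w.bind fun b => .leaf (⟨b, 0⟩ : Σ _ : β, Fin 1)) w (fun p => p.1) (fun _ => 𝟙 _)
      (w.bindIso (fun b => .leaf (⟨b, 0⟩ : Σ _ : β, Fin 1)) fun p => Y p.1).hom := by
  induction w with
  | unit =>
    refine ⟨.id _, ?_⟩
    change 𝟙 (𝟙_ C) = 𝟙 (𝟙_ C) ≫ 𝟙 (𝟙_ C) ≫ 𝟙 (𝟙_ C)
    simp
  | leaf b =>
    refine ⟨.id _, ?_⟩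
    change 𝟙 (Y b) = 𝟙 (Y b) ≫ 𝟙 (Y b) ≫ 𝟙 (Y b)
    simp
  | tensor s t hs ht => exact hs.tensor ht

end SubIso

end Word

/-! ### Canonical maps between linear words. -/

namespace LinWord

variable {α β γ : Type}

section Shuffle

variable {C : Type u} [Category.{v} C] [MonoidalCategory C] [SymmetricCategory C]

/-- The canonical map between two products given by a bijection of letters and maps of the
corresponding objects. -/
def shuffle (w : LinWord α) (w' : LinWord β) (e : α ≃ β) {X : α → C} {Z : β → C}
    (f : ∀ a, X a ⟶ Z (e a)) : w.eval X ⟶ w'.eval Z :=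
  w.word.evalMap f ≫ (w.word.mapIso e Z).inv ≫
    (Classical.choice (Word.exists_path (perm (w.map e) w'))).eval Z

theorem canon_eq_shuffle (w : LinWord α) (w' : LinWord β) (e : α ≃ β) {X : α → C} {Z : β → C}
    (h : ∀ a, X a = Z (e a)) : w.canon w' e h = w.shuffle w' e fun a => eqToHom (h a) :=
  rfl

theorem isCanon_shuffle (w : LinWord α) (w' : LinWord β) (e : α ≃ β) {X : α → C} {Z : β → C}
    (f : ∀ a, X a ⟶ Z (e a)) : Word.IsCanon w.word w'.word e f (w.shuffle w' e f) :=
  ⟨_, rfl⟩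

/-- Coherence enters here: the path in `IsCanon` and the one chosen in `shuffle` are parallel and
start at a linear word. Most identities below come from showing `IsCanon` for one side. -/
theorem eq_shuffle {w : LinWord α} {w' : LinWord β} {e : α ≃ β} {X : α → C} {Z : β → C}
    {f : ∀ a, X a ⟶ Z (e a)} {m : w.eval X ⟶ w'.eval Z}
    (h : Word.IsCanon w.word w'.word e f m) : m = w.shuffle w' e f := by
  obtain ⟨p, rfl⟩ := h
  exact congrArg (fun q => w.word.evalMap f ≫ (w.word.mapIso e Z).inv ≫ q)
    (p.eval_eq (w.map e).nodup (w.map e).mem _ Z)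

theorem eq_canon {w : LinWord α} {w' : LinWord β} {X : α → C} {Z : β → C} {e' : α → β}
    {f : ∀ a, X a ⟶ Z (e' a)} {m : w.eval X ⟶ w'.eval Z} (H : Word.IsCanon w.word w'.word e' f m)
    (e : α ≃ β) (he : ∀ a, e' a = e a) (h : ∀ a, X a = Z (e a))
    (hf : ∀ a, f a = eqToHom ((h a).trans (congrArg Z (he a)).symm)) : m = w.canon w' e h := by
  obtain rfl : e' = e := funext he
  obtain rfl : f = fun a => eqToHom (h a) := funext hf
  exact eq_shuffle H

theorem shuffle_congr (w : LinWord α) (w' : LinWord β) {e e' : α ≃ β} {X : α → C} {Z : β → C}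
    {f : ∀ a, X a ⟶ Z (e a)} {f' : ∀ a, X a ⟶ Z (e' a)} (he : ∀ a, e a = e' a)
    (hf : ∀ a, f a ≫ eqToHom (congrArg Z (he a)) = f' a) :
    w.shuffle w' e f = w.shuffle w' e' f' :=
  eq_shuffle ((isCanon_shuffle w w' e f).congr he hf rfl)

theorem canon_congr (w : LinWord α) (w' : LinWord β) {e e' : α ≃ β} {X : α → C} {Z : β → C}
    (h : ∀ a, X a = Z (e a)) (he : e = e') :
    w.canon w' e h = w.canon w' e' fun a => (h a).trans (congrArg (fun e => Z (e a)) he) := by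
  subst he
  rfl

theorem shuffle_comp (w : LinWord α) (w' : LinWord β) (w'' : LinWord γ) (e : α ≃ β) (e' : β ≃ γ)
    {X : α → C} {Y : β → C} {Z : γ → C} (f : ∀ a, X a ⟶ Y (e a)) (f' : ∀ b, Y b ⟶ Z (e' b)) :
    w.shuffle w' e f ≫ w'.shuffle w'' e' f' =
      w.shuffle w'' (e.trans e') fun a => f a ≫ f' (e a) :=
  eq_shuffle ((isCanon_shuffle w w' e f).comp (isCanon_shuffle w' w'' e' f'))

theorem canon_comp (w : LinWord α) (w' : LinWord β) (w'' : LinWord γ) (e : α ≃ β) (e' : β ≃ γ)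
    {X : α → C} {Y : β → C} {Z : γ → C} (h : ∀ a, X a = Y (e a)) (h' : ∀ b, Y b = Z (e' b)) :
    w.canon w' e h ≫ w'.canon w'' e' h' =
      w.canon w'' (e.trans e') fun a => (h a).trans (h' (e a)) := by
  simp only [canon_eq_shuffle, shuffle_comp]
  exact shuffle_congr _ _ (fun _ => rfl) fun a =>
    (Category.comp_id _).trans (eqToHom_trans _ _)

theorem evalMap_eq_shuffle (w : LinWord α) {X Z : α → C} (f : ∀ a, X a ⟶ Z a) :
    w.word.evalMap f = w.shuffle w (Equiv.refl α) f :=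
  eq_shuffle (Word.IsCanon.evalMap w.word f)

theorem canon_refl (w : LinWord α) {X : α → C} (h : ∀ a, X a = X (Equiv.refl α a)) :
    w.canon w (Equiv.refl α) h = 𝟙 (w.eval X) :=
  (evalMap_eq_shuffle w fun a => 𝟙 (X a)).symm.trans (w.word.evalMap_id X)

theorem canon_eq_id (w : LinWord α) {X : α → C} (e : α ≃ α) (he : e = Equiv.refl α)
    (h : ∀ a, X a = X (e a)) : w.canon w e h = 𝟙 (w.eval X) := by
  subst he
  exact canon_refl w h

theorem shuffle_evalMap (w : LinWord α) (w' : LinWord β) (e : α ≃ β) {X : α → C} {Z Z' : β → C}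
    (f : ∀ a, X a ⟶ Z (e a)) (k : ∀ b, Z b ⟶ Z' b) :
    w.shuffle w' e f ≫ w'.word.evalMap k = w.shuffle w' e fun a => f a ≫ k (e a) := by
  exact eq_shuffle ((isCanon_shuffle w w' e f).comp (Word.IsCanon.evalMap w'.word k))

theorem evalMap_shuffle (w : LinWord α) (w' : LinWord β) (e : α ≃ β) {X X' : α → C} {Z : β → C}
    (k : ∀ a, X a ⟶ X' a) (f : ∀ a, X' a ⟶ Z (e a)) :
    w.word.evalMap k ≫ w.shuffle w' e f = w.shuffle w' e fun a => k a ≫ f a := by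
  exact eq_shuffle ((Word.IsCanon.evalMap w.word k).comp (isCanon_shuffle w w' e f))

/-- The canonical isomorphism between two products of the same objects. -/
theorem canon_canon_symm (w : LinWord α) (w' : LinWord β) (e : α ≃ β) {X : α → C} {Z : β → C}
    (h : ∀ a, X a = Z (e a)) (h' : ∀ b, Z b = X (e.symm b)) :
    w.canon w' e h ≫ w'.canon w e.symm h' = 𝟙 _ := by
  rw [canon_comp]
  exact canon_eq_id _ _ (Equiv.self_trans_symm e) _

instance isIso_canon (w : LinWord α) (w' : LinWord β) (e : α ≃ β) {X : α → C} {Z : β → C}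
    (h : ∀ a, X a = Z (e a)) : IsIso (w.canon w' e h) := by
  have h' : ∀ b, Z b = X (e.symm b) := fun b => by rw [h, Equiv.apply_symm_apply]
  exact ⟨w'.canon w e.symm h', canon_canon_symm w w' e h h', canon_canon_symm w' w e.symm h' h⟩

/-- The value of a substituted word. -/
def subIso {γ : β → Type} (w : LinWord β) (g : ∀ b, LinWord (γ b)) (Z : (Σ b, γ b) → C) :
    (w.sub g).eval Z ≅ w.eval fun b => (g b).eval fun c => Z ⟨b, c⟩ :=
  w.word.subIso (fun b => (g b).word) Z

/-- Separates the regrouping, which is an isomorphism and natural, from the maps `φ`. -/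
theorem subMap_eq {γ : β → Type} (w : LinWord β) (g : ∀ b, LinWord (γ b)) {Z : (Σ b, γ b) → C}
    {Y : β → C} (φ : ∀ b, (g b).eval (fun c => Z ⟨b, c⟩) ⟶ Y b) :
    w.subMap g φ = (w.subIso g Z).hom ≫ w.word.evalMap φ := by
  refine Eq.trans ?_ (Category.assoc _ _ _).symm
  rw [Word.evalMap_comp]
  rfl

/-- Substitution is natural. -/
theorem shuffle_subIso {β' : Type} {γ : β → Type} {γ' : β' → Type} (w : LinWord β)
    (w' : LinWord β') (g : ∀ b, LinWord (γ b)) (g' : ∀ b, LinWord (γ' b)) (e : β ≃ β')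
    (k : ∀ b, γ b ≃ γ' (e b)) {X : (Σ b, γ b) → C} {Z : (Σ b, γ' b) → C}
    (f : ∀ p : Σ b, γ b, X p ⟶ Z ⟨e p.1, k p.1 p.2⟩) :
    (w.sub g).shuffle (w'.sub g') (Equiv.sigmaCongr e k) f ≫ (w'.subIso g' Z).hom =
      (w.subIso g X).hom ≫
        w.shuffle w' e fun b => (g b).shuffle (g' (e b)) (k b) fun c => f ⟨b, c⟩ := by
  have h₀ := (isCanon_shuffle w w' e fun b =>
      (g b).shuffle (g' (e b)) (k b) fun c => f ⟨b, c⟩).sub (g := fun b => (g b).word)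
    (g' := fun b => (g' b).word) (k := fun b => k b) (X := X) (Z := Z) (f := f)
    fun b => isCanon_shuffle (g b) (g' (e b)) (k b) (X := fun c => X ⟨b, c⟩)
      (Z := fun c => Z ⟨e b, c⟩) fun c => f ⟨b, c⟩
  have h := eq_shuffle (w := w.sub g) (w' := w'.sub g') (e := Equiv.sigmaCongr e k) h₀
  rw [← h]
  exact (Category.assoc _ _ _).trans (congrArg (_ ≫ ·) ((Category.assoc _ _ _).trans
    ((congrArg (_ ≫ ·) (Iso.inv_hom_id _)).trans (Category.comp_id _))))

/-- Substitution is natural. -/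
theorem shuffle_subMap {β' : Type} {γ : β → Type} {γ' : β' → Type} (w : LinWord β)
    (w' : LinWord β') (g : ∀ b, LinWord (γ b)) (g' : ∀ b, LinWord (γ' b)) (e : β ≃ β')
    (k : ∀ b, γ b ≃ γ' (e b)) {X : (Σ b, γ b) → C} {Z : (Σ b, γ' b) → C} {Y : β' → C}
    (f : ∀ p : Σ b, γ b, X p ⟶ Z ⟨e p.1, k p.1 p.2⟩)
    (φ : ∀ b, (g' b).eval (fun c => Z ⟨b, c⟩) ⟶ Y b) :
    (w.sub g).shuffle (w'.sub g') (Equiv.sigmaCongr e k) f ≫ w'.subMap g' φ =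
      w.subMap g (fun b => (g b).shuffle (g' (e b)) (k b) (Z := fun c => Z ⟨e b, c⟩)
        (fun c => f ⟨b, c⟩) ≫ φ (e b)) ≫ w.canon w' e fun _ => rfl := by
  rw [subMap_eq, subMap_eq, reassoc_of% @shuffle_subIso, shuffle_evalMap, canon_eq_shuffle,
    Category.assoc, evalMap_shuffle]
  exact congrArg (_ ≫ ·) (shuffle_congr _ _ (fun _ => rfl) fun b => rfl)

/-- Naturality with the outer bijection trivial: canonical maps of the inner words are absorbed into
the maps `φ`. In `canon_subMap_left` the inner bijections are trivial instead. -/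
theorem canon_subMap_right {γ γ' : β → Type} (w : LinWord β) (g : ∀ b, LinWord (γ b))
    (g' : ∀ b, LinWord (γ' b)) (k : ∀ b, γ b ≃ γ' b) {X : (Σ b, γ b) → C} {Z : (Σ b, γ' b) → C}
    {Y : β → C} (h : ∀ p, X p = Z (Equiv.sigmaCongrRight k p))
    (φ : ∀ b, (g' b).eval (fun c => Z ⟨b, c⟩) ⟶ Y b) :
    (w.sub g).canon (w.sub g') (Equiv.sigmaCongrRight k) h ≫ w.subMap g' φ =
      w.subMap g fun b => (g b).canon (g' b) (k b) (Z := fun c => Z ⟨b, c⟩)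
        (fun c => h ⟨b, c⟩) ≫ φ b := by
  have := shuffle_subMap w w g g' (Equiv.refl β) k (fun p => eqToHom (h p)) φ
  refine this.trans ((congrArg (_ ≫ ·) (canon_refl w _)).trans (Category.comp_id _))

theorem canon_subMap_left {β' : Type} {γ : β' → Type} (w : LinWord β)
    (w' : LinWord β') (g : ∀ b, LinWord (γ b)) (e : β ≃ β') {X : (Σ b, γ (e b)) → C}
    {Z : (Σ b, γ b) → C} {Y : β' → C}
    (h : ∀ p, X p = Z (Equiv.sigmaCongrLeft (β := γ) e p))
    (φ : ∀ b, (g b).eval (fun c => Z ⟨b, c⟩) ⟶ Y b) :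
    (w.sub fun b => g (e b)).canon (w'.sub g) (Equiv.sigmaCongrLeft (β := γ) e) h ≫
        w'.subMap g φ =
      w.subMap (fun b => g (e b)) (fun b => (g (e b)).canon (g (e b)) (Equiv.refl _)
        (Z := fun c => Z ⟨e b, c⟩) (fun c => h ⟨b, c⟩) ≫ φ (e b)) ≫
        w.canon w' e fun _ => rfl :=
  shuffle_subMap w w' (fun b => g (e b)) g e (fun _ => Equiv.refl _) (fun p => eqToHom (h p)) φ

/-- Substitution is associative. -/
theorem subMap_subMap {γ : β → Type} {δ : ∀ b, γ b → Type} (w : LinWord β)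
    (g : ∀ b, LinWord (γ b)) (k : ∀ p : Σ b, γ b, LinWord (δ p.1 p.2))
    {Z : (Σ b, Σ c, δ b c) → C} {X : (Σ b, γ b) → C} {Y : β → C}
    (χ : ∀ p : Σ b, γ b, (k p).eval (fun d => Z ⟨p.1, p.2, d⟩) ⟶ X p)
    (φ : ∀ b, (g b).eval (fun c => X ⟨b, c⟩) ⟶ Y b) :
    (w.sub g).subMap k (Z := fun q => Z ⟨q.1.1, q.1.2, q.2⟩) χ ≫ w.subMap g φ =
      ((w.sub g).sub k).canon (w.sub fun b => (g b).sub fun c => k ⟨b, c⟩) (Equiv.sigmaAssoc δ)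
          (fun _ => rfl) ≫
        w.subMap (fun b => (g b).sub fun c => k ⟨b, c⟩) fun b =>
          (g b).subMap (fun c => k ⟨b, c⟩) (Z := fun q => Z ⟨b, q⟩) (fun c => χ ⟨b, c⟩) ≫ φ b := by
  have h₁ : Word.bindBindMap (fun p => (k p).word) Z w.word (fun b => (g b).word) =
      ((w.sub g).sub k).canon (w.sub fun b => (g b).sub fun c => k ⟨b, c⟩) (Equiv.sigmaAssoc δ)
        fun _ => rfl :=
    eq_canon (w := (w.sub g).sub k) (w' := w.sub fun b => (g b).sub fun c => k ⟨b, c⟩)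
      (Word.isCanon_bindBindMap (fun p => (k p).word) Z w.word fun b => (g b).word)
      (Equiv.sigmaAssoc δ) (fun _ => rfl) (fun _ => rfl) fun _ => rfl
  have h₂ := Word.bindBindMap_subIso (fun p => (k p).word) Z w.word (fun b => (g b).word)
  rw [h₁] at h₂
  have h₃ := Word.evalMap_subIso w.word (fun b => (g b).word) χ
  simp only [subMap_eq]
  refine (Category.assoc _ _ _).trans ((congrArg (_ ≫ ·) ((Category.assoc _ _ _).symm.trans
    (congrArg (· ≫ _) h₃))).trans ?_)
  refine (congrArg (_ ≫ ·) (Category.assoc _ _ _)).trans ((Category.assoc _ _ _).symm.trans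
    ((congrArg (· ≫ _) h₂.symm).trans ?_))
  refine (Category.assoc _ _ _).trans (congrArg (_ ≫ ·) ((Category.assoc _ _ _).trans
    (congrArg (_ ≫ ·) ?_)))
  rw [Word.evalMap_comp, Word.evalMap_comp]
  exact congrArg w.word.evalMap (funext fun b => (Category.assoc _ _ _).symm)

/-- This and `one_subMap` are the unit laws of operadic substitution. -/
theorem subMap_one {Y : β → C} (w : LinWord β) :
    w.subMap (fun _ => one) (Z := fun p => Y p.1) (fun b => 𝟙 (Y b)) =
      (w.sub fun _ => one).canon w (Equiv.sigmaUnique β fun _ => Fin 1) fun _ => rfl := by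
  have : w.subMap (fun _ => one) (Z := fun p => Y p.1) (fun b => 𝟙 (Y b)) =
      (w.word.bindIso (fun b => .leaf (⟨b, 0⟩ : Σ _ : β, Fin 1)) fun p => Y p.1).hom := by
    refine (congrArg (_ ≫ ·) ?_).trans (Category.comp_id _)
    exact (congrArg w.word.evalMap (funext fun b => Category.comp_id _)).trans
      (w.word.evalMap_id Y)
  rw [this]
  exact eq_canon (w := w.sub fun _ => one) (w' := w)
    (Word.isCanon_bindIso_leaf w.word Y) _ (fun _ => rfl) _ fun _ => rfl

theorem one_subMap {Z : (Σ _ : Fin 1, α) → C} {Y : Fin 1 → C} (g : LinWord α)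
    (φ : ∀ b, g.eval (fun c => Z ⟨b, c⟩) ⟶ Y b) (h) :
    one.subMap (fun _ => g) φ = (one.sub fun _ => g).canon g
      ((Equiv.sigmaEquivProd (Fin 1) α).trans (Equiv.uniqueProd α (Fin 1)))
      (Z := fun c => Z ⟨0, c⟩) h ≫ φ 0 := by
  refine (Category.id_comp _).trans (congrArg (· ≫ φ 0) ?_)
  have h₀ := Word.IsCanon.evalMap g.word fun a => 𝟙 (Z ⟨0, a⟩)
  rw [Word.evalMap_id] at h₀
  have := Word.IsCanon.mapIso_comp (w := g.word) (w' := g.word) (X := Z)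
    (k := fun a => (⟨0, a⟩ : Σ _ : Fin 1, α)) (Z := fun c => Z ⟨0, c⟩)
    (e := fun p => p.2) (f := fun p => eqToHom (h p)) h₀
  have h' := eq_canon (w := one.sub fun _ => g) (w' := g) this _ (fun _ => rfl) h fun _ => rfl
  exact (Category.comp_id _).symm.trans h'

end Shuffle

end LinWord

/-! ### Words and lax symmetric monoidal functors -/

section LaxLemmas

open Functor.LaxMonoidal

variable {C D : Type u} [Category.{v} C] [Category.{v} D] [MonoidalCategory C]
  [MonoidalCategory D] (F : C ⥤ D)

/-- The tensor case of inductions on `Word.lax`, by naturality of `μ`. -/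
theorem tensor_mul [F.LaxMonoidal] {X X' Y Y' : C} {A A' B B' : D} {f : X ⟶ Y} {f' : X' ⟶ Y'}
    {l : A ⟶ F.obj X} {l' : A' ⟶ F.obj X'} {m : B ⟶ F.obj Y} {m' : B' ⟶ F.obj Y'} {g : A ⟶ B}
    {g' : A' ⟶ B'} (h : g ≫ m = l ≫ F.map f) (h' : g' ≫ m' = l' ≫ F.map f') :
    (g ⊗ₘ g') ≫ (m ⊗ₘ m') ≫ μ F Y Y' = ((l ⊗ₘ l') ≫ μ F X X') ≫ F.map (f ⊗ₘ f') := by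
  rw [tensorHom_comp_tensorHom_assoc, h, h', ← tensorHom_comp_tensorHom_assoc, μ_natural,
    Category.assoc]

theorem tensor_mul_of_comp [F.LaxMonoidal] {X X' Y Y' : C} {A A' B B' E E' : D} {f : X ⟶ Y}
    {f' : X' ⟶ Y'} {l : A ⟶ F.obj X} {l' : A' ⟶ F.obj X'} {m : E ⟶ F.obj Y} {m' : E' ⟶ F.obj Y'}
    {i : A ⟶ B} {i' : A' ⟶ B'} {g : B ⟶ E} {g' : B' ⟶ E'} (h : i ≫ g ≫ m = l ≫ F.map f)
    (h' : i' ≫ g' ≫ m' = l' ≫ F.map f') :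
    (i ⊗ₘ i') ≫ (g ⊗ₘ g') ≫ (m ⊗ₘ m') ≫ μ F Y Y' =
      ((l ⊗ₘ l') ≫ μ F X X') ≫ F.map (f ⊗ₘ f') := by
  rw [tensorHom_comp_tensorHom_assoc]
  exact tensor_mul F ((Category.assoc _ _ _).trans h) ((Category.assoc _ _ _).trans h')

theorem comp_mul [F.LaxMonoidal] {X X' Y Y' Z : C} {A A' : D} {f : X ⟶ Y} {f' : X' ⟶ Y'}
    (l : A ⟶ F.obj X) (l' : A' ⟶ F.obj X') (k : Y ⊗ Y' ⟶ Z) :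
    ((l ≫ F.map f) ⊗ₘ (l' ≫ F.map f')) ≫ μ F Y Y' ≫ F.map k =
      ((l ⊗ₘ l') ≫ μ F X X') ≫ F.map ((f ⊗ₘ f') ≫ k) := by
  rw [← tensorHom_comp_tensorHom_assoc, μ_natural_assoc, Functor.map_comp, Category.assoc]

/-- This and the next three lemmas are the axioms of a lax braided functor with arbitrary maps into
the factors, the form in which they occur as cases of `Path.eval_lax`. -/
theorem assoc_mul [F.LaxMonoidal] {X Y Z : C} {A B E : D} (a : A ⟶ F.obj X) (b : B ⟶ F.obj Y)
    (c : E ⟶ F.obj Z) :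
    (α_ A B E).hom ≫ (a ⊗ₘ ((b ⊗ₘ c) ≫ μ F Y Z)) ≫ μ F X (Y ⊗ Z) =
      ((((a ⊗ₘ b) ≫ μ F X Y) ⊗ₘ c) ≫ μ F (X ⊗ Y) Z) ≫ F.map (α_ X Y Z).hom := by
  have h₁ : (a ⊗ₘ ((b ⊗ₘ c) ≫ μ F Y Z)) = (a ⊗ₘ (b ⊗ₘ c)) ≫ F.obj X ◁ μ F Y Z := by
    rw [← id_tensorHom, tensorHom_comp_tensorHom, Category.comp_id]
  have h₂ : (((a ⊗ₘ b) ≫ μ F X Y) ⊗ₘ c) = ((a ⊗ₘ b) ⊗ₘ c) ≫ μ F X Y ▷ F.obj Z := by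
    rw [← tensorHom_id, tensorHom_comp_tensorHom, Category.comp_id]
  rw [h₁, h₂, Category.assoc, ← associator_naturality_assoc, Category.assoc, Category.assoc,
    associativity]

theorem left_mul [F.LaxMonoidal] {X : C} {A : D} (a : A ⟶ F.obj X) :
    (λ_ A).hom ≫ a = ((ε F ⊗ₘ a) ≫ μ F (𝟙_ C) X) ≫ F.map (λ_ X).hom := by
  have h : (ε F ⊗ₘ a) = 𝟙_ D ◁ a ≫ ε F ▷ F.obj X := by
    rw [← id_tensorHom, ← tensorHom_id, tensorHom_comp_tensorHom, Category.comp_id,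
      Category.id_comp]
  rw [h, Category.assoc, Category.assoc, ← left_unitality, leftUnitor_naturality]

theorem right_mul [F.LaxMonoidal] {X : C} {A : D} (a : A ⟶ F.obj X) :
    (ρ_ A).hom ≫ a = ((a ⊗ₘ ε F) ≫ μ F X (𝟙_ C)) ≫ F.map (ρ_ X).hom := by
  have h : (a ⊗ₘ ε F) = a ▷ 𝟙_ D ≫ F.obj X ◁ ε F := by
    rw [← id_tensorHom, ← tensorHom_id, tensorHom_comp_tensorHom, Category.comp_id,
      Category.id_comp]
  rw [h, Category.assoc, Category.assoc, ← right_unitality, rightUnitor_naturality]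

theorem braid_mul [BraidedCategory C] [BraidedCategory D] [F.LaxBraided] {X Y : C} {A B : D}
    (a : A ⟶ F.obj X) (b : B ⟶ F.obj Y) :
    (β_ A B).hom ≫ (b ⊗ₘ a) ≫ μ F Y X = ((a ⊗ₘ b) ≫ μ F X Y) ≫ F.map (β_ X Y).hom := by
  rw [Category.assoc, Functor.LaxBraided.braided, BraidedCategory.braiding_naturality_assoc]

end LaxLemmas

theorem eqToHom_tensor_eqToHom_comp {C : Type u} [Category.{v} C] [MonoidalCategory C]
    {X X' Y Y' Z : C} (h : X = Y) (h' : X' = Y') (k : Y ⊗ Y' = Z) :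
    (eqToHom h ⊗ₘ eqToHom h') ≫ eqToHom k =
      eqToHom ((congrArg₂ (fun A B : C => A ⊗ B) h h').trans k) := by
  subst h h' k
  simp

theorem comp_iso_inv_of_comp_hom {C : Type u} [Category.{v} C] {X Y X' Y' : C} {i : X ≅ Y}
    {i' : X' ≅ Y'} {l : X' ⟶ X} {m : Y' ⟶ Y} (h : i'.hom ≫ m = l ≫ i.hom) :
    i'.inv ≫ l = m ≫ i.inv := by
  rw [Iso.inv_comp_eq, ← Category.assoc, Iso.eq_comp_inv, h]

namespace Word

variable {α β : Type} {C D : SymMonCat.{u, v}} (F : LaxBraidedFunctor C D)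

theorem evalMap_lax (w : Word α) {X Z : α → C} (f : ∀ a, X a ⟶ Z a) :
    w.evalMap (fun a => F.map (f a)) ≫ lax F w Z = lax F w X ≫ F.map (w.evalMap f) := by
  induction w with
  | unit =>
    exact (Category.id_comp _).trans ((Category.comp_id _).symm.trans
      (congrArg (_ ≫ ·) (F.toFunctor.map_id _).symm))
  | leaf a => exact (Category.comp_id _).trans (Category.id_comp _).symm
  | tensor s t hs ht => exact tensor_mul F.toFunctor hs ht

/-- Each generator of paths is handled by one axiom of a lax symmetric monoidal functor, and inverse
generators by cancelling isomorphisms. -/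
theorem Path.eval_lax {w w' : Word α} (p : Path w w') (X : α → C) :
    p.eval (fun a => F.obj (X a)) ≫ lax F w' X = lax F w X ≫ F.map (p.eval X) := by
  induction p with
  | id =>
    exact (Category.id_comp _).trans ((Category.comp_id _).symm.trans
      (congrArg (_ ≫ ·) (F.toFunctor.map_id _).symm))
  | comp p q hp hq =>
    simp only [Path.eval, Category.assoc, hq, reassoc_of% hp, Functor.map_comp]
  | tensor p q hp hq => exact tensor_mul F.toFunctor hp hq
  | assoc r s t => exact assoc_mul F.toFunctor _ _ _
  | assocInv r s t =>
    exact comp_iso_inv_of_comp_hom (i' := α_ _ _ _) (i := F.toFunctor.mapIso (α_ _ _ _))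
      (assoc_mul F.toFunctor _ _ _)
  | left s => exact left_mul F.toFunctor _
  | leftInv s =>
    exact comp_iso_inv_of_comp_hom (i' := λ_ _) (i := F.toFunctor.mapIso (λ_ _))
      (left_mul F.toFunctor _)
  | right s => exact right_mul F.toFunctor _
  | rightInv s =>
    exact comp_iso_inv_of_comp_hom (i' := ρ_ _) (i := F.toFunctor.mapIso (ρ_ _))
      (right_mul F.toFunctor _)
  | braid s t => exact braid_mul F.toFunctor _ _

/-- The comparison map of a substituted word is composed of those of the inner words and that of the
outer one, since both are built along the same tree. -/
theorem bindIso_lax (w : Word α) (g : α → Word β) (Z : β → C) :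
    (w.bindIso g fun b => F.obj (Z b)).hom ≫ w.evalMap (fun a => lax F (g a) Z) ≫
        lax F w (fun a => (g a).eval Z) =
      lax F (w.bind g) Z ≫ F.map (w.bindIso g Z).hom := by
  induction w with
  | unit =>
    change 𝟙 (𝟙_ D) ≫ 𝟙 (𝟙_ D) ≫ Functor.LaxMonoidal.ε F.toFunctor =
      Functor.LaxMonoidal.ε F.toFunctor ≫ F.map (𝟙 (𝟙_ C))
    simp
  | leaf a =>
    change 𝟙 _ ≫ lax F (g a) Z ≫ 𝟙 (F.obj ((g a).eval Z)) = lax F (g a) Z ≫ F.map (𝟙 _)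
    rw [F.toFunctor.map_id]
    exact Category.id_comp _
  | tensor s t hs ht =>
    exact tensor_mul_of_comp F.toFunctor hs ht

theorem mapIso_lax (w : Word α) (e : α → β) (Z : β → C) :
    (w.mapIso e fun b => F.obj (Z b)).hom ≫ lax F w (fun a => Z (e a)) =
      lax F (w.map e) Z ≫ F.map (w.mapIso e Z).hom := by
  refine Eq.trans ?_ (bindIso_lax F w (fun a => leaf (e a)) Z)
  refine congrArg (_ ≫ ·) ((Category.id_comp _).symm.trans (congrArg (· ≫ _) ?_))
  exact (w.evalMap_id fun a => F.obj (Z (e a))).symm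

theorem Path.eval_map_lax {w : Word α} {w' : Word β} {e : α → β} (p : Path (w.map e) w')
    {X : α → C} {Z : β → C} (f : ∀ a, X a ⟶ Z (e a)) :
    (w.evalMap (fun a => F.map (f a)) ≫ (w.mapIso e fun b => F.obj (Z b)).inv ≫
        p.eval fun b => F.obj (Z b)) ≫ lax F w' Z =
      lax F w X ≫ F.map (w.evalMap f ≫ (w.mapIso e Z).inv ≫ p.eval Z) := by
  have h := comp_iso_inv_of_comp_hom (i' := w.mapIso e fun b => F.obj (Z b))
      (i := F.toFunctor.mapIso (w.mapIso e Z)) (mapIso_lax F w e Z)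
  simp only [Category.assoc, F.toFunctor.map_comp]
  rw [Path.eval_lax, reassoc_of% h, reassoc_of% @evalMap_lax]
  rfl

theorem evalMap_bindIso_lax {γ : β → Type} (w : Word β) (g : ∀ b, Word (γ b))
    {Z : (Σ b, γ b) → C} {Y : β → C} (φ : ∀ b, (g b).eval (fun c => Z ⟨b, c⟩) ⟶ Y b) :
    (w.bindIso (fun b => (g b).map (Sigma.mk b)) fun p => F.obj (Z p)).hom ≫
        w.evalMap (fun b => ((g b).mapIso (Sigma.mk b) fun p => F.obj (Z p)).hom ≫
          lax F (g b) (fun c => Z ⟨b, c⟩) ≫ F.map (φ b)) ≫ lax F w Y =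
      lax F (w.bind fun b => (g b).map (Sigma.mk b)) Z ≫
        F.map ((w.bindIso (fun b => (g b).map (Sigma.mk b)) Z).hom ≫
          w.evalMap fun b => ((g b).mapIso (Sigma.mk b) Z).hom ≫ φ b) := by
  rw [F.toFunctor.map_comp, ← reassoc_of% @bindIso_lax, ← evalMap_lax, reassoc_of% @evalMap_comp]
  refine congrArg (_ ≫ ·) (congrArg (· ≫ _) (congrArg w.evalMap (funext fun b => ?_)))
  rw [F.toFunctor.map_comp, reassoc_of% @mapIso_lax]

theorem lax_id (w : Word α) (X : α → C) : lax (𝟙 C : C ⟶ C) w X = 𝟙 (w.eval X) := by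
  induction w with
  | unit => rfl
  | leaf a => rfl
  | tensor s t hs ht =>
    refine (Category.comp_id _).trans ?_
    rw [hs, ht]
    exact id_tensorHom_id _ _

/-- The structure maps of a composite functor are composites, and naturality of `μ` of `G` collects
the parts coming from `F`. This is the pasting formula for `ξ`. -/
theorem lax_comp {E : SymMonCat.{u, v}} (F : C ⟶ D) (G : D ⟶ E) (w : Word α) (X : α → C) :
    lax (F ≫ G : C ⟶ E) w X =
      lax G w (fun a => LaxBraidedFunctor.toFunctor F |>.obj (X a)) ≫
        (LaxBraidedFunctor.toFunctor G).map (lax F w X) := by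
  induction w with
  | unit => rfl
  | leaf a =>
    change 𝟙 _ = 𝟙 _ ≫ (LaxBraidedFunctor.toFunctor G).map
      (𝟙 ((LaxBraidedFunctor.toFunctor F).obj (X a)))
    simp only [CategoryTheory.Functor.map_id]
    exact (Category.id_comp _).symm
  | tensor s t hs ht =>
    refine (congrArg (· ≫ _) (congrArg₂ (· ⊗ₘ ·) hs ht)).trans ?_
    exact comp_mul (LaxBraidedFunctor.toFunctor G) _ _ _

theorem isIso_lax (hF : IsStrong F) (w : Word α) (X : α → C) : IsIso (lax F w X) := by
  induction w with
  | unit => exact hF.1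
  | leaf a => exact inferInstanceAs (IsIso (𝟙 (F.obj (X a))))
  | tensor s t hs ht =>
    have := hF.2 (s.eval X) (t.eval X)
    exact isIso_tensorHom_comp (lax F s X) (lax F t X)
      (Functor.LaxMonoidal.μ F.toFunctor (s.eval X) (t.eval X))

theorem lax_eq_eqToHom (hF : IsStrict F) (w : Word α) (X : α → C) :
    ∃ h, lax F w X = eqToHom h := by
  induction w with
  | unit => exact hF.1
  | leaf a => exact ⟨rfl, rfl⟩
  | tensor s t hs ht =>
    obtain ⟨h₁, hs⟩ := hs
    obtain ⟨h₂, ht⟩ := ht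
    obtain ⟨h₃, h⟩ := hF.2 (s.eval X) (t.eval X)
    refine ⟨(congrArg₂ (fun A B : D => (A ⊗ B : D)) h₁ h₂).trans h₃, ?_⟩
    rw [lax, hs, ht, h]
    exact eqToHom_tensor_eqToHom_comp h₁ h₂ h₃

end Word

namespace LinWord

variable {α β : Type} {C D : SymMonCat.{u, v}} (F : LaxBraidedFunctor C D)

theorem shuffle_lax (w : LinWord α) (w' : LinWord β) (e : α ≃ β) {X : α → C} {Z : β → C}
    (f : ∀ a, X a ⟶ Z (e a)) :
    w.shuffle w' e (fun a => F.map (f a)) ≫ w'.word.lax F Z =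
      w.word.lax F X ≫ F.map (w.shuffle w' e f) := by
  exact Word.Path.eval_map_lax F _ f

theorem canon_lax (w : LinWord α) (w' : LinWord β) (e : α ≃ β) {X : α → C} {Z : β → C}
    (h : ∀ a, X a = Z (e a)) (h' : ∀ a, F.obj (X a) = F.obj (Z (e a))) :
    w.canon w' e h' ≫ w'.word.lax F Z = w.word.lax F X ≫ F.map (w.canon w' e h) := by
  obtain rfl : X = fun a => Z (e a) := funext h
  have := shuffle_lax F w w' e fun a => 𝟙 (Z (e a))
  simp only [F.toFunctor.map_id] at this
  exact this

/-- Lets a lax functor pass through operadic composition: the form of `bindIso_lax` that includes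
the multimorphisms. -/
theorem subMap_lax {γ : β → Type} (w : LinWord β) (g : ∀ b, LinWord (γ b)) {Z : (Σ b, γ b) → C}
    {Y : β → C} (φ : ∀ b, (g b).eval (fun c => Z ⟨b, c⟩) ⟶ Y b) :
    w.subMap g (fun b => (g b).word.lax F (fun c => Z ⟨b, c⟩) ≫ F.map (φ b)) ≫ w.word.lax F Y =
      (w.sub g).word.lax F Z ≫ F.map (w.subMap g φ) := by
  exact (Category.assoc _ _ _).trans (Word.evalMap_bindIso_lax F w.word (fun b => (g b).word) φ)

end LinWord

/-! ### The underlying multicategory -/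

namespace LinWord

variable {α β : Type} {C : Type u} [Category.{v} C] [MonoidalCategory C] [SymmetricCategory C]

theorem subMap_congr {γ : β → Type} (w : LinWord β) (g : ∀ b, LinWord (γ b)) {Z : (Σ b, γ b) → C}
    {Y : β → C} {φ φ' : ∀ b, (g b).eval (fun c => Z ⟨b, c⟩) ⟶ Y b} (h : ∀ b, φ b = φ' b) :
    w.subMap g φ = w.subMap g φ' := by
  rw [funext h]

/-- By coherence only the bijections have to be compared. The final step of most of the proofs about
operadic composition. -/
theorem canon_square {β' γ : Type} (w : LinWord α) (w₁ : LinWord β) (w₂ : LinWord β')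
    (w' : LinWord γ) {e₁ : α ≃ β} {e₁' : β ≃ γ} {e₂ : α ≃ β'} {e₂' : β' ≃ γ} {X : α → C}
    {Y₁ : β → C} {Y₂ : β' → C} {Z : γ → C} (h₁ : ∀ a, X a = Y₁ (e₁ a))
    (h₁' : ∀ b, Y₁ b = Z (e₁' b)) (h₂ : ∀ a, X a = Y₂ (e₂ a)) (h₂' : ∀ b, Y₂ b = Z (e₂' b))
    (he : ∀ a, e₁' (e₁ a) = e₂' (e₂ a)) :
    w.canon w₁ e₁ h₁ ≫ w₁.canon w' e₁' h₁' = w.canon w₂ e₂ h₂ ≫ w₂.canon w' e₂' h₂' :=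
  (canon_comp _ _ _ _ _ _ _).trans
    ((canon_congr _ _ _ (Equiv.ext he)).trans (canon_comp _ _ _ _ _ _ _).symm)

theorem canon_comp_eq (w : LinWord α) (w₁ : LinWord β) {γ : Type} (w' : LinWord γ) {e : α ≃ β}
    {e' : β ≃ γ} {e'' : α ≃ γ} {X : α → C} {Y : β → C} {Z : γ → C} (h : ∀ a, X a = Y (e a))
    (h' : ∀ b, Y b = Z (e' b)) (h'' : ∀ a, X a = Z (e'' a)) (he : ∀ a, e' (e a) = e'' a) :
    w.canon w₁ e h ≫ w₁.canon w' e' h' = w.canon w' e'' h'' :=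
  (canon_comp _ _ _ _ _ _ _).trans (canon_congr _ _ _ (Equiv.ext he))

/-- This and the following lemmas rewrite an initial segment of a composite. They are applied as
terms, so that objects need to match only up to unfolding. -/
theorem comp_eq_comp_assoc {W X X' Y Z : C} {f : W ⟶ X} {g : X ⟶ Y} {f' : W ⟶ X'} {g' : X' ⟶ Y}
    (h : f ≫ g = f' ≫ g') (k : Y ⟶ Z) : f ≫ g ≫ k = f' ≫ g' ≫ k := by
  rw [← Category.assoc, h, Category.assoc]

theorem comp_eq_comp₂' {V W Y Z : C} {f : V ⟶ W} {g : W ⟶ Y} {f' : V ⟶ Y}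
    (H : f ≫ g = f') (k : Y ⟶ Z) : f ≫ g ≫ k = f' ≫ k := by
  rw [← Category.assoc, H]

theorem comp_eq_comp₃' {U V W W' X X' Y Z : C} {f : U ⟶ V} {g : V ⟶ W} {h : W ⟶ Y}
    {f' : U ⟶ W'} {g' : W' ⟶ X} {h' : X ⟶ X'} {l : X' ⟶ Y} (H : f ≫ g ≫ h = f' ≫ g' ≫ h' ≫ l)
    (k : Y ⟶ Z) {m : W ⟶ Z} (hm : h ≫ k = m) :
    f ≫ g ≫ m = f' ≫ g' ≫ h' ≫ l ≫ k := by
  subst hm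
  simpa only [Category.assoc] using congrArg (· ≫ k) H

theorem comp_eq_comp₂ {V W W' X' Y Z : C} {f : V ⟶ W} {g : W ⟶ Y} {f' : V ⟶ W'}
    {g' : W' ⟶ X'} {h' : X' ⟶ Y} (H : f ≫ g = f' ≫ g' ≫ h') (k : Y ⟶ Z) :
    f ≫ g ≫ k = f' ≫ g' ≫ h' ≫ k := by
  simpa only [Category.assoc] using congrArg (· ≫ k) H

theorem comp_eq_comp₃ {V W X W' X' Y Z : C} {f : V ⟶ W} {g : W ⟶ X} {h : X ⟶ Y} {f' : V ⟶ W'}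
    {g' : W' ⟶ X'} {h' : X' ⟶ Y} (H : f ≫ g ≫ h = f' ≫ g' ≫ h') (k : Y ⟶ Z) :
    f ≫ g ≫ h ≫ k = f' ≫ g' ≫ h' ≫ k := by
  simpa only [Category.assoc] using congrArg (· ≫ k) H

theorem comp_eq_comp₄ {U V W X W' X' Y Z : C} {l : U ⟶ V} {f : V ⟶ W} {g : W ⟶ X} {h : X ⟶ Y}
    {f' : U ⟶ W'} {g' : W' ⟶ X'} {h' : X' ⟶ Y} (H : l ≫ f ≫ g ≫ h = f' ≫ g' ≫ h') (k : Y ⟶ Z) :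
    l ≫ f ≫ g ≫ h ≫ k = f' ≫ g' ≫ h' ≫ k := by
  simpa only [Category.assoc] using congrArg (· ≫ k) H

theorem subMap_canon_left {β' : Type} {γ : β' → Type} (w : LinWord β)
    (w' : LinWord β') (g : ∀ b, LinWord (γ b)) (e : β ≃ β') {Z : (Σ b, γ b) → C} {Y : β' → C}
    (φ : ∀ b, (g b).eval (fun c => Z ⟨b, c⟩) ⟶ Y b) :
    w.subMap (fun b => g (e b)) (Z := fun p => Z ⟨e p.1, p.2⟩) (Y := fun b => Y (e b))
        (fun b => φ (e b)) ≫ w.canon w' e (fun _ => rfl) =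
      (w.sub fun b => g (e b)).canon (w'.sub g) (Equiv.sigmaCongrLeft (β := γ) e) (fun _ => rfl) ≫
        w'.subMap g φ := by
  refine Eq.trans ?_ (canon_subMap_left w w' g e (X := fun p => Z ⟨e p.1, p.2⟩) (Z := Z)
    (fun _ => rfl) φ).symm
  refine congrArg (· ≫ _) (subMap_congr _ _ fun b => ?_)
  exact ((congrArg (· ≫ φ (e b)) (canon_refl _ _)).trans (Category.id_comp _)).symm

/-- Identities of the multicategory are canonical maps to the word `one`, so plugging them into all
inputs gives a canonical map again. -/
theorem subMap_canon_one {Y : β → C} (w : LinWord β) (g : β → LinWord (Fin 1)) :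
    w.subMap g (Z := fun p => Y p.1) (fun b => (g b).canon one (Equiv.refl _)
        (X := fun _ => Y b) (Z := fun _ => Y b) fun _ => rfl) =
      (w.sub g).canon w (Equiv.sigmaUnique β fun _ => Fin 1) fun _ => rfl := by
  have h := canon_subMap_right w g (fun _ => one) (fun _ => Equiv.refl _) (X := fun p => Y p.1)
    (Z := fun p => Y p.1) (fun _ => rfl) (fun b => 𝟙 (Y b))
  refine Eq.trans ?_ (h.symm.trans ((congrArg (_ ≫ ·) (subMap_one w)).trans
    (canon_comp_eq _ _ _ _ _ _ fun _ => rfl)))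
  exact subMap_congr _ _ fun b => (Category.comp_id _).symm

theorem subMap_comp_canon_one {X : α → C} {Y : C} (w : LinWord (Fin 1)) (g : LinWord α)
    (φ : g.eval X ⟶ Y) :
    w.subMap (fun _ => g) (Z := fun p => X p.2) (Y := fun _ => Y) (fun _ => φ) ≫
        w.canon one (Equiv.refl _) (Z := fun _ => Y) (fun _ => rfl) =
      (w.sub fun _ => g).canon g
        ((Equiv.sigmaEquivProd (Fin 1) α).trans (Equiv.uniqueProd α (Fin 1))) (fun _ => rfl) ≫
          φ := by
  refine (subMap_canon_left w one (fun _ => g) (Equiv.refl (Fin 1)) (Z := fun p => X p.2)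
    (Y := fun _ => Y) fun _ => φ).trans ?_
  refine (congrArg (_ ≫ ·) (one_subMap (Z := fun p => X p.2) (Y := fun _ => Y) g (fun _ => φ)
    fun _ => rfl)).trans ?_
  exact (Category.assoc _ _ _).symm.trans
    (congrArg (· ≫ φ) (canon_comp_eq _ _ _ _ _ _ fun _ => rfl))

/-- Operadic composition is associative. -/
theorem operad_assoc {n : ℕ} {j : Fin n → ℕ} {i : ∀ s, Fin (j s) → ℕ}
    {x : ∀ s t, Fin (i s t) → C} {y : ∀ s, Fin (j s) → C} {z : Fin n → C} (w : LinWord (Fin n))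
    (wj : ∀ s, LinWord (Fin (j s))) (wi : ∀ s t, LinWord (Fin (i s t)))
    (vj : LinWord (Fin (∑ s, j s)))
    (v : LinWord (Fin (∑ k, i (finSigmaFinEquiv.symm k).1 (finSigmaFinEquiv.symm k).2)))
    (v' : LinWord (Fin (∑ s, ∑ t, i s t))) (vi : ∀ s, LinWord (Fin (∑ t, i s t)))
    (φ : ∀ s, (wj s).eval (y s) ⟶ z s) (χ : ∀ s t, (wi s t).eval (x s t) ⟶ y s t) (h₁ h₂) :
    v.canon (X := concat fun k => x (finSigmaFinEquiv.symm k).1 (finSigmaFinEquiv.symm k).2)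
        (vj.sub fun k => wi (finSigmaFinEquiv.symm k).1 (finSigmaFinEquiv.symm k).2)
        finSigmaFinEquiv.symm (Z := fun p => x (finSigmaFinEquiv.symm p.1).1
          (finSigmaFinEquiv.symm p.1).2 p.2) h₁ ≫
      vj.subMap (fun k => wi (finSigmaFinEquiv.symm k).1 (finSigmaFinEquiv.symm k).2)
        (Y := concat y) (fun k => χ (finSigmaFinEquiv.symm k).1 (finSigmaFinEquiv.symm k).2) ≫
      vj.canon (w.sub wj) finSigmaFinEquiv.symm (Z := fun p => y p.1 p.2) (fun _ => rfl) ≫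
      w.subMap wj φ =
    v.canon v' (blockEquiv ((Equiv.sigmaCongrLeft (β := fun p : Σ s, Fin (j s) => Fin (i p.1 p.2))
        finSigmaFinEquiv.symm).trans ((Equiv.sigmaAssoc fun s t => Fin (i s t)).trans
          (Equiv.sigmaCongrRight fun _ => finSigmaFinEquiv))))
        (Z := concat fun s => concat (x s)) h₂ ≫
      v'.canon (w.sub vi) finSigmaFinEquiv.symm (Z := fun p => concat (x p.1) p.2)
        (fun _ => rfl) ≫
      w.subMap vi fun s =>
        (vi s).canon ((wj s).sub (wi s)) finSigmaFinEquiv.symm (Z := fun p => x s p.1 p.2)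
          (fun _ => rfl) ≫ (wj s).subMap (wi s) (χ s) ≫ φ s := by
  -- Moves the canonical map in front of the innermost multimorphisms, so that the middle word
  -- becomes `w.sub wj`, indexed by pairs.
  have e₁ := subMap_canon_left vj (w.sub wj) (fun p => wi p.1 p.2) finSigmaFinEquiv.symm
    (Z := fun q => x q.1.1 q.1.2 q.2) (Y := fun p => y p.1 p.2) fun p => χ p.1 p.2
  refine (congrArg (_ ≫ ·) (comp_eq_comp_assoc e₁ _)).trans ?_
  have e₂ := subMap_subMap (δ := fun s t => Fin (i s t)) w wj (fun p => wi p.1 p.2) (Z := fun q => x q.1 q.2.1 q.2.2)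
    (X := fun p => y p.1 p.2) (fun p => χ p.1 p.2) φ
  refine (congrArg (_ ≫ ·) (congrArg (_ ≫ ·) e₂)).trans ?_
  -- Read backwards: takes the chosen inner products out of the inner composites, leaving only
  -- canonical maps in front.
  have e₃ := canon_subMap_right w vi (fun s => (wj s).sub (wi s)) (fun _ => finSigmaFinEquiv.symm)
    (X := fun p => concat (x p.1) p.2) (Z := fun q => x q.1 q.2.1 q.2.2) (fun _ => rfl)
    fun s => (wj s).subMap (wi s) (χ s) ≫ φ s
  refine Eq.trans ?_ (congrArg (_ ≫ ·) (congrArg (_ ≫ ·) e₃))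
  refine comp_eq_comp₃ ?_ _
  refine (congrArg (_ ≫ ·) (canon_comp _ _ _ _ _ _ _)).trans
    (Eq.trans ?_ (congrArg (_ ≫ ·) (canon_comp _ _ _ _ _ _ _).symm))
  exact canon_square _ _ _ _ _ _ _ _ fun p => by simp [blockEquiv]

end LinWord

open LinWord

/-- Each law becomes an equation of canonical maps followed by the same multimorphisms on both
sides; the two equivariances are naturality of substitution in the outer and in the inner words. -/
theorem underlyingData_laws (κ : Choices.{u, v}) (C : SymMonCat.{u, v}) :
    (underlyingData κ C).Laws where
  perm_refl φ := (congrArg (· ≫ φ) (canon_refl _ _)).trans (Category.id_comp φ)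
  perm_perm σ τ h h' φ :=
    (Category.assoc _ _ _).symm.trans (congrArg (· ≫ φ) (canon_comp _ _ _ _ _ _ _))
  comp_id {n y z} ψ := by
    refine (congrArg (fun q => _ ≫ q ≫ ψ) (subMap_canon_one _ _)).trans ?_
    exact (Category.assoc _ _ _).symm.trans (congrArg (· ≫ ψ) (canon_comp _ _ _ _ _ _ _))
  id_comp {n x z} φ := by
    refine (congrArg (_ ≫ ·) (subMap_comp_canon_one _ _ φ)).trans ?_
    exact (Category.assoc _ _ _).symm.trans (congrArg (· ≫ φ) (canon_comp _ _ _ _ _ _ _))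
  assoc {n j i x y z w} ψ φ χ := by
    refine comp_eq_comp₄ (C := C) ?_ ψ
    exact operad_assoc (C := C) (κ C n z) (fun s => κ C (j s) (y s)) (fun s t => κ C (i s t) (x s t))
      _ _ _ _ φ χ _ _
  outer_equivariant {m n j x y z} σ ψ φ := by
    have h := subMap_canon_left (C := C) (κ C n fun i => y (σ i)) (κ C m y)
      (fun s => κ C (j s) (x s)) σ (Z := fun p => x p.1 p.2) φ
    refine (congrArg (_ ≫ ·) (comp_eq_comp_assoc h ψ)).trans (comp_eq_comp_assoc (C := C) ?_ _)
    exact canon_square _ _ _ _ _ _ _ _ fun p => by simp [blockEquiv]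
  inner_equivariant {n j j' x y z} ψ τ φ := by
    have h := canon_subMap_right (C := C) (κ C n y) (fun s => κ C (j' s) fun i => x s (τ s i))
      (fun s => κ C (j s) (x s)) τ (X := fun p => x p.1 (τ p.1 p.2)) (Z := fun p => x p.1 p.2)
      (fun _ => rfl) φ
    refine (congrArg (fun q => _ ≫ q ≫ ψ) h.symm).trans ?_
    refine (congrArg (_ ≫ ·) (Category.assoc _ _ _)).trans (comp_eq_comp_assoc (C := C) ?_ _)
    exact canon_square _ _ _ _ _ _ _ _ fun p => by simp [blockEquiv]

/-- Lax symmetric monoidal functors are compatible with operadic composition. -/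
theorem operad_lax {C D : SymMonCat.{u, v}} (F : LaxBraidedFunctor C D) {n : ℕ} {j : Fin n → ℕ}
    {x : ∀ s, Fin (j s) → C} {y : Fin n → C} (w : LinWord (Fin n)) (wD : LinWord (Fin n))
    (g gD : ∀ s, LinWord (Fin (j s))) (v vD : LinWord (Fin (∑ s, j s)))
    (φ : ∀ s, (g s).eval (x s) ⟶ y s) :
    vD.canon (X := fun i => F.obj (concat x i)) (Z := fun i => F.obj (concat x i)) v (Equiv.refl _)
        (fun _ => rfl) ≫ v.word.lax F (concat x) ≫
      F.map (v.canon (w.sub g) finSigmaFinEquiv.symm (Z := fun p => x p.1 p.2) (fun _ => rfl) ≫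
        w.subMap g φ) =
    vD.canon (X := concat fun s i => F.obj (x s i)) (wD.sub gD) finSigmaFinEquiv.symm
        (Z := fun p => F.obj (x p.1 p.2)) (fun _ => rfl) ≫
      wD.subMap gD (Y := fun s => F.obj (y s)) (fun s => (gD s).canon (g s) (Equiv.refl _)
        (X := fun i => F.obj (x s i)) (Z := fun i => F.obj (x s i)) (fun _ => rfl) ≫
          (g s).word.lax F (x s) ≫ F.map (φ s)) ≫
      wD.canon w (Equiv.refl _) (Z := fun s => F.obj (y s)) (fun _ => rfl) ≫ w.word.lax F y := by
  -- `e₁` and `e₂` replace the products chosen in `D` by those chosen in `C`, outside and inside;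
  -- `e₃` and `e₄` move the comparison map of `F` through the substitution and the canonical map.
  have e₁ := subMap_canon_left wD w gD (Equiv.refl _) (Z := fun p => F.obj (x p.1 p.2))
    (Y := fun s => F.obj (y s)) (fun s => (gD s).canon (g s) (Equiv.refl _)
      (X := fun i => F.obj (x s i)) (Z := fun i => F.obj (x s i)) (fun _ => rfl) ≫
        (g s).word.lax F (x s) ≫ F.map (φ s))
  have e₂ := canon_subMap_right w gD g (fun _ => Equiv.refl _) (X := fun p => F.obj (x p.1 p.2))
    (Z := fun p => F.obj (x p.1 p.2)) (fun _ => rfl)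
    (fun s => (g s).word.lax F (x s) ≫ F.map (φ s))
  have e₃ := subMap_lax F w g (Z := fun p => x p.1 p.2) φ
  have e₄ := canon_lax F v (w.sub g) finSigmaFinEquiv.symm (X := concat x)
    (Z := fun p => x p.1 p.2) (fun _ => rfl) fun _ => rfl
  refine Eq.trans ?_ (congrArg (_ ≫ ·) (comp_eq_comp_assoc e₁ _)).symm
  refine Eq.trans ?_ (congrArg (fun q => _ ≫ _ ≫ q) (congrArg (· ≫ _) e₂))
  refine Eq.trans ?_ (congrArg (fun q => _ ≫ _ ≫ q) (Category.assoc _ _ _).symm)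
  refine Eq.trans ?_ (congrArg (fun q => _ ≫ _ ≫ _ ≫ q) e₃.symm)
  refine (congrArg (fun q => _ ≫ _ ≫ q) (F.map_comp _ _)).trans ?_
  refine (congrArg (_ ≫ ·) (comp_eq_comp_assoc e₄.symm _)).trans ?_
  refine comp_eq_comp₂ ?_ _
  refine Eq.trans ?_ (congrArg (_ ≫ ·) (canon_comp _ _ _ _ _ _ _).symm)
  exact canon_square _ _ _ _ _ _ _ _ fun _ => rfl

theorem underlyingMapData_laws (κ : Choices.{u, v}) {C D : SymMonCat.{u, v}}
    (F : LaxBraidedFunctor C D) : (underlyingMapData κ F).Laws where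
  map_id a := by
    refine (congrArg (_ ≫ ·) (canon_lax F (κ C 1 fun _ => a) one (Equiv.refl _) (X := fun _ => a)
      (Z := fun _ => a) (fun _ => rfl) fun _ => rfl).symm).trans ?_
    refine (congrArg (_ ≫ ·) (Category.comp_id _)).trans ?_
    exact canon_comp_eq _ _ _ _ _ _ fun _ => rfl
  map_perm {m n x x' y} σ h φ := by
    refine (congrArg (fun q => _ ≫ _ ≫ q) (F.map_comp _ _)).trans ?_
    refine (congrArg (_ ≫ ·) (comp_eq_comp_assoc (canon_lax F (κ C n x') (κ C m x) σ h
      fun i => congrArg F.obj (h i)).symm _)).trans ?_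
    exact comp_eq_comp_assoc (C := D) (canon_square (e₁ := Equiv.refl _) (e₁' := σ) (e₂ := σ)
      (e₂' := Equiv.refl _) (κ D n fun i => F.obj (x' i)) (κ C n x')
      (κ D m fun i => F.obj (x i)) (κ C m x) (fun _ => rfl) (fun i => congrArg F.obj (h i))
      (fun i => congrArg F.obj (h i)) (fun _ => rfl) fun _ => rfl) _
  map_comp {n j x y z} ψ φ := by
    have h := operad_lax F (κ C n y) (κ D n fun s => F.obj (y s)) (fun s => κ C (j s) (x s))
      (fun s => κ D (j s) fun i => F.obj (x s i)) (κ C (∑ s, j s) (concat x))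
      (κ D (∑ s, j s) fun i => F.obj (concat x i)) φ
    exact (comp_eq_comp₃' (C := D) h (F.map ψ) ((F.map_comp _ _).symm.trans
      (congrArg F.map (Category.assoc _ _ _))))

theorem MultifunctorData.mk_congr {M N : MultiData.{u, v}} {o : M.Obj → N.Obj}
    {m m' : ∀ {n : ℕ} {x : Fin n → M.Obj} {y : M.Obj}, M.Hom x y → N.Hom (fun i => o (x i)) (o y)}
    (h : ∀ {n : ℕ} {x : Fin n → M.Obj} {y : M.Obj} (φ : M.Hom x y), m φ = m' φ) :
    (⟨o, m⟩ : MultifunctorData M N) = ⟨o, m'⟩ := by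
  congr
  funext n x y φ
  exact h φ

theorem underlyingLaws (κ : Choices.{u, v}) : UnderlyingLaws κ where
  obj := underlyingData_laws κ
  map := underlyingMapData_laws κ
  map_id C := by
    refine MultifunctorData.mk_congr fun {n x y} φ => ?_
    refine (congrArg (· ≫ _) (canon_refl _ _)).trans ((Category.id_comp _).trans ?_)
    exact (congrArg (· ≫ φ) (Word.lax_id _ _)).trans (Category.id_comp _)
  map_comp {C D E} F G := by
    let F' : LaxBraidedFunctor C D := F
    let G' : LaxBraidedFunctor D E := G
    refine MultifunctorData.mk_congr fun {n x y} φ => ?_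
    refine (congrArg (fun q => _ ≫ q ≫ G'.map (F'.map φ)) (Word.lax_comp F G _ x)).trans ?_
    -- The product chosen in `D` for the intermediate tuple drops out, since the comparison map of
    -- `G` commutes with the canonical map away from it.
    have e := canon_lax G' (κ D n fun i => F'.obj (x i)) (κ C n x) (Equiv.refl _)
      (X := fun i => F'.obj (x i)) (Z := fun i => F'.obj (x i)) (fun _ => rfl) fun _ => rfl
    refine Eq.symm ((congrArg (fun q => _ ≫ _ ≫ q) (G'.map_comp _ _)).trans ?_)
    refine (congrArg (_ ≫ ·) (comp_eq_comp_assoc e.symm _)).trans ?_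
    refine (comp_eq_comp₂' (C := E) (canon_comp_eq _ _ _ (e := Equiv.refl _)
      (e' := Equiv.refl _) (e'' := Equiv.refl _) _ _ (fun _ => rfl) fun _ => rfl) _).trans ?_
    refine congrArg (_ ≫ ·) (Eq.trans ?_ (Category.assoc _ _ _).symm)
    exact congrArg (_ ≫ ·) (G'.map_comp _ _)

/-! ### Calculus of morphisms of tuples -/

theorem MultiData.perm_congr (M : MultiData.{u, v}) {m n : ℕ} {x : Fin m → M.Obj}
    {x' : Fin n → M.Obj} {y : M.Obj} {σ τ : Fin n ≃ Fin m} (hστ : ∀ i, σ i = τ i)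
    (h : ∀ i, x' i = x (σ i)) (h' : ∀ i, x' i = x (τ i)) (φ : M.Hom x y) :
    M.perm σ h φ = M.perm τ h' φ := by
  obtain rfl : σ = τ := Equiv.ext hστ
  rfl

theorem MultiData.Laws.perm_eq_self {M : MultiData.{u, v}} (hM : M.Laws) {n : ℕ} {x : Fin n → M.Obj}
    {y : M.Obj} (σ : Fin n ≃ Fin n) (hσ : ∀ i, σ i = i) (h : ∀ i, x i = x (σ i)) (φ : M.Hom x y) :
    M.perm σ h φ = φ := by
  obtain rfl : σ = Equiv.refl _ := Equiv.ext hσ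
  exact hM.perm_refl φ

theorem MultiData.Laws.perm_injective {M : MultiData.{u, v}} (hM : M.Laws) {m n : ℕ}
    {x : Fin m → M.Obj} {x' : Fin n → M.Obj} {y : M.Obj} (σ : Fin n ≃ Fin m)
    (h : ∀ i, x' i = x (σ i)) {φ ψ : M.Hom x y} (H : M.perm σ h φ = M.perm σ h ψ) : φ = ψ := by
  have h' : ∀ i, x i = x' (σ.symm i) := fun i => by rw [h, Equiv.apply_symm_apply]
  have H' := congrArg (M.perm σ.symm h') H
  rwa [hM.perm_perm, hM.perm_perm, hM.perm_eq_self _ (by simp), hM.perm_eq_self _ (by simp)] at H'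

theorem fibComp_symm_spec {j n p : ℕ} (f : Fin j → Fin n) (g : Fin n → Fin p) (t : Fin p)
    (q : Σ k : Fin (Finset.univ.filter fun s => g s = t).card,
      Fin (Finset.univ.filter fun r => f r = (fibEnum g t k).1).card) :
    (fibEnum (fun r => g (f r)) t ((fibComp f g t).symm q)).1 = (fibEnum f _ q.2).1 := by
  obtain ⟨k, rfl⟩ := (fibComp f g t).surjective q
  rw [Equiv.symm_apply_apply]
  exact (fibComp_spec f g t k).symm

namespace FreeHom

variable {M : MultiData.{u, v}} {x y z : FreeObj M}

/-- The map `e` enumerates the fibre of the morphism `φ` over `s`, and with this enumeration `v` is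
the multimorphism that belongs to `φ` and `s`. -/
def IsAt (φ : FreeHom M x y) (s : Fin y.1) {n : ℕ} {x' : Fin n → M.Obj} {y' : M.Obj}
    (e : Fin n → Fin x.1) (v : M.Hom x' y') : Prop :=
  ∃ (σ : Fin n ≃ Fin (Finset.univ.filter fun r => φ.fn r = s).card)
    (_ : ∀ k, (fibEnum φ.fn s (σ k)).1 = e k) (hx : ∀ k, x' k = fibTuple x.2 φ.fn s (σ k))
    (hy : y.2 s = y'), v = castTarget M hy (M.perm σ hx (φ.mor s))

theorem IsAt.fn_eq {φ : FreeHom M x y} {s : Fin y.1} {n : ℕ} {x' : Fin n → M.Obj} {y' : M.Obj}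
    {e : Fin n → Fin x.1} {v : M.Hom x' y'} (h : IsAt φ s e v) (k : Fin n) : φ.fn (e k) = s := by
  obtain ⟨σ, he, -⟩ := h
  rw [← he]
  exact (fibEnum φ.fn s (σ k)).2

theorem IsAt.exists_eq {φ : FreeHom M x y} {s : Fin y.1} {n : ℕ} {x' : Fin n → M.Obj} {y' : M.Obj}
    {e : Fin n → Fin x.1} {v : M.Hom x' y'} (h : IsAt φ s e v) {r : Fin x.1} (hr : φ.fn r = s) :
    ∃ k, e k = r := by
  obtain ⟨σ, he, -⟩ := h
  refine ⟨σ.symm ((fibEnum φ.fn s).symm ⟨r, hr⟩), ?_⟩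
  rw [← he]
  simp

theorem IsAt.source_eq {φ : FreeHom M x y} {s : Fin y.1} {n : ℕ} {x' : Fin n → M.Obj} {y' : M.Obj}
    {e : Fin n → Fin x.1} {v : M.Hom x' y'} (h : IsAt φ s e v) (k : Fin n) : x' k = x.2 (e k) := by
  obtain ⟨σ, he, hx, -⟩ := h
  rw [hx, fibTuple, he]

theorem IsAt.target_eq {φ : FreeHom M x y} {s : Fin y.1} {n : ℕ} {x' : Fin n → M.Obj} {y' : M.Obj}
    {e : Fin n → Fin x.1} {v : M.Hom x' y'} (h : IsAt φ s e v) : y.2 s = y' :=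
  h.choose_spec.choose_spec.choose_spec.choose

theorem isAt_mor (hM : M.Laws) (φ : FreeHom M x y) (s : Fin y.1) :
    IsAt φ s (fun k => (fibEnum φ.fn s k).1) (φ.mor s) :=
  ⟨Equiv.refl _, fun _ => rfl, fun _ => rfl, rfl, (hM.perm_refl _).symm⟩

/-- Any common enumeration of the fibres suffices. The functions agree because every index is
enumerated in the fibre over its image, and the multimorphisms agree because the action of a
permutation is injective. -/
theorem ext_isAt (hM : M.Laws) {φ ψ : FreeHom M x y}
    (h : ∀ s, ∃ (n : ℕ) (x' : Fin n → M.Obj) (y' : M.Obj) (e : Fin n → Fin x.1) (v : M.Hom x' y'),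
      IsAt φ s e v ∧ IsAt ψ s e v) : φ = ψ := by
  obtain ⟨f, φ⟩ := φ
  obtain ⟨g, ψ⟩ := ψ
  obtain rfl : f = g := funext fun r => by
    obtain ⟨n, x', y', e, v, h₁, h₂⟩ := h (f r)
    obtain ⟨k, rfl⟩ := h₁.exists_eq (r := r) rfl
    exact (h₂.fn_eq k).symm
  congr 1
  funext s
  obtain ⟨n, x', y', e, v, ⟨σ, he, hx, rfl, hv⟩, σ', he', hx', hy', hv'⟩ := h s
  refine hM.perm_injective σ hx (hv.symm.trans (hv'.trans ?_))
  refine M.perm_congr (fun k => (fibEnum f s).injective (Subtype.ext ?_)) _ _ _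
  rw [he, he']

theorem IsAt.perm (hM : M.Laws) {φ : FreeHom M x y} {s : Fin y.1} {m n : ℕ} {x' : Fin n → M.Obj}
    {x'' : Fin m → M.Obj} {y' : M.Obj} {e : Fin n → Fin x.1} {v : M.Hom x' y'} (h : IsAt φ s e v)
    (τ : Fin m ≃ Fin n) (hτ : ∀ i, x'' i = x' (τ i)) :
    IsAt φ s (fun k => e (τ k)) (M.perm τ hτ v) := by
  obtain ⟨σ, he, hx, rfl, rfl⟩ := h
  exact ⟨τ.trans σ, fun k => he _, fun k => (hτ k).trans (hx _), rfl, hM.perm_perm _ _ _ _ _⟩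

theorem IsAt.congr (hM : M.Laws) {φ : FreeHom M x y} {s s' : Fin y.1} {m n : ℕ} {x' : Fin n → M.Obj}
    {x'' : Fin m → M.Obj} {y' : M.Obj} {e : Fin n → Fin x.1} {e' : Fin m → Fin x.1}
    {v : M.Hom x' y'} {v' : M.Hom x'' y'} (h : IsAt φ s e v) (hs : s = s') (τ : Fin m ≃ Fin n)
    (hτ : ∀ i, x'' i = x' (τ i)) (he : ∀ k, e (τ k) = e' k) (hv : M.perm τ hτ v = v') :
    IsAt φ s' e' v' := by
  subst hs hv
  obtain rfl : (fun k => e (τ k)) = e' := funext he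
  exact h.perm hM τ hτ

theorem IsAt.of_perm (hM : M.Laws) {φ : FreeHom M x y} {s : Fin y.1} {m n : ℕ} {x' : Fin n → M.Obj}
    {x'' : Fin m → M.Obj} {y' : M.Obj} {e : Fin n → Fin x.1} {e' : Fin m → Fin x.1}
    {v : M.Hom x' y'} {τ : Fin m ≃ Fin n} {hτ : ∀ i, x'' i = x' (τ i)}
    (h : IsAt φ s e' (M.perm τ hτ v)) (he : ∀ k, e' k = e (τ k)) : IsAt φ s e v := by
  refine h.congr hM rfl τ.symm (fun k => ?_) (fun k => ?_) ?_
  · rw [hτ, τ.apply_symm_apply]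
  · rw [he, τ.apply_symm_apply]
  · rw [hM.perm_perm]
    exact hM.perm_eq_self _ (fun k => τ.apply_symm_apply k) _ _

/-- The equivariance laws say exactly that a composite may be computed with any enumerations of the
fibres, the composite fibre being enumerated block by block. Afterwards the increasing enumerations
are no longer needed. -/
theorem IsAt.comp (hM : M.Laws) {φ : FreeHom M x y} {ψ : FreeHom M y z} {t : Fin z.1} {n : ℕ}
    {j : Fin n → ℕ} {x' : ∀ k, Fin (j k) → M.Obj} {y' : Fin n → M.Obj} {z' : M.Obj}
    {e : Fin n → Fin y.1} {e' : ∀ k, Fin (j k) → Fin x.1} {v : M.Hom y' z'}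
    {v' : ∀ k, M.Hom (x' k) (y' k)} (h : IsAt ψ t e v) (h' : ∀ k, IsAt φ (e k) (e' k) (v' k)) :
    IsAt (φ.comp ψ) t (concat e') (M.comp v v') := by
  obtain ⟨σ, he, hy, rfl, rfl⟩ := h
  obtain rfl : (fun k => (fibEnum ψ.fn t (σ k)).1) = e := funext he
  choose σ' he' hx hy' hv using h'
  obtain rfl : (fun k => y.2 (fibEnum ψ.fn t (σ k)).1) = y' := funext hy'
  obtain rfl : (fun k i => (fibEnum φ.fn (fibEnum ψ.fn t (σ k)).1 (σ' k i)).1) = e' :=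
    funext fun k => funext (he' k)
  obtain rfl : x' = fun k i => fibTuple x.2 φ.fn (fibEnum ψ.fn t (σ k)).1 (σ' k i) :=
    funext fun k => funext (hx k)
  obtain rfl : v' = fun k => M.perm (σ' k) (hx k) (φ.mor (fibEnum ψ.fn t (σ k)).1) := funext hv
  have h₁ := hM.inner_equivariant (M.perm σ hy (ψ.mor t)) σ'
    (fun k => φ.mor (fibEnum ψ.fn t (σ k)).1)
  have h₂ := hM.outer_equivariant σ (ψ.mor t) fun k => φ.mor (fibEnum ψ.fn t k).1
  have h₃ := h₁.trans ((congrArg (M.perm _ _) h₂).trans (hM.perm_perm _ _ _ _ _))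
  -- Sends a position in the concatenation of the chosen enumerations to the corresponding one in
  -- the increasing enumeration of the composite fibre.
  let ρ : Fin (∑ k, j k) ≃ Fin (Finset.univ.filter fun r => ψ.fn (φ.fn r) = t).card :=
    (blockEquiv ((Equiv.sigmaCongrRight σ').trans
      (Equiv.sigmaCongrLeft (β := fun s => Fin (Finset.univ.filter
        fun r => φ.fn r = (fibEnum ψ.fn t s).1).card) σ))).trans
          ((fibComp φ.fn ψ.fn t).trans finSigmaFinEquiv).symm
  have hρ (p : Σ k, Fin (j k)) :
      ρ (finSigmaFinEquiv p) = (fibComp φ.fn ψ.fn t).symm ⟨σ p.1, σ' p.1 p.2⟩ := by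
    simp [ρ, blockEquiv]
  have hρ' (p : Σ k, Fin (j k)) : (fibEnum (fun r => ψ.fn (φ.fn r)) t (ρ (finSigmaFinEquiv p))).1 =
      (fibEnum φ.fn (fibEnum ψ.fn t (σ p.1)).1 (σ' p.1 p.2)).1 := by
    rw [hρ]
    exact fibComp_symm_spec φ.fn ψ.fn t ⟨σ p.1, σ' p.1 p.2⟩
  refine ⟨ρ, fun k => ?_, fun k => ?_, rfl, ?_⟩
  · obtain ⟨p, rfl⟩ := finSigmaFinEquiv.surjective k
    exact (hρ' p).trans (concat_mk (fun k i =>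
      (fibEnum φ.fn (fibEnum ψ.fn t (σ k)).1 (σ' k i)).1) p).symm
  · obtain ⟨p, rfl⟩ := finSigmaFinEquiv.surjective k
    exact (concat_mk (fun k i => fibTuple x.2 φ.fn (fibEnum ψ.fn t (σ k)).1 (σ' k i)) p).trans
      (congrArg x.2 (hρ' p).symm)
  · refine h₃.trans (Eq.trans ?_ (hM.perm_perm _ _ _ _ _).symm)
    refine M.perm_congr (fun k => ?_) _ _ _
    change _ = finSigmaFinEquiv (fibComp φ.fn ψ.fn t (((blockEquiv _).trans
      ((fibComp φ.fn ψ.fn t).trans finSigmaFinEquiv).symm) k))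
    -- Only the cancellation of `fibComp` against its inverse matters, not its construction.
    generalize fibComp φ.fn ψ.fn t = q
    simp [blockEquiv]

theorem perm_castTarget {m n : ℕ} {a : Fin m → M.Obj} {a' : Fin n → M.Obj} {b b' : M.Obj}
    (h : b = b') (σ : Fin n ≃ Fin m) (hσ : ∀ i, a' i = a (σ i)) (v : M.Hom a b) :
    M.perm σ hσ (castTarget M h v) = castTarget M h (M.perm σ hσ v) := by
  subst h
  rfl

theorem castTarget_castTarget {n : ℕ} {a : Fin n → M.Obj} {b b' : M.Obj}
    (h : b = b') (h' : b' = b) (v : M.Hom a b) : castTarget M h' (castTarget M h v) = v := by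
  subst h
  rfl

/-- Enumerations push forward along a map that is bijective between the two fibres, and the
multimorphism stays the same. Both halves of a concatenation of morphisms are instances. -/
theorem isAt_of_fibTransport (hM : M.Laws) {x' y' : FreeObj M} {φ : FreeHom M x y}
    {φ' : FreeHom M x' y'} {s : Fin y.1} {s' : Fin y'.1} (i : Fin x.1 → Fin x'.1)
    (hi : Set.BijOn i {r | φ.fn r = s} {r | φ'.fn r = s'}) (hx : ∀ r, x'.2 (i r) = x.2 r)
    (hy : y.2 s = y'.2 s')
    (hφ : φ'.mor s' = castTarget M hy (fibTransport M i hi hx (φ.mor s))) {n : ℕ}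
    {a : Fin n → M.Obj} {b : M.Obj} {e : Fin n → Fin x.1} {v : M.Hom a b} (h : IsAt φ s e v) :
    IsAt φ' s' (fun k => i (e k)) v := by
  obtain ⟨σ, he, hx', rfl, rfl⟩ := h
  have h' (k) : (fibEnum φ'.fn s' (((fibEnum φ'.fn s').trans ((Set.BijOn.equiv i hi).symm.trans
      (fibEnum φ.fn s).symm)).symm (σ k))).1 = i (e k) := by
    rw [← he]
    simp only [Equiv.symm_trans_apply, Equiv.symm_symm, Equiv.apply_symm_apply]
    rfl
  refine ⟨σ.trans ((fibEnum φ'.fn s').trans ((Set.BijOn.equiv i hi).symm.trans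
    (fibEnum φ.fn s).symm)).symm, h', fun k => ?_, hy.symm, ?_⟩
  · refine (hx' k).trans ((congrArg x.2 (he k)).trans ((hx _).symm.trans ?_))
    exact congrArg x'.2 (h' k).symm
  · rw [hφ, perm_castTarget, castTarget_castTarget]
    refine Eq.trans ?_ (hM.perm_perm _ _ _ _ _).symm
    exact M.perm_congr (fun k => by simp) _ _ _

/-! The elementary morphisms. -/

theorem IsAt.tensor_left (hM : M.Laws) {x' y' : FreeObj M} {φ : FreeHom M x y} {s : Fin y.1} {n : ℕ}
    {a : Fin n → M.Obj} {b : M.Obj} {e : Fin n → Fin x.1} {v : M.Hom a b} (h : IsAt φ s e v)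
    (ψ : FreeHom M x' y') :
    IsAt (φ.tensorHom ψ) (Fin.castAdd y'.1 s) (fun k => Fin.castAdd x'.1 (e k)) v := by
  refine isAt_of_fibTransport hM (φ' := φ.tensorHom ψ) (s' := Fin.castAdd y'.1 s)
    (Fin.castAdd x'.1) (sumFn_left φ.fn ψ.fn s)
    (fun r => Fin.append_left x.2 x'.2 r) (Fin.append_left y.2 y'.2 s).symm ?_ h
  simp only [FreeHom.tensorHom]
  exact Fin.addCases_left s

theorem IsAt.tensor_right (hM : M.Laws) {x' y' : FreeObj M} {ψ : FreeHom M x' y'} {s : Fin y'.1}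
    {n : ℕ} {a : Fin n → M.Obj} {b : M.Obj} {e : Fin n → Fin x'.1} {v : M.Hom a b}
    (φ : FreeHom M x y) (h : IsAt ψ s e v) :
    IsAt (φ.tensorHom ψ) (Fin.natAdd y.1 s) (fun k => Fin.natAdd x.1 (e k)) v := by
  refine isAt_of_fibTransport hM (φ' := φ.tensorHom ψ) (s' := Fin.natAdd y.1 s)
    (Fin.natAdd x.1) (sumFn_right φ.fn ψ.fn s)
    (fun r => Fin.append_right x.2 x'.2 r) (Fin.append_right y.2 y'.2 s).symm ?_ h
  simp only [FreeHom.tensorHom]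
  exact Fin.addCases_right s

theorem isAt_ofMulti (hM : M.Laws) {n : ℕ} {x : Fin n → M.Obj} {y : M.Obj} (φ : M.Hom x y) :
    IsAt (ofMulti φ) 0 (fun k => k) φ := by
  let σ : Fin (Finset.univ.filter fun r : Fin n => (fun _ => (0 : Fin 1)) r = 0).card ≃ Fin n :=
    (fibEnum (fun _ => 0) 0).trans (Equiv.subtypeUnivEquiv fun _ => Subsingleton.elim _ _)
  have h (k) : (fibEnum (fun _ : Fin n => (0 : Fin 1)) 0 (σ.symm k)).1 = k :=
    σ.apply_symm_apply k
  refine ⟨σ.symm, h, fun k => congrArg x (h k).symm, rfl, ?_⟩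
  refine Eq.trans ?_ (hM.perm_perm _ _ _ _ _).symm
  exact (hM.perm_eq_self _ (fun i => σ.apply_symm_apply i) _ _).symm

theorem IsAt.mapMulti {N : MultiData.{u, v}} {F : MultifunctorData M N} (hF : F.Laws)
    {φ : FreeHom M x y} {s : Fin y.1} {n : ℕ} {a : Fin n → M.Obj} {b : M.Obj}
    {e : Fin n → Fin x.1} {v : M.Hom a b} (h : IsAt φ s e v) :
    IsAt (FreeHom.mapMulti F φ) s e (F.map v) := by
  obtain ⟨σ, he, hx, rfl, rfl⟩ := h
  exact ⟨σ, he, fun k => congrArg F.obj (hx k), rfl, hF.map_perm _ _ _⟩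

theorem isAt_ofEquiv (hM : M.Laws) (e : Fin x.1 ≃ Fin y.1) (h : ∀ r, x.2 r = y.2 (e r))
    {r : Fin x.1} {s : Fin y.1} (hr : e r = s) :
    IsAt (ofEquiv e h) s (fun _ : Fin 1 => r) (M.id (y.2 s)) := by
  let σ := (fibEnum e s).trans (@Equiv.ofUnique _ (Fin 1) ⟨⟨⟨e.symm s, e.apply_symm_apply s⟩⟩,
    fun r => Subtype.ext (by simp [← r.2])⟩ _)
  have h' (k) : (fibEnum e s (σ.symm k)).1 = r :=
    e.injective ((fibEnum e s (σ.symm k)).2.trans hr.symm)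
  refine ⟨σ.symm, h', fun k => ?_, rfl, ?_⟩
  · exact ((h _).trans (congrArg y.2 ((congrArg e (h' k)).trans hr))).symm
  · refine Eq.trans ?_ (hM.perm_perm _ _ _ _ _).symm
    exact (hM.perm_eq_self _ (fun i => Subsingleton.elim _ _) _ _).symm

/-- The morphism `φ` takes the entry `r` to the entry `s` without change, and no other entry goes
to `s`. -/
def Moves (φ : FreeHom M x y) (r : Fin x.1) (s : Fin y.1) : Prop :=
  IsAt φ s (fun _ : Fin 1 => r) (M.id (y.2 s))

theorem moves_ofEquiv (hM : M.Laws) (e : Fin x.1 ≃ Fin y.1) (h : ∀ r, x.2 r = y.2 (e r))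
    {r : Fin x.1} {s : Fin y.1} (hr : e r = s) : Moves (ofEquiv e h) r s :=
  isAt_ofEquiv hM e h hr

theorem moves_id (hM : M.Laws) (x : FreeObj M) (r : Fin x.1) : Moves (FreeHom.id x) r r :=
  moves_ofEquiv hM _ _ rfl

theorem Moves.source_eq {φ : FreeHom M x y} {r : Fin x.1} {s : Fin y.1} (h : Moves φ r s) :
    x.2 r = y.2 s :=
  (IsAt.source_eq h 0).symm

/-- The criterion for equations between structure morphisms: follow each entry of the target back to
its origin. -/
theorem ext_moves (hM : M.Laws) {φ ψ : FreeHom M x y} (h : ∀ s, ∃ r, Moves φ r s ∧ Moves ψ r s) :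
    φ = ψ :=
  ext_isAt hM fun s =>
    let ⟨r, h₁, h₂⟩ := h s
    ⟨1, _, _, fun _ => r, M.id (y.2 s), h₁, h₂⟩

/-- The unit law for composing with an identity multimorphism, its permutation absorbed into the
enumeration. `IsAt.moves_comp` is the same with the identities on the inside. -/
theorem IsAt.comp_moves (hM : M.Laws) {φ : FreeHom M x y} {ψ : FreeHom M y z} {s : Fin y.1}
    {t : Fin z.1} {n : ℕ} {a : Fin n → M.Obj} {b : M.Obj} {e : Fin n → Fin x.1} {v : M.Hom a b}
    (h : IsAt φ s e v) (h' : Moves ψ s t) : IsAt (φ.comp ψ) t e v := by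
  have hb : b = z.2 t := h.target_eq.symm.trans h'.source_eq
  subst hb
  have h'' := IsAt.comp hM h' (j := fun _ => n) (e' := fun _ => e)
    (x' := fun _ => a) (v' := fun _ => v) fun _ => h
  rw [hM.id_comp] at h''
  exact h''.of_perm hM fun k => rfl

theorem IsAt.moves_comp (hM : M.Laws) {φ : FreeHom M x y} {ψ : FreeHom M y z}
    {t : Fin z.1} {n : ℕ} {a : Fin n → M.Obj} {b : M.Obj} {e : Fin n → Fin y.1}
    {e' : Fin n → Fin x.1} {v : M.Hom a b} (h : IsAt ψ t e v) (h' : ∀ k, Moves φ (e' k) (e k)) :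
    IsAt (φ.comp ψ) t e' v := by
  obtain rfl : a = fun k => y.2 (e k) := funext h.source_eq
  have h'' := IsAt.comp hM h (j := fun _ => 1) (e' := fun k _ => e' k)
    (x' := fun k _ => y.2 (e k)) (v' := fun k => M.id (y.2 (e k))) h'
  rw [hM.comp_id] at h''
  exact h''.of_perm hM fun k => rfl

theorem Moves.comp (hM : M.Laws) {φ : FreeHom M x y} {ψ : FreeHom M y z} {r : Fin x.1} {s : Fin y.1}
    {t : Fin z.1} (h : Moves φ r s) (h' : Moves ψ s t) : Moves (φ.comp ψ) r t :=
  IsAt.moves_comp hM h' fun _ => h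

theorem Moves.tensor_left (hM : M.Laws) {x' y' : FreeObj M} {φ : FreeHom M x y} {r : Fin x.1}
    {s : Fin y.1} (h : Moves φ r s) (ψ : FreeHom M x' y') :
    Moves (φ.tensorHom ψ) (Fin.castAdd x'.1 r) (Fin.castAdd y'.1 s) := by
  have h' : (append y y').2 (Fin.castAdd y'.1 s) = y.2 s := Fin.append_left _ _ _
  unfold Moves
  rw [h']
  exact IsAt.tensor_left hM h ψ

theorem Moves.tensor_right (hM : M.Laws) {x' y' : FreeObj M} (φ : FreeHom M x y)
    {ψ : FreeHom M x' y'} {r : Fin x'.1} {s : Fin y'.1} (h : Moves ψ r s) :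
    Moves (φ.tensorHom ψ) (Fin.natAdd x.1 r) (Fin.natAdd y.1 s) := by
  have h' : (append y y').2 (Fin.natAdd y.1 s) = y'.2 s := Fin.append_right _ _ _
  unfold Moves
  rw [h']
  exact IsAt.tensor_right hM φ h

end FreeHom

/-! ### The symmetric monoidal category generated by a multicategory -/

namespace FreeHom

variable {M : MultiData.{u, v}} {x y z : FreeObj M}

theorem append_cases {p : Fin (append x y).1 → Prop} (h₁ : ∀ s, p (Fin.castAdd y.1 s))
    (h₂ : ∀ s, p (Fin.natAdd x.1 s)) (s : Fin (append x y).1) : p s :=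
  Fin.addCases (motive := p) h₁ h₂ s

theorem moves_finCongr (hM : M.Laws) (e : x.1 = y.1) (h : ∀ r, x.2 r = y.2 (finCongr e r))
    {r : Fin x.1} {s : Fin y.1} (hr : r.val = s.val) : Moves (ofEquiv (finCongr e) h) r s :=
  moves_ofEquiv hM _ _ (Fin.ext hr)

theorem moves_braid_left (hM : M.Laws) (r : Fin x.1) :
    Moves ((freeData M).braid x y) (Fin.castAdd y.1 r) (Fin.natAdd y.1 r) := by
  dsimp only [freeData]
  exact moves_ofEquiv hM _ _ (finAddFlip_apply_castAdd r y.1)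

theorem moves_braid_right (hM : M.Laws) (r : Fin y.1) :
    Moves ((freeData M).braid x y) (Fin.natAdd x.1 r) (Fin.castAdd x.1 r) := by
  dsimp only [freeData]
  exact moves_ofEquiv hM _ _ (finAddFlip_apply_natAdd r x.1)

theorem moves_assoc (hM : M.Laws) {r : Fin (append (append x y) z).1}
    {s : Fin (append x (append y z)).1} (h : r.val = s.val) :
    Moves ((freeData M).assocHom x y z) r s := by
  dsimp only [freeData]
  exact moves_finCongr hM _ _ h

theorem moves_assocInv (hM : M.Laws) {r : Fin (append x (append y z)).1}
    {s : Fin (append (append x y) z).1} (h : r.val = s.val) :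
    Moves ((freeData M).assocInv x y z) r s := by
  dsimp only [freeData]
  exact moves_finCongr hM _ _ h

theorem moves_left (hM : M.Laws) {r : Fin (append ⟨0, Fin.elim0⟩ x).1} {s : Fin x.1}
    (h : r.val = s.val) : Moves ((freeData M).leftHom x) r s := by
  dsimp only [freeData]
  exact moves_finCongr hM _ _ h

theorem moves_leftInv (hM : M.Laws) {r : Fin x.1} {s : Fin (append ⟨0, Fin.elim0⟩ x).1}
    (h : r.val = s.val) : Moves ((freeData M).leftInv x) r s := by
  dsimp only [freeData]
  exact moves_finCongr hM _ _ h

theorem moves_right (hM : M.Laws) {r : Fin (append x ⟨0, Fin.elim0⟩).1} {s : Fin x.1}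
    (h : r.val = s.val) : Moves ((freeData M).rightHom x) r s := by
  dsimp only [freeData]
  exact moves_finCongr hM _ _ h

theorem moves_rightInv (hM : M.Laws) {r : Fin x.1} {s : Fin (append x ⟨0, Fin.elim0⟩).1}
    (h : r.val = s.val) : Moves ((freeData M).rightInv x) r s := by
  dsimp only [freeData]
  exact moves_finCongr hM _ _ h

theorem id_comp (hM : M.Laws) (f : FreeHom M x y) : (FreeHom.id x).comp f = f :=
  ext_isAt hM fun s =>
    ⟨_, _, _, _, _, (isAt_mor hM f s).moves_comp hM fun _ => moves_id hM _ _, isAt_mor hM f s⟩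

theorem comp_id (hM : M.Laws) (f : FreeHom M x y) : f.comp (FreeHom.id y) = f :=
  ext_isAt hM fun s =>
    ⟨_, _, _, _, _, (isAt_mor hM f s).comp_moves hM (moves_id hM _ _), isAt_mor hM f s⟩

theorem comp_assoc (hM : M.Laws) {w : FreeObj M} (f : FreeHom M w x) (g : FreeHom M x y)
    (h : FreeHom M y z) : (f.comp g).comp h = f.comp (g.comp h) := by
  refine ext_isAt hM fun s => ?_
  have h₀ := isAt_mor hM h s
  have h₁ := fun k => isAt_mor hM g (fibEnum h.fn s k).1
  have h₂ := fun k l => isAt_mor hM f (fibEnum g.fn (fibEnum h.fn s k).1 l).1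
  -- `h₃` describes the left side and `h₄` the right side of the law; associativity in `M` makes
  -- their values differ by a permutation that also relates their enumerations.
  have h₃ := h₀.comp hM fun k => (h₁ k).comp hM (h₂ k)
  have h₄ := (h₀.comp hM h₁).comp hM fun k =>
    h₂ (finSigmaFinEquiv.symm k).1 (finSigmaFinEquiv.symm k).2
  rw [hM.assoc (h.mor s) (fun k => g.mor (fibEnum h.fn s k).1)
    fun k l => f.mor (fibEnum g.fn (fibEnum h.fn s k).1 l).1] at h₄
  exact ⟨_, _, _, _, _, h₃, h₄.of_perm hM (concat_block _ fun p => (concat_mk (fun l i =>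
    (fibEnum f.fn (fibEnum g.fn (fibEnum h.fn s (finSigmaFinEquiv.symm p.1).1).1 l).1 i).1)
      ⟨(finSigmaFinEquiv.symm p.1).2, p.2⟩).symm)⟩

end FreeHom

open FreeHom

/-- Equations between structure morphisms use `ext_moves`, the others `ext_isAt`. Each block of the
target is followed through both composites; what remains are identities between positions, such as
associativity of addition for the last block of an associator. -/
theorem freeData_laws (M : MultiData.{u, v}) (hM : M.Laws) : (freeData M).Laws where
  id_comp := FreeHom.id_comp hM
  comp_id := FreeHom.comp_id hM
  assoc := FreeHom.comp_assoc hM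
  tensor_id x y := ext_moves hM <| append_cases
    (fun s => ⟨_, (moves_id hM x s).tensor_left hM _, moves_id hM _ _⟩)
    fun s => ⟨_, (moves_id hM y s).tensor_right hM _, moves_id hM _ _⟩
  tensor_comp f g f' g' := ext_isAt hM <| append_cases
    (fun s => ⟨_, _, _, _, _, ((isAt_mor hM g s).comp hM fun k => isAt_mor hM f _).tensor_left hM _,
      ((isAt_mor hM g s).tensor_left hM _).comp hM fun k => (isAt_mor hM f _).tensor_left hM _⟩)
    fun s => ⟨_, _, _, _, _, ((isAt_mor hM g' s).comp hM fun k => isAt_mor hM f' _).tensor_right hM _,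
      ((isAt_mor hM g' s).tensor_right hM _).comp hM fun k => (isAt_mor hM f' _).tensor_right hM _⟩
  assoc_hom_inv x y z := ext_moves hM fun s =>
    ⟨_, (moves_assoc hM (s := Fin.cast (Nat.add_assoc _ _ _) s) rfl).comp hM (moves_assocInv hM rfl),
      moves_id hM _ _⟩
  assoc_inv_hom x y z := ext_moves hM fun s =>
    ⟨_, (moves_assocInv hM (s := Fin.cast (Nat.add_assoc _ _ _).symm s) rfl).comp hM
      (moves_assoc hM rfl), moves_id hM _ _⟩
  left_hom_inv x := ext_moves hM fun s =>
    ⟨_, (moves_left hM (s := Fin.cast (Nat.zero_add _) s) rfl).comp hM (moves_leftInv hM rfl),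
      moves_id hM _ _⟩
  left_inv_hom x := ext_moves hM fun s =>
    ⟨_, (moves_leftInv hM (s := Fin.cast (Nat.zero_add _).symm s) rfl).comp hM (moves_left hM rfl),
      moves_id hM _ _⟩
  right_hom_inv x := ext_moves hM fun s =>
    ⟨_, (moves_right hM (x := x) (s := s) rfl).comp hM (moves_rightInv hM rfl),
      moves_id hM _ _⟩
  right_inv_hom x := ext_moves hM fun s =>
    ⟨_, (moves_rightInv hM (s := s) rfl).comp hM (moves_right hM rfl),
      moves_id hM _ _⟩
  assoc_nat {x x' y y' z z'} f g h := ext_isAt hM <| append_cases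
    (fun s => ⟨_, _, _, _, _,
      (((isAt_mor hM f s).tensor_left hM g).tensor_left hM h).comp_moves hM (moves_assoc hM rfl),
      ((isAt_mor hM f s).tensor_left hM (g.tensorHom h)).moves_comp hM fun k =>
        moves_assoc hM rfl⟩) <| append_cases
    (fun s => ⟨_, _, _, _, _,
      (((isAt_mor hM g s).tensor_right hM f).tensor_left hM h).comp_moves hM (moves_assoc hM rfl),
      (((isAt_mor hM g s).tensor_left hM h).tensor_right hM f).moves_comp hM fun k =>
        moves_assoc hM rfl⟩)
    fun s => ⟨_, _, _, _, _,
      ((isAt_mor hM h s).tensor_right hM (f.tensorHom g)).comp_moves hM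
        (moves_assoc hM (by exact Nat.add_assoc _ _ _)),
      (((isAt_mor hM h s).tensor_right hM g).tensor_right hM f).moves_comp hM fun k =>
        moves_assoc hM (by exact Nat.add_assoc _ _ _)⟩
  left_nat {x y} f := ext_isAt hM fun s => ⟨_, _, _, _, _,
    ((isAt_mor hM f s).tensor_right hM _).comp_moves hM (moves_left hM (Nat.zero_add _)),
    (isAt_mor hM f s).moves_comp hM fun k => moves_left hM (Nat.zero_add _)⟩
  right_nat {x y} f := ext_isAt hM fun s => ⟨_, _, _, _, _,
    ((isAt_mor hM f s).tensor_left hM _).comp_moves hM (moves_right hM rfl),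
    (isAt_mor hM f s).moves_comp hM fun k => moves_right hM rfl⟩
  braid_nat f g := ext_isAt hM <| append_cases
    (fun s => ⟨_, _, _, _, _,
      ((isAt_mor hM g s).tensor_right hM f).comp_moves hM (moves_braid_right hM s),
      ((isAt_mor hM g s).tensor_left hM f).moves_comp hM fun k => moves_braid_right hM _⟩)
    fun s => ⟨_, _, _, _, _,
      ((isAt_mor hM f s).tensor_left hM g).comp_moves hM (moves_braid_left hM s),
      ((isAt_mor hM f s).tensor_right hM g).moves_comp hM fun k => moves_braid_left hM _⟩
  pentagon w x y z := ext_moves hM <| append_cases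
    (fun s => ⟨Fin.castAdd z.1 (Fin.castAdd y.1 (Fin.castAdd x.1 s)),
      ((moves_assoc hM (s := Fin.castAdd _ s) rfl).tensor_left hM _).comp hM
        ((moves_assoc hM (s := Fin.castAdd _ s) rfl).comp hM ((moves_id hM w s).tensor_left hM _)),
      (moves_assoc hM (s := Fin.castAdd _ (Fin.castAdd _ s)) rfl).comp hM (moves_assoc hM rfl)⟩) <|
    append_cases
    (fun s => ⟨Fin.castAdd z.1 (Fin.castAdd y.1 (Fin.natAdd w.1 s)),
      ((moves_assoc hM (s := Fin.natAdd _ (Fin.castAdd _ s)) rfl).tensor_left hM _).comp hM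
        ((moves_assoc hM (s := Fin.natAdd _ (Fin.castAdd _ (Fin.castAdd _ s))) rfl).comp hM
          ((moves_assoc hM rfl).tensor_right hM _)),
      (moves_assoc hM (s := Fin.castAdd _ (Fin.natAdd _ s)) rfl).comp hM (moves_assoc hM rfl)⟩) <|
    append_cases
    (fun s => ⟨Fin.castAdd z.1 (Fin.natAdd (w.1 + x.1) s),
      ((moves_assoc hM (s := Fin.natAdd _ (Fin.natAdd _ s))
        (by exact Nat.add_assoc _ _ _)).tensor_left hM _).comp hM
        ((moves_assoc hM (s := Fin.natAdd _ (Fin.castAdd _ (Fin.natAdd _ s))) rfl).comp hM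
          ((moves_assoc hM rfl).tensor_right hM _)),
      (moves_assoc hM (s := Fin.natAdd _ (Fin.castAdd _ s)) rfl).comp hM
        (moves_assoc hM (by exact Nat.add_assoc _ _ _))⟩)
    (fun s => ⟨Fin.natAdd (w.1 + x.1 + y.1) s,
      ((moves_id hM z s).tensor_right hM _).comp hM
        ((moves_assoc hM (s := Fin.natAdd _ (Fin.natAdd _ s)) (by exact Nat.add_assoc _ _ _)).comp hM
          ((moves_assoc hM (by exact Nat.add_assoc _ _ _)).tensor_right hM _)),
      (moves_assoc hM (s := Fin.natAdd _ (Fin.natAdd _ s)) (by exact Nat.add_assoc _ _ _)).comp hM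
        (moves_assoc hM (by exact Nat.add_assoc _ _ _))⟩)
  triangle x y := ext_moves hM <| append_cases
    (fun s => ⟨_,
      (moves_assoc hM (r := Fin.castAdd _ (Fin.castAdd _ s)) rfl).comp hM
        ((moves_id hM x s).tensor_left hM _),
      (moves_right hM (x := x) (r := Fin.castAdd _ s) rfl).tensor_left hM _⟩)
    fun s => ⟨_,
      (moves_assoc hM (r := Fin.natAdd _ s) (by exact Nat.add_assoc _ _ _)).comp hM
        ((moves_left hM (x := y) (r := Fin.natAdd 0 s) (Nat.zero_add _)).tensor_right hM _),
      (moves_id hM y s).tensor_right hM _⟩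
  symmetry x y := ext_moves hM <| append_cases
    (fun s => ⟨_, (moves_braid_left hM s).comp hM (moves_braid_right hM s), moves_id hM _ _⟩)
    fun s => ⟨_, (moves_braid_right hM s).comp hM (moves_braid_left hM s), moves_id hM _ _⟩
  hexagon x y z := ext_moves hM <| append_cases
    (fun s => ⟨Fin.castAdd z.1 (Fin.natAdd x.1 s),
      (moves_assoc hM (s := Fin.natAdd _ (Fin.castAdd _ s)) rfl).comp hM
        ((moves_braid_right hM (x := x) (y := append y z) (Fin.castAdd z.1 s)).comp hM
          (moves_assoc hM rfl)),
      ((moves_braid_right hM s).tensor_left hM _).comp hM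
        ((moves_assoc hM (s := Fin.castAdd _ s) rfl).comp hM ((moves_id hM y s).tensor_left hM _))⟩) <|
    append_cases
    (fun s => ⟨Fin.natAdd (x.1 + y.1) s,
      (moves_assoc hM (s := Fin.natAdd _ (Fin.natAdd _ s)) (by exact Nat.add_assoc _ _ _)).comp hM
        ((moves_braid_right hM (x := x) (y := append y z) (Fin.natAdd y.1 s)).comp hM
          (moves_assoc hM rfl)),
      ((moves_id hM z s).tensor_right hM _).comp hM
        ((moves_assoc hM (s := Fin.natAdd _ (Fin.natAdd _ s)) (by exact Nat.add_assoc _ _ _)).comp hM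
          ((moves_braid_right hM s).tensor_right hM _))⟩)
    fun s => ⟨Fin.castAdd z.1 (Fin.castAdd y.1 s),
      (moves_assoc hM (s := Fin.castAdd _ s) rfl).comp hM
        ((moves_braid_left hM (x := x) (y := append y z) s).comp hM (moves_assoc hM (by exact Nat.add_assoc _ _ _))),
      ((moves_braid_left hM s).tensor_left hM _).comp hM
        ((moves_assoc hM (s := Fin.natAdd _ (Fin.castAdd _ s)) rfl).comp hM
          ((moves_braid_left hM s).tensor_right hM _))⟩

/-! ### Functoriality of the generated symmetric monoidal category -/

namespace FreeHom

theorem Moves.mapMulti {M N : MultiData.{u, v}} {F : MultifunctorData M N} (hF : F.Laws)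
    {x y : FreeObj M} {φ : FreeHom M x y} {r : Fin x.1} {s : Fin y.1} (h : Moves φ r s) :
    Moves (FreeHom.mapMulti F φ) r s := by
  have h' := IsAt.mapMulti hF h
  rwa [hF.map_id] at h'

/-- The effect of a multifunctor on tuples. -/
abbrev mapObj {M N : MultiData.{u, v}} (F : MultifunctorData M N) (x : FreeObj M) : FreeObj N :=
  ⟨x.1, fun i => F.obj (x.2 i)⟩

theorem IsAt.map_comp {M N : MultiData.{u, v}} {F : MultifunctorData M N} (hF : F.Laws)
    {x y : FreeObj N} {φ : FreeHom N x y} {s : Fin y.1} {n : ℕ} {j : Fin n → ℕ}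
    {x' : ∀ k, Fin (j k) → M.Obj} {y' : Fin n → M.Obj} {z' : M.Obj}
    {e : Fin (∑ k, j k) → Fin x.1} {v : M.Hom y' z'} {v' : ∀ k, M.Hom (x' k) (y' k)}
    (h : IsAt φ s e (N.comp (F.map v) fun k => F.map (v' k))) :
    IsAt φ s e (F.map (M.comp v v')) := by
  rwa [hF.map_comp]

/-- The enumerations on both sides are the same, so that only compatibility of `F` with composition
in `M` is used. -/
theorem mapMulti_comp {M N : MultiData.{u, v}} (hM : M.Laws) (hN : N.Laws)
    {F : MultifunctorData M N} (hF : F.Laws) {x y z : FreeObj M} (f : FreeHom M x y)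
    (g : FreeHom M y z) : FreeHom.mapMulti F (f.comp g) =
      (FreeHom.mapMulti F f).comp (FreeHom.mapMulti F g) := by
  refine ext_isAt hN fun s => ⟨_, _, _, _, _, ((isAt_mor hM g s).comp hM
    fun k => isAt_mor hM f _).mapMulti hF, ?_⟩
  refine IsAt.map_comp hF ?_
  exact ((isAt_mor hM g s).mapMulti hF).comp hN fun k => (isAt_mor hM f _).mapMulti hF

theorem moves_mul (h : ∀ M : Multicat.{u, v}, (freeData M.toMultiData).Laws)
    {M N : Multicat.{u, v}} (F : MultifunctorData M.toMultiData N.toMultiData)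
    {x y : FreeObj M.toMultiData} (r : Fin (x.1 + y.1)) :
    Moves ((freeMapData h F).mul x y : FreeHom N.toMultiData _ _) r r := by
  dsimp only [freeMapData]
  exact moves_ofEquiv N.laws _ _ rfl

end FreeHom

open FreeHom

theorem freeMapData_laws (h : ∀ M : Multicat.{u, v}, (freeData M.toMultiData).Laws)
    {M N : Multicat.{u, v}} (F : MultifunctorData M.toMultiData N.toMultiData) (hF : F.Laws) :
    (freeMapData h F).Laws where
  map_id x := ext_moves N.laws fun s => ⟨s, (moves_id M.laws x s).mapMulti hF, moves_id N.laws _ _⟩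
  map_comp f g := mapMulti_comp M.laws N.laws hF f g
  mul_nat f g := ext_isAt N.laws <| append_cases
    (fun s => ⟨_, _, _, _, _,
      (((isAt_mor M.laws f s).mapMulti hF).tensor_left N.laws _).comp_moves N.laws
        (moves_mul h F _),
      (((isAt_mor M.laws f s).tensor_left M.laws g).mapMulti hF).moves_comp N.laws fun k =>
        moves_mul h F _⟩)
    fun s => ⟨_, _, _, _, _,
      (((isAt_mor M.laws g s).mapMulti hF).tensor_right N.laws _).comp_moves N.laws
        (moves_mul h F _),
      (((isAt_mor M.laws g s).tensor_right M.laws f).mapMulti hF).moves_comp N.laws fun k =>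
        moves_mul h F _⟩
  assoc x y z := ext_moves N.laws <| append_cases
    (fun s => ⟨Fin.castAdd z.1 (Fin.castAdd y.1 s),
      ((moves_mul h F (Fin.castAdd y.1 s)).tensor_left N.laws _).comp N.laws
        ((moves_mul h F (x := append x y) (y := z) (Fin.castAdd z.1 (Fin.castAdd y.1 s))).comp N.laws
          ((moves_assoc M.laws rfl).mapMulti hF)),
      (moves_assoc N.laws (x := mapObj F x) (y := mapObj F y) (z := mapObj F z)
        (s := Fin.castAdd (y.1 + z.1) s) rfl).comp N.laws
        (((moves_id N.laws (mapObj F x) s).tensor_left N.laws ((freeMapData h F).mul y z)).comp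
          N.laws (moves_mul h F (x := x) (y := append y z) (Fin.castAdd (y.1 + z.1) s)))⟩) <|
    append_cases
    (fun s => ⟨Fin.castAdd z.1 (Fin.natAdd x.1 s),
      ((moves_mul h F (Fin.natAdd x.1 s)).tensor_left N.laws _).comp N.laws
        ((moves_mul h F (x := append x y) (y := z) (Fin.castAdd z.1 (Fin.natAdd x.1 s))).comp N.laws
          ((moves_assoc M.laws rfl).mapMulti hF)),
      (moves_assoc N.laws (x := mapObj F x) (y := mapObj F y) (z := mapObj F z)
        (s := Fin.natAdd x.1 (Fin.castAdd z.1 s)) rfl).comp N.laws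
        (((moves_mul h F (Fin.castAdd z.1 s)).tensor_right N.laws _).comp N.laws
          (moves_mul h F (x := x) (y := append y z) _))⟩)
    fun s => ⟨Fin.natAdd (x.1 + y.1) s,
      ((moves_id N.laws (mapObj F z) s).tensor_right N.laws ((freeMapData h F).mul x y)).comp N.laws
        ((moves_mul h F (x := append x y) (y := z) (Fin.natAdd (x.1 + y.1) s)).comp N.laws
          ((moves_assoc M.laws (s := Fin.natAdd x.1 (Fin.natAdd y.1 s)) (by exact Nat.add_assoc _ _ _)).mapMulti hF)),
      (moves_assoc N.laws (x := mapObj F x) (y := mapObj F y) (z := mapObj F z)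
        (s := Fin.natAdd x.1 (Fin.natAdd y.1 s))
        (by exact Nat.add_assoc _ _ _)).comp N.laws
        (((moves_mul h F (Fin.natAdd y.1 s)).tensor_right N.laws _).comp N.laws
          (moves_mul h F (x := x) (y := append y z) _))⟩
  left_unit x := ext_moves N.laws fun s => ⟨Fin.natAdd 0 s, moves_left N.laws (Nat.zero_add _),
    ((moves_id N.laws _ s).tensor_right N.laws _).comp N.laws
      ((moves_mul h F (x := ⟨0, Fin.elim0⟩) _).comp N.laws
        ((moves_left M.laws (Nat.zero_add _)).mapMulti hF))⟩
  right_unit x := ext_moves N.laws fun s => ⟨Fin.castAdd 0 s, moves_right N.laws rfl,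
    ((moves_id N.laws _ s).tensor_left N.laws _).comp N.laws
      ((moves_mul h F (y := ⟨0, Fin.elim0⟩) _).comp N.laws
        ((moves_right M.laws rfl).mapMulti hF))⟩
  braided x y := ext_moves N.laws <| append_cases
    (fun s => ⟨Fin.natAdd x.1 s,
      (moves_mul h F (Fin.natAdd x.1 s)).comp N.laws ((moves_braid_right M.laws s).mapMulti hF),
      (moves_braid_right N.laws (x := mapObj F x) (y := mapObj F y) s).comp N.laws (moves_mul h F (Fin.castAdd x.1 s))⟩)
    fun s => ⟨Fin.castAdd y.1 s,
      (moves_mul h F (Fin.castAdd y.1 s)).comp N.laws ((moves_braid_left M.laws s).mapMulti hF),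
      (moves_braid_left N.laws (x := mapObj F x) (y := mapObj F y) s).comp N.laws (moves_mul h F (Fin.natAdd y.1 s))⟩

/-- The object map is definitionally that of the composite, so the remaining data can be compared
field by field without heterogeneous equality. -/
theorem LaxData.toHom_eq_comp {C D E : SymMonCat.{u, v}} (F : LaxData C D) (G : LaxData D E)
    {m : ∀ {x y : C}, (x ⟶ y) → (G.obj (F.obj x) ⟶ G.obj (F.obj y))}
    {e : 𝟙_ E ⟶ G.obj (F.obj (𝟙_ C))}
    {μ : ∀ x y : C, G.obj (F.obj x) ⊗ G.obj (F.obj y) ⟶ G.obj (F.obj (x ⊗ y))} (hF : F.Laws)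
    (hG : G.Laws) (h : (⟨fun x => G.obj (F.obj x), m, e, μ⟩ : LaxData C E).Laws)
    (hm : ∀ {x y : C} (f : x ⟶ y), m f = G.map (F.map f)) (he : e = G.unit ≫ G.map F.unit)
    (hμ : ∀ x y, μ x y = G.mul (F.obj x) (F.obj y) ≫ G.map (F.mul x y)) :
    LaxData.toHom _ h = F.toHom hF ≫ G.toHom hG := by
  obtain rfl : @m = fun {x y} f => G.map (F.map f) := by
    funext x y f
    exact hm f
  obtain rfl : μ = fun x y => G.mul (F.obj x) (F.obj y) ≫ G.map (F.mul x y) :=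
    funext fun x => funext fun y => hμ x y
  subst he
  rfl

theorem freeLaws : FreeLaws.{u, v} where
  obj M := freeData_laws _ M.laws
  map F := freeMapData_laws _ F.toMultifunctorData F.laws
  map_id M := laxBraided_ext _ _ rfl (heq_of_eq rfl) fun x y => heq_of_eq rfl
  map_comp {M N P} F G := by
    refine LaxData.toHom_eq_comp (freeMapData _ F.toMultifunctorData)
      (freeMapData _ G.toMultifunctorData)
      (m := fun f => FreeHom.mapMulti (F ≫ G).toMultifunctorData f)
      (e := (freeMapData _ (F ≫ G).toMultifunctorData).unit)
      (μ := (freeMapData _ (F ≫ G).toMultifunctorData).mul) _ _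
      (freeMapData_laws _ (F ≫ G).toMultifunctorData (F ≫ G).laws) (fun f => rfl) ?_ fun x y => ?_
    · exact ext_moves P.laws fun s => s.elim0
    · refine ext_moves P.laws fun s => ⟨s, moves_mul _ (F ≫ G).toMultifunctorData s, ?_⟩
      exact (moves_mul _ G.toMultifunctorData (x := mapObj F.toMultifunctorData x)
        (y := mapObj F.toMultifunctorData y) s).comp P.laws
          ((moves_mul _ F.toMultifunctorData s).mapMulti G.laws)

/-! ### Morphisms that move nothing: permutativity and strictness. -/

theorem moves_eqToHom (hL : FreeLaws.{u, v}) (M : Multicat.{u, v}) {x y : (free hL).obj M}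
    (h : x = y) {r : Fin (Sigma.fst (x : FreeObj M.toMultiData))}
    {s : Fin (Sigma.fst (y : FreeObj M.toMultiData))} (hr : r.val = s.val) :
    Moves (M := M.toMultiData) (eqToHom h) r s := by
  subst h
  obtain rfl := Fin.ext hr
  exact moves_id M.laws _ r

theorem eq_eqToHom_of_moves (hL : FreeLaws.{u, v}) (M : Multicat.{u, v}) {x y : (free hL).obj M}
    (h : x = y) (φ : x ⟶ y)
    (hφ : ∀ (r : Fin (Sigma.fst (x : FreeObj M.toMultiData)))
      (s : Fin (Sigma.fst (y : FreeObj M.toMultiData))), r.val = s.val →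
        Moves (M := M.toMultiData) φ r s) : φ = eqToHom h :=
  ext_moves M.laws fun s =>
    ⟨Fin.cast (congrArg (fun x : FreeObj M.toMultiData => x.1) h.symm) s, hφ _ _ rfl,
      moves_eqToHom hL M h rfl⟩

/-- A morphism that moves nothing between tuples of equal length forces the tuples to agree, since
`Moves` includes the equality of the entries. -/
theorem exists_eq_eqToHom (hL : FreeLaws.{u, v}) (M : Multicat.{u, v}) {x y : (free hL).obj M}
    (h : Sigma.fst (x : FreeObj M.toMultiData) = Sigma.fst (y : FreeObj M.toMultiData)) (φ : x ⟶ y)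
    (hφ : ∀ (r : Fin (Sigma.fst (x : FreeObj M.toMultiData)))
      (s : Fin (Sigma.fst (y : FreeObj M.toMultiData))), r.val = s.val →
        Moves (M := M.toMultiData) φ r s) : ∃ h, φ = eqToHom h := by
  have hxy : x = y := by
    obtain ⟨m, x⟩ := x
    obtain ⟨n, y⟩ := y
    dsimp only at h
    subst h
    exact congrArg (Sigma.mk m) (funext fun i => (hφ i i rfl).source_eq)
  exact ⟨hxy, eq_eqToHom_of_moves hL M hxy φ hφ⟩

theorem isPermutative_free (hL : FreeLaws.{u, v}) (M : Multicat.{u, v}) :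
    IsPermutative ((free hL).obj M) :=
  ⟨fun _ _ _ => exists_eq_eqToHom hL M (Nat.add_assoc _ _ _) _ fun _ _ h => moves_assoc M.laws h,
    fun _ => exists_eq_eqToHom hL M (Nat.zero_add _) _ fun _ _ h => moves_left M.laws h,
    fun _ => exists_eq_eqToHom hL M (by exact rfl) _ fun _ _ h => moves_right M.laws h⟩

theorem isStrict_free (hL : FreeLaws.{u, v}) {M N : Multicat.{u, v}} (F : M ⟶ N) :
    IsStrict ((free hL).map F) := by
  refine ⟨exists_eq_eqToHom hL N (by exact rfl) _ fun r _ _ => r.elim0,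
    fun x y => exists_eq_eqToHom hL N (by exact rfl) _ fun r s h => ?_⟩
  obtain rfl := Fin.ext h
  exact moves_mul _ F.toMultifunctorData _

/-! ### Positions of letters -/

namespace Word

variable {α β : Type}

/-- The length of the concatenation of lists of given lengths. -/
def size (ℓ : α → ℕ) : Word α → ℕ
  | unit => 0
  | leaf a => ℓ a
  | tensor s t => s.size ℓ + t.size ℓ

/-- In the concatenation of lists of given lengths, the entry `i` of the list that belongs to an
occurrence of the letter `a` is at the position `r`. -/
def Pos (ℓ : α → ℕ) : Word α → α → ℕ → ℕ → Prop
  | unit, _, _, _ => False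
  | leaf b, a, i, r => a = b ∧ i = r ∧ i < ℓ b
  | tensor s t, a, i, r => s.Pos ℓ a i r ∨ ∃ r', t.Pos ℓ a i r' ∧ r = s.size ℓ + r'

variable {ℓ : α → ℕ} {w : Word α} {a b : α} {i j r r' : ℕ}

theorem Pos.lt_size (h : w.Pos ℓ a i r) : r < w.size ℓ := by
  induction w generalizing r with
  | unit => exact h.elim
  | leaf c => exact h.2.1 ▸ h.2.2
  | tensor s t hs ht =>
    rcases h with h | ⟨r', h, rfl⟩
    · exact Nat.lt_add_right _ (hs h)
    · exact Nat.add_lt_add_left (ht h) _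

theorem Pos.mem (h : w.Pos ℓ a i r) : a ∈ w.leaves := by
  induction w generalizing r with
  | unit => exact h.elim
  | leaf c => exact List.mem_singleton.2 h.1
  | tensor s t hs ht =>
    rcases h with h | ⟨r', h, rfl⟩
    · exact List.mem_append_left _ (hs h)
    · exact List.mem_append_right _ (ht h)

theorem Pos.lt (h : w.Pos ℓ a i r) : i < ℓ a := by
  induction w generalizing r with
  | unit => exact h.elim
  | leaf c => exact h.1 ▸ h.2.2
  | tensor s t hs ht =>
    rcases h with h | ⟨r', h, rfl⟩
    · exact hs h
    · exact ht h

theorem exists_pos (ha : a ∈ w.leaves) (hi : i < ℓ a) : ∃ r, w.Pos ℓ a i r := by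
  induction w with
  | unit => exact absurd ha List.not_mem_nil
  | leaf c =>
    obtain rfl := List.mem_singleton.1 ha
    exact ⟨i, rfl, rfl, hi⟩
  | tensor s t hs ht =>
    rcases List.mem_append.1 ha with h | h
    · obtain ⟨r, h⟩ := hs h
      exact ⟨r, .inl h⟩
    · obtain ⟨r, h⟩ := ht h
      exact ⟨_, .inr ⟨r, h, rfl⟩⟩

theorem exists_pos_of_lt (hr : r < w.size ℓ) : ∃ a i, w.Pos ℓ a i r := by
  induction w generalizing r with
  | unit => exact absurd hr (Nat.not_lt_zero _)
  | leaf c => exact ⟨c, r, rfl, rfl, hr⟩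
  | tensor s t hs ht =>
    by_cases h : r < s.size ℓ
    · obtain ⟨a, i, h⟩ := hs h
      exact ⟨a, i, .inl h⟩
    · obtain ⟨a, i, h'⟩ := ht (r := r - s.size ℓ) (by rw [size] at hr; omega)
      exact ⟨a, i, .inr ⟨_, h', by omega⟩⟩

theorem Pos.inj (h : w.Pos ℓ a i r) (h' : w.Pos ℓ b j r) : a = b ∧ i = j := by
  induction w generalizing r with
  | unit => exact h.elim
  | leaf c => exact ⟨h.1.trans h'.1.symm, h.2.1.trans h'.2.1.symm⟩
  | tensor s t hs ht =>
    rcases h with h | ⟨r₁, h, rfl⟩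
    · rcases h' with h' | ⟨r₂, h', rfl⟩
      · exact hs h h'
      · have := h.lt_size
        omega
    · rcases h' with h' | ⟨r₂, h', e⟩
      · have := h'.lt_size
        omega
      · obtain rfl : r₁ = r₂ := Nat.add_left_cancel e
        exact ht h h'

theorem Pos.unique (hw : w.leaves.Nodup) (h : w.Pos ℓ a i r) (h' : w.Pos ℓ a i r') : r = r' := by
  induction w generalizing r r' with
  | unit => exact h.elim
  | leaf c => exact h.2.1.symm.trans h'.2.1
  | tensor s t hs ht =>
    have hd := List.disjoint_of_nodup_append hw
    rcases h with h | ⟨r₁, h, rfl⟩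
    · rcases h' with h' | ⟨r₂, h', rfl⟩
      · exact hs (List.Nodup.of_append_left hw) h h'
      · exact (hd h.mem h'.mem).elim
    · rcases h' with h' | ⟨r₂, h', rfl⟩
      · exact (hd h'.mem h.mem).elim
      · rw [ht (List.Nodup.of_append_right hw) h h']

theorem size_bind (w : Word α) (g : α → Word β) (ℓ : β → ℕ) :
    (w.bind g).size ℓ = w.size fun a => (g a).size ℓ := by
  induction w with
  | unit => rfl
  | leaf a => rfl
  | tensor s t hs ht => exact congrArg₂ (· + ·) hs ht

/-- Positions nest: position `i` within the block of `a` is found inside that block after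
substitution. -/
theorem Pos.bind {ℓ : β → ℕ} {g : α → Word β} {b : β}
    (h : w.Pos (fun a => (g a).size ℓ) a i r) (h' : (g a).Pos ℓ b j i) :
    (w.bind g).Pos ℓ b j r := by
  induction w generalizing r with
  | unit => exact h.elim
  | leaf c =>
    obtain ⟨rfl, rfl, -⟩ := h
    exact h'
  | tensor s t hs ht =>
    rcases h with h | ⟨r', h, rfl⟩
    · exact .inl (hs h)
    · exact .inr ⟨r', ht h, by rw [size_bind]⟩

theorem Pos.map {ℓ : β → ℕ} {e : α → β} (h : w.Pos (fun a => ℓ (e a)) a i r) :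
    (w.map e).Pos ℓ (e a) i r :=
  Pos.bind (g := fun a => leaf (e a)) h ⟨rfl, rfl, h.lt⟩

theorem pos_std (n : ℕ) (l : Fin n → α) (hl : ∀ k, ℓ (l k) = 1) :
    (std n l).size ℓ = n ∧ ∀ k, (std n l).Pos ℓ (l k) 0 k := by
  induction n with
  | zero => exact ⟨rfl, fun k => k.elim0⟩
  | succ n ih =>
    cases n with
    | zero =>
      refine ⟨hl 0, fun k => ?_⟩
      obtain rfl : k = 0 := Fin.fin_one_eq_zero k
      exact ⟨rfl, rfl, by rw [hl]; exact Nat.one_pos⟩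
    | succ n =>
      obtain ⟨h₁, h₂⟩ := ih (fun i => l i.castSucc) fun k => hl _
      refine ⟨congrArg₂ (· + ·) h₁ (hl _), fun k => ?_⟩
      induction k using Fin.lastCases with
      | last => exact .inr ⟨0, ⟨rfl, rfl, by rw [hl]; exact Nat.one_pos⟩, by rw [h₁]; rfl⟩
      | cast k => exact .inl (h₂ k)

end Word

/-! ### Canonical morphisms in the generated symmetric monoidal category -/

section Carries

open FreeHom

variable (hL : FreeLaws.{u, v}) (M : Multicat.{u, v})

variable {hL M} in
/-- The length of a tuple. -/
def len (x : (free hL).obj M) : ℕ :=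
  Sigma.fst (x : FreeObj M.toMultiData)

variable {hL M} {α β γ : Type}

theorem len_eval (w : Word α) (X : α → (free hL).obj M) :
    len (w.eval X) = w.size fun a => len (X a) := by
  induction w with
  | unit => rfl
  | leaf a => rfl
  | tensor s t hs ht => exact congrArg₂ (· + ·) hs ht

/-- The entry `r` of `x` goes to the entry `s` of `y` without change, and nothing else does. -/
def MovesTo {x y : (free hL).obj M} (φ : x ⟶ y) (r s : ℕ) : Prop :=
  ∃ (hr : r < len x) (hs : s < len y), Moves (M := M.toMultiData) φ ⟨r, hr⟩ ⟨s, hs⟩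

/-- The morphism `φ` between products of tuples only permutes entries, and it takes the entries
that belong to the letter `a` to those that belong to `e a`. -/
def Carries (w : Word α) (w' : Word β) (e : α → β) {X : α → (free hL).obj M}
    {Z : β → (free hL).obj M} (φ : w.eval X ⟶ w'.eval Z) : Prop :=
  ∀ s, s < len (w'.eval Z) → ∃ r, MovesTo φ r s ∧ ∃ a i,
    w.Pos (fun a => len (X a)) a i r ∧ w'.Pos (fun b => len (Z b)) (e a) i s

theorem MovesTo.comp {x y z : (free hL).obj M} {φ : x ⟶ y} {ψ : y ⟶ z} {r s t : ℕ}
    (h : MovesTo φ r s) (h' : MovesTo ψ s t) : MovesTo (φ ≫ ψ) r t := by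
  obtain ⟨hr, hs, h⟩ := h
  obtain ⟨hs', ht, h'⟩ := h'
  exact ⟨hr, ht, h.comp M.laws h'⟩

theorem MovesTo.tensor_left {x y x' y' : (free hL).obj M} {φ : x ⟶ y} {r s : ℕ}
    (h : MovesTo φ r s) (ψ : x' ⟶ y') : MovesTo (φ ⊗ₘ ψ) r s := by
  obtain ⟨hr, hs, h⟩ := h
  exact ⟨_, _, h.tensor_left M.laws ψ⟩

theorem MovesTo.tensor_right {x y x' y' : (free hL).obj M} (φ : x ⟶ y) {ψ : x' ⟶ y'} {r s : ℕ}
    (h : MovesTo ψ r s) : MovesTo (φ ⊗ₘ ψ) (len x + r) (len y + s) := by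
  obtain ⟨hr, hs, h⟩ := h
  exact ⟨_, _, h.tensor_right M.laws φ⟩

theorem movesTo_id (x : (free hL).obj M) {r : ℕ} (hr : r < len x) : MovesTo (𝟙 x) r r :=
  ⟨hr, hr, moves_id M.laws _ _⟩

theorem movesTo_eqToHom {x y : (free hL).obj M} (h : x = y) {r : ℕ} (hr : r < len y) :
    MovesTo (eqToHom h) r r :=
  ⟨h ▸ hr, hr, moves_eqToHom hL M h rfl⟩

theorem Carries.comp {w : Word α} {w' : Word β} {w'' : Word γ} {e : α → β} {e' : β → γ}
    {X : α → (free hL).obj M} {Y : β → (free hL).obj M} {Z : γ → (free hL).obj M}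
    {φ : w.eval X ⟶ w'.eval Y} {ψ : w'.eval Y ⟶ w''.eval Z} (h : Carries w w' e φ)
    (h' : Carries w' w'' e' ψ) : Carries w w'' (fun a => e' (e a)) (φ ≫ ψ) := by
  intro t ht
  obtain ⟨s, h₁, b, i, hb, hc⟩ := h' t ht
  obtain ⟨r, h₂, a, j, ha, hb'⟩ := h s (by rw [len_eval]; exact hb.lt_size)
  obtain ⟨rfl, rfl⟩ := hb.inj hb'
  exact ⟨r, h₂.comp h₁, a, i, ha, hc⟩

theorem Carries.tensor {w v : Word α} {w' v' : Word β} {e : α → β}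
    {X : α → (free hL).obj M} {Z : β → (free hL).obj M}
    {φ : w.eval X ⟶ w'.eval Z} {ψ : v.eval X ⟶ v'.eval Z} (h : Carries w w' e φ)
    (h' : Carries v v' e ψ) : Carries (.tensor w v) (.tensor w' v') e (φ ⊗ₘ ψ) := by
  intro s hs
  by_cases hs' : s < len (w'.eval Z)
  · obtain ⟨r, h₁, a, i, ha, hb⟩ := h s hs'
    exact ⟨r, h₁.tensor_left ψ, a, i, .inl ha, .inl hb⟩
  · obtain ⟨s, rfl⟩ := Nat.exists_eq_add_of_le (Nat.le_of_not_lt hs')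
    obtain ⟨r, h₁, a, i, ha, hb⟩ := h' s (Nat.lt_of_add_lt_add_left hs)
    exact ⟨_, h₁.tensor_right φ, a, i, .inr ⟨r, ha, by rw [len_eval]⟩,
      .inr ⟨s, hb, by rw [len_eval]⟩⟩

/-- The morphism `φ` does not move any entries. -/
def Rigid {x y : (free hL).obj M} (φ : x ⟶ y) : Prop :=
  len x = len y ∧ ∀ s, s < len y → MovesTo φ s s

theorem rigid_of_moves {x y : (free hL).obj M} {φ : x ⟶ y} (h : len x = len y)
    (hφ : ∀ (r : Fin (len x)) (s : Fin (len y)), r.val = s.val →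
      Moves (M := M.toMultiData) φ r s) : Rigid φ :=
  ⟨h, fun s hs => ⟨h ▸ hs, hs, hφ _ _ rfl⟩⟩

theorem Rigid.comp {x y z : (free hL).obj M} {φ : x ⟶ y} {ψ : y ⟶ z} (h : Rigid φ) (h' : Rigid ψ) :
    Rigid (φ ≫ ψ) :=
  ⟨h.1.trans h'.1, fun s hs => (h.2 s (h'.1 ▸ hs)).comp (h'.2 s hs)⟩

theorem Rigid.tensor {x y x' y' : (free hL).obj M} {φ : x ⟶ y} {ψ : x' ⟶ y'} (h : Rigid φ)
    (h' : Rigid ψ) : Rigid (φ ⊗ₘ ψ) := by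
  refine ⟨congrArg₂ (· + ·) h.1 h'.1, fun s hs => ?_⟩
  by_cases hs' : s < len y
  · exact (h.2 s hs').tensor_left ψ
  · obtain ⟨s, rfl⟩ := Nat.exists_eq_add_of_le (Nat.le_of_not_lt hs')
    have := (h'.2 s (Nat.lt_of_add_lt_add_left hs)).tensor_right φ
    rwa [h.1] at this

theorem rigid_id (x : (free hL).obj M) : Rigid (𝟙 x) :=
  ⟨rfl, fun _ hs => movesTo_id x hs⟩

theorem rigid_eqToHom {x y : (free hL).obj M} (h : x = y) : Rigid (eqToHom h) :=
  ⟨congrArg len h, fun _ hs => movesTo_eqToHom h hs⟩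

theorem rigid_evalMap (w : Word α) {X Z : α → (free hL).obj M} {f : ∀ a, X a ⟶ Z a}
    (hf : ∀ a, Rigid (f a)) : Rigid (w.evalMap f) := by
  induction w with
  | unit => exact rigid_id _
  | leaf a => exact hf a
  | tensor s t hs ht => exact hs.tensor ht

theorem rigid_bindIso_hom (w : Word α) (g : α → Word β) (Z : β → (free hL).obj M) :
    Rigid (w.bindIso g Z).hom := by
  induction w with
  | unit => exact rigid_id _
  | leaf a => exact rigid_id _
  | tensor s t hs ht => exact hs.tensor ht

theorem rigid_bindIso_inv (w : Word α) (g : α → Word β) (Z : β → (free hL).obj M) :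
    Rigid (w.bindIso g Z).inv := by
  induction w with
  | unit => exact rigid_id _
  | leaf a => exact rigid_id _
  | tensor s t hs ht => exact hs.tensor ht

theorem Rigid.carries {w : Word α} {w' : Word β} {e : α → β} {X : α → (free hL).obj M}
    {Z : β → (free hL).obj M} {φ : w.eval X ⟶ w'.eval Z} (h : Rigid φ)
    (hw : ∀ a i r, w.Pos (fun a => len (X a)) a i r → w'.Pos (fun b => len (Z b)) (e a) i r) :
    Carries w w' e φ := by
  intro s hs
  have hs' : s < w.size fun a => len (X a) := by rwa [← len_eval, h.1]
  obtain ⟨a, i, hp⟩ := Word.exists_pos_of_lt hs'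
  exact ⟨s, h.2 s hs, a, i, hp, hw a i s hp⟩

/-- Associators and unitors do not move entries, so for them only the bookkeeping of blocks is
checked; the braiding exchanges two blocks. -/
theorem carries_path {w w' : Word α} (p : Word.Path w w') (X : α → (free hL).obj M) :
    Carries w w' (fun a => a) (p.eval X) := by
  induction p with
  | id s => exact (rigid_id _).carries fun _ _ _ h => h
  | comp p q hp hq => exact hp.comp hq
  | tensor p q hp hq => exact hp.tensor hq
  | assoc r s t =>
    refine (rigid_of_moves (Nat.add_assoc _ _ _) fun _ _ h => moves_assoc M.laws h).carries ?_
    rintro a i q ((h | ⟨q, h, rfl⟩) | ⟨q, h, rfl⟩)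
    · exact .inl h
    · exact .inr ⟨q, .inl h, rfl⟩
    · exact .inr ⟨_, .inr ⟨q, h, rfl⟩, Nat.add_assoc _ _ _⟩
  | assocInv r s t =>
    refine (rigid_of_moves (Nat.add_assoc _ _ _).symm fun _ _ h =>
      moves_assocInv M.laws h).carries ?_
    rintro a i q (h | ⟨_, (h | ⟨q, h, rfl⟩), rfl⟩)
    · exact .inl (.inl h)
    · exact .inl (.inr ⟨_, h, rfl⟩)
    · exact .inr ⟨q, h, (Nat.add_assoc _ _ _).symm⟩
  | left s =>
    refine (rigid_of_moves (Nat.zero_add _) fun _ _ h => moves_left M.laws h).carries ?_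
    rintro a i q (h | ⟨q, h, rfl⟩)
    · exact h.elim
    · rwa [Word.size, Nat.zero_add]
  | leftInv s =>
    refine (rigid_of_moves (Nat.zero_add _).symm fun _ _ h => moves_leftInv M.laws h).carries ?_
    exact fun a i q h => .inr ⟨q, h, (Nat.zero_add _).symm⟩
  | right s =>
    refine (rigid_of_moves (by exact Nat.add_zero _) fun _ _ h =>
      moves_right M.laws (by exact h)).carries ?_
    rintro a i q (h | ⟨q, h, rfl⟩)
    · exact h
    · exact h.elim
  | rightInv s =>
    refine (rigid_of_moves (by exact (Nat.add_zero _).symm) fun _ _ h =>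
      moves_rightInv M.laws (by exact h)).carries ?_
    exact fun a i q h => .inl h
  | braid s t =>
    intro q hq
    by_cases hq' : q < len (t.eval X)
    · obtain ⟨a, i, h⟩ := Word.exists_pos_of_lt (len_eval t X ▸ hq')
      refine ⟨len (s.eval X) + q, ⟨Nat.add_lt_add_left hq' _, hq,
        moves_braid_right M.laws ⟨q, hq'⟩⟩, a, i,
        .inr ⟨q, h, by rw [len_eval]⟩, .inl h⟩
    · obtain ⟨q, rfl⟩ := Nat.exists_eq_add_of_le (Nat.le_of_not_lt hq')
      have hq : q < len (s.eval X) := Nat.lt_of_add_lt_add_left hq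
      obtain ⟨a, i, h⟩ := Word.exists_pos_of_lt (len_eval s X ▸ hq)
      exact ⟨q, ⟨_, _, moves_braid_left M.laws ⟨q, hq⟩⟩, a, i, .inl h,
        .inr ⟨q, h, by rw [len_eval]⟩⟩

/-- Holds for whichever path `canon` has chosen, because every path carries blocks to blocks with
the same letter. This makes canonical maps in `L M` explicit. -/
theorem carries_canon (w : LinWord α) (w' : LinWord β) (e : α ≃ β) {X : α → (free hL).obj M}
    {Z : β → (free hL).obj M} (h : ∀ a, X a = Z (e a)) :
    Carries w.word w'.word e (w.canon w' e h) := by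
  obtain rfl : X = fun a => Z (e a) := funext h
  have h₁ : Carries w.word w.word (fun a => a) (w.word.evalMap fun a => eqToHom (h a)) :=
    (rigid_evalMap _ fun a => rigid_eqToHom (h a)).carries fun _ _ _ h => h
  have h₂ : Carries w.word (w.word.map e) e (w.word.mapIso e Z).inv :=
    (rigid_bindIso_inv _ _ _).carries fun _ _ _ h => h.map
  exact h₁.comp (h₂.comp (carries_path _ _))

/-- A block position determines its letter and index; as `e` is injective and a letter occurs at
most once, the origin of an entry is determined as well. -/
theorem Carries.movesTo {w : Word α} {w' : Word β} {e : α → β} {X : α → (free hL).obj M}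
    {Z : β → (free hL).obj M} {φ : w.eval X ⟶ w'.eval Z} (h : Carries w w' e φ)
    (hw : w.leaves.Nodup) (he : Function.Injective e) {a : α} {i r s : ℕ}
    (hr : w.Pos (fun a => len (X a)) a i r) (hs : w'.Pos (fun b => len (Z b)) (e a) i s) :
    MovesTo φ r s := by
  obtain ⟨r', h', b, j, hb, hb'⟩ := h s (by rw [len_eval]; exact hs.lt_size)
  obtain ⟨e', rfl⟩ := hb'.inj hs
  obtain rfl := he e'
  rwa [hr.unique hw hb]

/-- The multimorphism of `φ` at the entry `s` of the target is `v`, if the entries of the source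
that go there are enumerated by `e`. -/
def ValueAt {x y : (free hL).obj M} (φ : x ⟶ y) (s : ℕ) {n : ℕ} {a : Fin n → M.Obj} {b : M.Obj}
    (e : Fin n → ℕ) (v : M.Hom a b) : Prop :=
  ∃ (hs : s < len y) (he : ∀ k, e k < len x),
    IsAt (M := M.toMultiData) φ ⟨s, hs⟩ (fun k => ⟨e k, he k⟩) v

section ValueAt

variable {x y z : (free hL).obj M} {n : ℕ} {a : Fin n → M.Obj} {b : M.Obj} {e : Fin n → ℕ}
  {v : M.Hom a b} {s t : ℕ}

theorem ValueAt.moves_comp {φ : x ⟶ y} {ψ : y ⟶ z} (h : ValueAt ψ t e v) {e' : Fin n → ℕ}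
    (h' : ∀ k, MovesTo φ (e' k) (e k)) : ValueAt (φ ≫ ψ) t e' v := by
  obtain ⟨hs, he, h⟩ := h
  exact ⟨hs, fun k => (h' k).1, IsAt.moves_comp M.laws h fun k => (h' k).2.2⟩

theorem Rigid.valueAt_comp {φ : x ⟶ y} {ψ : y ⟶ z} (h : Rigid φ) (h' : ValueAt ψ t e v) :
    ValueAt (φ ≫ ψ) t e v :=
  h'.moves_comp fun k => h.2 _ (h'.2.1 k)

theorem ValueAt.comp {φ : x ⟶ y} {ψ : y ⟶ z} (h : ValueAt ψ t e v) {j : Fin n → ℕ}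
    {a' : ∀ k, Fin (j k) → M.Obj} {v' : ∀ k, M.Hom (a' k) (a k)} {e' : ∀ k, Fin (j k) → ℕ}
    (h' : ∀ k, ValueAt φ (e k) (e' k) (v' k)) :
    ValueAt (φ ≫ ψ) t (concat e') (M.comp v v') := by
  obtain ⟨hs, he, h⟩ := h
  exact ⟨hs, fun k => (h' _).2.1 _, IsAt.comp M.laws h fun k => (h' k).2.2⟩

theorem ValueAt.perm {φ : x ⟶ y} (h : ValueAt φ s e v) {m : ℕ} {a' : Fin m → M.Obj}
    (τ : Fin m ≃ Fin n) (hτ : ∀ i, a' i = a (τ i)) :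
    ValueAt φ s (fun k => e (τ k)) (M.perm τ hτ v) := by
  obtain ⟨hs, he, h⟩ := h
  exact ⟨hs, fun k => he _, h.perm M.laws τ hτ⟩

theorem ValueAt.tensor_left {x' y' : (free hL).obj M} {φ : x ⟶ y} (h : ValueAt φ s e v)
    (ψ : x' ⟶ y') : ValueAt (φ ⊗ₘ ψ) s e v := by
  obtain ⟨hs, he, h⟩ := h
  exact ⟨_, _, h.tensor_left M.laws ψ⟩

theorem ValueAt.tensor_right {x' y' : (free hL).obj M} {φ : x ⟶ y} (ψ : x' ⟶ y')
    (h : ValueAt φ s e v) : ValueAt (ψ ⊗ₘ φ) (len y' + s) (fun k => len x' + e k) v := by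
  obtain ⟨hs, he, h⟩ := h
  exact ⟨_, _, h.tensor_right M.laws ψ⟩

/-- A product of morphisms acts block by block, so the component over an entry in the block of `c`
is the component of `f c`, its inputs lying in the corresponding source block. -/
theorem valueAt_evalMap (w : Word α) {X Y : α → (free hL).obj M} (f : ∀ c, X c ⟶ Y c) {c : α}
    (h : ValueAt (f c) s e v) (hc : w.Pos (fun c => len (Y c)) c s t) :
    ∃ e', ValueAt (w.evalMap f) t e' v ∧
      ∀ k, w.Pos (fun c => len (X c)) c (e k) (e' k) := by
  induction w generalizing t with
  | unit => exact hc.elim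
  | leaf c =>
    obtain ⟨rfl, rfl, -⟩ := hc
    exact ⟨e, h, fun k => ⟨rfl, rfl, h.2.1 k⟩⟩
  | tensor p q hp hq =>
    rcases hc with hc | ⟨t, hc, rfl⟩
    · obtain ⟨e', h₁, h₂⟩ := hp hc
      exact ⟨e', h₁.tensor_left _, fun k => .inl (h₂ k)⟩
    · obtain ⟨e', h₁, h₂⟩ := hq hc
      refine ⟨_, ?_, fun k => .inr ⟨e' k, h₂ k, rfl⟩⟩
      rw [← len_eval, ← len_eval]
      exact h₁.tensor_right _

theorem valueAt_subMap {γ : β → Type} (w : LinWord β) (g : ∀ b, LinWord (γ b))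
    {Z : (Σ b, γ b) → (free hL).obj M} {Y : β → (free hL).obj M}
    (φ : ∀ b, (g b).eval (fun c => Z ⟨b, c⟩) ⟶ Y b) {c : β} (h : ValueAt (φ c) s e v)
    (hc : w.word.Pos (fun b => len (Y b)) c s t) :
    ∃ e', ValueAt (w.subMap g φ) t e' v ∧ ∀ k d i,
      (g c).word.Pos (fun d => len (Z ⟨c, d⟩)) d i (e k) →
        (w.sub g).word.Pos (fun p => len (Z p)) ⟨c, d⟩ i (e' k) := by
  obtain ⟨e', h₁, h₂⟩ := valueAt_evalMap w.word
    (fun b => ((g b).word.mapIso (Sigma.mk b) Z).hom ≫ φ b)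
    ((rigid_bindIso_hom (g c).word _ Z).valueAt_comp h) hc
  refine ⟨e', (rigid_bindIso_hom w.word _ Z).valueAt_comp h₁, fun k d i hd => ?_⟩
  refine Word.Pos.bind (i := e k) ?_ (hd.map (e := Sigma.mk c) (ℓ := fun p => len (Z p)))
  have := h₂ k
  simp only [len_eval] at this
  exact this

end ValueAt

end Carries

/-! ### The unit -/

section UnitLaws

open FreeHom

variable {hL : FreeLaws.{u, v}} {M : Multicat.{u, v}}

/-- The morphism `φ` from a product of tuples of length one to a tuple of length one is given by
the multimorphism `v`. -/
def Represents {n : ℕ} (w : LinWord (Fin n)) {X : Fin n → (free hL).obj M} {z : (free hL).obj M}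
    {a : Fin n → M.Obj} {b : M.Obj} (φ : w.eval X ⟶ z) (v : M.Hom a b) : Prop :=
  ∃ e : Fin n → ℕ, ValueAt φ 0 e v ∧ ∀ k, w.word.Pos (fun k => len (X k)) k 0 (e k)

/-- The target has a single entry, and the position of each letter in a linear word is unique, so
both morphisms have the same only component with the same enumeration. -/
theorem Represents.eq {n : ℕ} {w : LinWord (Fin n)} {X : Fin n → (free hL).obj M}
    {z : (free hL).obj M} (hz : len z = 1) {a : Fin n → M.Obj} {b : M.Obj} {φ ψ : w.eval X ⟶ z}
    {v : M.Hom a b} (h : Represents w φ v) (h' : Represents w ψ v) : φ = ψ := by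
  obtain ⟨e, ⟨hs, he, hφ⟩, hp⟩ := h
  obtain ⟨e', ⟨hs', he', hψ⟩, hp'⟩ := h'
  obtain rfl : e = e' := funext fun k => (hp k).unique w.nodup (hp' k)
  refine ext_isAt M.laws fun s => ?_
  obtain rfl : s = ⟨0, hs⟩ := Fin.ext (by have : s.val < len z := s.2; change s.val = 0; omega)
  exact ⟨_, _, _, _, v, hφ, hψ⟩

theorem represents_canon_comp {m n : ℕ} {w : LinWord (Fin n)} {w' : LinWord (Fin m)}
    (σ : Fin n ≃ Fin m) {X : Fin n → (free hL).obj M} {Z : Fin m → (free hL).obj M}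
    {z : (free hL).obj M} {a : Fin m → M.Obj} {a' : Fin n → M.Obj} {b : M.Obj} {φ : w'.eval Z ⟶ z}
    {v : M.Hom a b} (h : ∀ k, X k = Z (σ k)) (h' : ∀ k, a' k = a (σ k)) (hφ : Represents w' φ v) :
    Represents w (w.canon w' σ h ≫ φ) (M.perm σ h' v) := by
  obtain ⟨e, hv, hp⟩ := hφ
  choose e' he' using fun k => Word.exists_pos (ℓ := fun k => len (X k)) (w.mem k)
    (show 0 < len (X k) by rw [h k]; exact (hp (σ k)).lt)
  exact ⟨e', (hv.perm σ h').moves_comp fun k => (carries_canon w w' σ h).movesTo w.nodup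
    σ.injective (he' k) (hp (σ k)), he'⟩

/-- Composition in `U L M` matches composition in `M`: the component of the substituted word is
found by `valueAt_subMap`, and the canonical map in front only rearranges its inputs. -/
theorem represents_operad {n : ℕ} {j : Fin n → ℕ} {X : ∀ s, Fin (j s) → (free hL).obj M}
    {Y : Fin n → (free hL).obj M} {z : (free hL).obj M} {a : ∀ s, Fin (j s) → M.Obj}
    {a' : Fin n → M.Obj} {b : M.Obj} {w : LinWord (Fin n)} {g : ∀ s, LinWord (Fin (j s))}
    {u : LinWord (Fin (∑ s, j s))} {φ : ∀ s, (g s).eval (X s) ⟶ Y s} {ψ : w.eval Y ⟶ z}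
    {v : M.Hom a' b} {v' : ∀ s, M.Hom (a s) (a' s)} (hψ : Represents w ψ v)
    (hφ : ∀ s, Represents (g s) (φ s) (v' s)) :
    Represents u (u.canon (w.sub g) finSigmaFinEquiv.symm (X := concat X)
      (Z := fun p => X p.1 p.2) (fun _ => rfl) ≫ w.subMap g φ ≫ ψ) (M.comp v v') := by
  obtain ⟨e, hv, hp⟩ := hψ
  choose e₁ hv₁ hp₁ using hφ
  choose e₂ hv₂ hp₂ using fun s => valueAt_subMap w g (Z := fun p => X p.1 p.2) φ (hv₁ s) (hp s)
  have hp₃ (k) : (w.sub g).word.Pos (fun p => len (X p.1 p.2)) (finSigmaFinEquiv.symm k) 0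
      (concat e₂ k) := hp₂ _ _ _ _ (hp₁ _ _)
  choose e₃ hp₄ using fun k => Word.exists_pos (ℓ := fun k => len (concat X k)) (u.mem k) (hp₃ k).lt
  exact ⟨e₃, (hv.comp hv₂).moves_comp fun k => (carries_canon u (w.sub g) finSigmaFinEquiv.symm
    _).movesTo u.nodup finSigmaFinEquiv.symm.injective (hp₄ k) (hp₃ k), hp₄⟩

variable (hL) in
/-- The tuple of length one. -/
abbrev single (x : M.Obj) : (free hL).obj M :=
  (⟨1, fun _ => x⟩ : FreeObj M.toMultiData)

theorem represents_unitData (κ : Choices.{u, v}) {n : ℕ} {x : Fin n → M.Obj} {y : M.Obj}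
    (φ : M.Hom x y) : Represents (κ ((free hL).obj M) n fun i => single hL (x i))
      ((unitData κ hL M).map φ) φ := by
  have h : Represents (LinWord.std n) (X := fun i => single hL (x i))
      (eqToHom (eval_std_single hL M n (_root_.id : Fin n → Fin n)
          (fun i => single hL (x i)) x fun _ => rfl) ≫
        (FreeHom.ofMulti φ : FreeHom M.toMultiData _ _)) φ := by
    refine ⟨fun k => k, ?_, (Word.pos_std (ℓ := fun _ => 1) n _ fun _ => rfl).2⟩
    exact (rigid_eqToHom _).valueAt_comp
      ⟨Nat.one_pos, fun k => k.2, isAt_ofMulti M.laws φ⟩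
  have h' := represents_canon_comp (w := κ ((free hL).obj M) n fun i => single hL (x i))
    (Equiv.refl _) (fun _ => rfl) (fun _ => rfl) h
  rwa [M.laws.perm_refl] at h'

/-- Both sides of each law represent the same multimorphism. -/
theorem unitData_laws (κ : Choices.{u, v}) (M : Multicat.{u, v}) : (unitData κ hL M).Laws where
  map_id a := by
    refine (represents_unitData κ (M.id a)).eq rfl ?_
    have h : Represents LinWord.one (X := fun _ : Fin 1 => single hL a) (𝟙 (single hL a))
        (M.id a) :=
      ⟨fun _ => 0, ⟨Nat.one_pos, fun _ => Nat.one_pos, moves_id M.laws _ _⟩,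
        fun k => ⟨Subsingleton.elim _ _, rfl, Nat.one_pos⟩⟩
    have h' := represents_canon_comp (w := κ ((free hL).obj M) 1 fun _ => single hL a)
      (Equiv.refl _) (fun _ => rfl) (fun _ => rfl) h
    rw [M.laws.perm_refl] at h'
    exact (congrArg (fun q => Represents _ q (M.id a)) (Category.comp_id _)).mp h'
  map_perm {m n x x' y} σ h φ :=
    (represents_unitData κ (M.perm σ h φ)).eq rfl
      (represents_canon_comp σ (fun k => by rw [h]) h (represents_unitData κ φ))
  map_comp {n j x y z} ψ φ :=
    (represents_unitData κ (M.comp ψ φ)).eq rfl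
      (represents_operad (X := fun s i => single hL (x s i)) (represents_unitData κ ψ)
        fun s => represents_unitData κ (φ s))

/-- The structure maps of `L F` do not move entries, hence no map built from them does. -/
theorem rigid_lax {N : Multicat.{u, v}} (F : M ⟶ N) {α : Type} (w : Word α)
    (X : α → (free hL).obj M) : Rigid (w.lax ((free hL).map F) X) := by
  induction w with
  | unit => exact rigid_of_moves rfl fun r _ _ => r.elim0
  | leaf a => exact rigid_id _
  | tensor s t hs ht =>
    refine (hs.tensor ht).comp (rigid_of_moves rfl fun r s h => ?_)
    obtain rfl := Fin.ext h
    exact moves_mul _ F.toMultifunctorData _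

theorem ValueAt.map {N : Multicat.{u, v}} (F : M ⟶ N) {x y : (free hL).obj M} {φ : x ⟶ y} {s n : ℕ}
    {a : Fin n → M.Obj} {b : M.Obj} {e : Fin n → ℕ} {v : M.Hom a b} (h : ValueAt φ s e v) :
    ValueAt (((free hL).map F).map φ) s e (F.map v) := by
  obtain ⟨hs, he, h⟩ := h
  exact ⟨hs, he, h.mapMulti F.laws⟩

theorem Multifunctor.eq_of_map {M N : MultiData.{u, v}} (F G : Multifunctor M N)
    (h : F.obj = G.obj) (h' : ∀ {n : ℕ} {x : Fin n → M.Obj} {y : M.Obj} (φ : M.Hom x y),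
      F.map φ = cast (by rw [h]) (G.map φ)) : F = G := by
  obtain ⟨⟨o, m⟩, l⟩ := F
  obtain ⟨⟨o', m'⟩, l'⟩ := G
  dsimp only at h
  subst h
  congr
  funext n x y φ
  exact h' φ

theorem unitLaws (κ : Choices.{u, v}) (hU : UnderlyingLaws κ) (hL : FreeLaws.{u, v}) :
    UnitLaws κ hU hL where
  obj := unitData_laws κ
  natural {M N} F := by
    refine Multifunctor.eq_of_map _ _ rfl fun {n x y} φ => ?_
    refine (represents_unitData κ (F.map φ)).eq rfl ?_
    obtain ⟨e, hv, hp⟩ := represents_unitData (hL := hL) κ φ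
    have h : Represents (κ ((free hL).obj M) n fun i => single hL (x i))
        (Word.lax ((free hL).map F) (κ ((free hL).obj M) n fun i => single hL (x i)).word
          (fun i => single hL (x i)) ≫ ((free hL).map F).map ((unitData κ hL M).map φ)) (F.map φ) :=
      ⟨e, (rigid_lax F _ _).valueAt_comp (hv.map F), hp⟩
    have h' := represents_canon_comp (w := κ ((free hL).obj N) n fun i => single hL (F.obj (x i)))
      (Equiv.refl _) (fun _ => rfl) (fun _ => rfl) h
    rwa [N.laws.perm_refl] at h'

end UnitLaws

/-! ### Substitution identities behind the counit. -/

/-- Functoriality of the counit in terms of words: composing first and evaluating once equals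
evaluating in two stages, by associativity of substitution. -/
theorem LinWord.canon_subMap_comp {α α' β : Type} {C : Type u} [Category.{v} C]
    [MonoidalCategory C] [SymmetricCategory C] {c : β → ℕ} {d : ∀ b, Fin (c b) → ℕ} {X : α → C}
    {Y : α' → C} {Z : ∀ b i, Fin (d b i) → C} {Y' : ∀ b, Fin (c b) → C} {T : β → C}
    (s : LinWord α) (s' : LinWord α') (w : LinWord β) (g : ∀ b, LinWord (Fin (c b)))
    (k : ∀ b i, LinWord (Fin (d b i))) (v : ∀ b, LinWord (Fin (∑ i, d b i)))
    (χ : ∀ b i, (k b i).eval (Z b i) ⟶ Y' b i) (φ : ∀ b, (g b).eval (Y' b) ⟶ T b)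
    (ε : α ≃ Σ b, Fin (∑ i, d b i)) (ε' : α ≃ Σ p : Σ b, Fin (c b), Fin (d p.1 p.2))
    (ρ : (Σ b, Fin (c b)) ≃ α') (hX : ∀ r, X r = concat (Z (ε r).1) (ε r).2)
    (hX' : ∀ r, X r = Z (ε' r).1.1 (ε' r).1.2 (ε' r).2) (hT : ∀ b, T b = T (Equiv.refl β b))
    (hY : ∀ p, Y' p.1 p.2 = Y (ρ p)) (hY' : ∀ r, Y r = Y' (ρ.symm r).1 (ρ.symm r).2)
    (he : ∀ r, (⟨(ε r).1, finSigmaFinEquiv.symm (ε r).2⟩ : Σ b, Σ i, Fin (d b i)) =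
      ⟨(ε' r).1.1, (ε' r).1.2, (ε' r).2⟩) :
    s.canon (w.sub v) ε (Z := fun p => concat (Z p.1) p.2) hX ≫
      w.subMap v (Z := fun p => concat (Z p.1) p.2) (fun b =>
        (v b).canon ((g b).sub (k b)) finSigmaFinEquiv.symm (Z := fun p => Z b p.1 p.2)
          (fun _ => rfl) ≫ (g b).subMap (k b) (χ b) ≫ φ b) ≫ w.canon w (Equiv.refl β) hT =
    (s.canon ((w.sub g).sub fun p => k p.1 p.2) ε' (Z := fun q => Z q.1.1 q.1.2 q.2) hX' ≫
      (w.sub g).subMap (fun p => k p.1 p.2) (Z := fun q => Z q.1.1 q.1.2 q.2)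
        (Y := fun p => Y' p.1 p.2) (fun p => χ p.1 p.2) ≫ (w.sub g).canon s' ρ hY) ≫
      s'.canon (w.sub g) ρ.symm (Z := fun p => Y' p.1 p.2) hY' ≫ w.subMap g φ := by
  have h₁ := subMap_subMap (δ := fun b i => Fin (d b i)) w g (fun p => k p.1 p.2)
    (Z := fun q => Z q.1 q.2.1 q.2.2) (X := fun p => Y' p.1 p.2) (fun p => χ p.1 p.2) φ
  have h₂ := canon_subMap_right w v (fun b => (g b).sub (k b)) (fun _ => finSigmaFinEquiv.symm)
    (X := fun p => concat (Z p.1) p.2) (Z := fun q => Z q.1 q.2.1 q.2.2) (fun _ => rfl)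
    fun b => (g b).subMap (k b) (χ b) ≫ φ b
  refine (congrArg (fun q => _ ≫ _ ≫ q) (canon_refl _ _)).trans ?_
  refine (congrArg (_ ≫ ·) ((Category.comp_id _).trans h₂.symm)).trans ?_
  refine Eq.trans ?_ (Category.assoc _ _ _).symm
  refine Eq.trans ?_ (congrArg (_ ≫ ·) (Category.assoc _ _ _).symm)
  refine Eq.trans ?_ (congrArg (fun q => _ ≫ _ ≫ q) (Category.assoc _ _ _))
  -- The detour through the intermediate product `s'` cancels.
  refine Eq.trans ?_ (congrArg (fun q => _ ≫ _ ≫ q ≫ _) (canon_canon_symm _ _ _ _ _).symm)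
  refine Eq.trans ?_ (congrArg (fun q => _ ≫ _ ≫ q) (Category.id_comp _).symm)
  refine Eq.trans ?_ (congrArg (_ ≫ ·) h₁.symm)
  refine comp_eq_comp_assoc ?_ _
  exact canon_square _ _ _ _ _ _ _ _ he

/-- Sorting by fibres and multiplying does not depend on how the fibres and the targets are indexed,
nor on the words used for them: naturality of substitution plus coherence. -/
theorem LinWord.canon_subMap_eq {α β β' : Type} {C : Type u} [Category.{v} C]
    [MonoidalCategory C] [SymmetricCategory C] {γ : β → Type} {γ' : β' → Type} {X : α → C}
    {Z : ∀ b, γ b → C} {Z' : ∀ b, γ' b → C} {Y : β → C} {Y' : β' → C} (s : LinWord α)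
    (w' : LinWord β') (w : LinWord β) (g' : ∀ b, LinWord (γ' b)) (g : ∀ b, LinWord (γ b))
    (φ : ∀ b, (g' b).eval (Z' b) ⟶ Y' b) (ε' : α ≃ Σ b, γ' b) (ε : α ≃ Σ b, γ b) (ρ : β ≃ β')
    (σ : ∀ b, γ b ≃ γ' (ρ b)) (hX' : ∀ r, X r = Z' (ε' r).1 (ε' r).2)
    (hX : ∀ r, X r = Z (ε r).1 (ε r).2) (hZ : ∀ b k, Z b k = Z' (ρ b) (σ b k))
    (hY : ∀ b, Y b = Y' (ρ b)) (v : ∀ b, (g b).eval (Z b) ⟶ Y b)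
    (hv : ∀ b, v b ≫ eqToHom (hY b) = (g b).canon (g' (ρ b)) (σ b) (hZ b) ≫ φ (ρ b))
    (he : ∀ r, (⟨ρ (ε r).1, σ _ (ε r).2⟩ : Σ b, γ' b) = ε' r) :
    s.canon (w'.sub g') ε' (Z := fun p => Z' p.1 p.2) hX' ≫
        w'.subMap g' (Z := fun p => Z' p.1 p.2) φ =
      s.canon (w.sub g) ε (Z := fun p => Z p.1 p.2) hX ≫
        w.subMap g (Z := fun p => Z p.1 p.2) v ≫ w.canon w' ρ hY := by
  obtain rfl : Y = fun b => Y' (ρ b) := funext hY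
  obtain rfl : v = fun b => (g b).canon (g' (ρ b)) (σ b) (hZ b) ≫ φ (ρ b) :=
    funext fun b => (Category.comp_id _).symm.trans (hv b)
  have h₁ := shuffle_subMap w w' g g' ρ σ (X := fun p => Z p.1 p.2) (Z := fun p => Z' p.1 p.2)
    (fun p => eqToHom (hZ p.1 p.2)) φ
  refine Eq.trans ?_ (congrArg (_ ≫ ·) h₁)
  refine Eq.trans ?_ (Category.assoc _ _ _)
  exact congrArg (· ≫ _) (canon_comp_eq s (w.sub g) (w'.sub g') (e' := Equiv.sigmaCongr ρ σ) hX
    (fun p => hZ p.1 p.2) hX' he).symm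

/-! ### The counit on morphisms -/

section CounitMap

open LinWord FreeHom

variable (κ : Choices.{u, v}) {C : SymMonCat.{u, v}}

/-- The effect of the counit on morphisms. -/
def counitMap {m n : ℕ} {X : Fin m → C} {Y : Fin n → C}
    (φ : FreeHom (underlyingData κ C) ⟨m, X⟩ ⟨n, Y⟩) : (std m).eval X ⟶ (std n).eval Y :=
  (std m).canon ((std n).sub fun s => κ C _ (fibTuple (O := C) X φ.fn s))
      ((Equiv.sigmaFiberEquiv φ.fn).symm.trans
        (Equiv.sigmaCongrRight fun s => (fibEnum φ.fn s).symm))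
      (Z := fun p => fibTuple (O := C) X φ.fn p.1 p.2)
      (fun r => congrArg X (congrArg Subtype.val
        ((fibEnum φ.fn (φ.fn r)).apply_symm_apply ⟨r, rfl⟩)).symm) ≫
    (std n).subMap (fun s => κ C _ (fibTuple (O := C) X φ.fn s)) φ.mor

variable {κ}

/-- The effect of the counit on a morphism can be computed from arbitrary enumerations of the
fibres. -/
theorem counitMap_eq {m n : ℕ} {X : Fin m → C} {Y : Fin n → C}
    (φ : FreeHom (underlyingData κ C) ⟨m, X⟩ ⟨n, Y⟩) {β : Type} (W : LinWord β) (ρ : β ≃ Fin n)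
    {c : β → ℕ} {Z : ∀ b, Fin (c b) → C} {Y' : β → C} {e : ∀ b, Fin (c b) → Fin m}
    {v : ∀ b, (κ C (c b) (Z b)).eval (Z b) ⟶ Y' b}
    (h : ∀ b, IsAt (M := underlyingData κ C) φ (ρ b) (x' := Z b) (e b) (v b))
    (ε : Fin m ≃ Σ b, Fin (c b)) (hε : ∀ r, e (ε r).1 (ε r).2 = r)
    (hX : ∀ r, X r = Z (ε r).1 (ε r).2) (hY : ∀ b, Y' b = Y (ρ b)) :
    counitMap κ φ = (std m).canon (W.sub fun b => κ C (c b) (Z b)) ε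
        (Z := fun p => Z p.1 p.2) hX ≫
      W.subMap (fun b => κ C (c b) (Z b)) (Z := fun p => Z p.1 p.2) v ≫ W.canon (std n) ρ hY := by
  choose σ he hx hy hv using h
  refine canon_subMap_eq (C := C) (std m) (std n) W (fun s => κ C _ (fibTuple (O := C) X φ.fn s))
    (fun b => κ C (c b) (Z b)) φ.mor _ ε ρ σ _ hX hx hY v ?_ fun r => ?_
  · intro b
    obtain rfl : Y' = fun b => Y (ρ b) := funext hY
    exact (Category.comp_id _).trans (hv b)
  -- Two positions (fibre, place in it) agree as soon as they name the same source index.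
  refine ((Equiv.sigmaFiberEquiv φ.fn).symm.trans
    (Equiv.sigmaCongrRight fun s => (fibEnum φ.fn s).symm)).symm.injective ?_
  rw [Equiv.symm_apply_apply]
  exact (he (ε r).1 (ε r).2).trans (hε r)

/-- The equivalence given by enumerations of all fibres. -/
theorem exists_equiv_of_isAt {M : MultiData.{u, v}} {x y : FreeObj M} {φ : FreeHom M x y}
    {β : Type} (ρ : β ≃ Fin y.1) {c : β → ℕ} {Z : ∀ b, Fin (c b) → M.Obj} {Y' : β → M.Obj}
    {e : ∀ b, Fin (c b) → Fin x.1} {v : ∀ b, M.Hom (Z b) (Y' b)}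
    (h : ∀ b, IsAt φ (ρ b) (e b) (v b)) :
    ∃ ε : Fin x.1 ≃ Σ b, Fin (c b), ∀ r, e (ε r).1 (ε r).2 = r := by
  have hb : Function.Bijective fun p : Σ b, Fin (c b) => e p.1 p.2 := by
    refine ⟨?_, fun r => ?_⟩
    · rintro ⟨b, k⟩ ⟨b', k'⟩ hp
      dsimp only at hp
      obtain rfl : b = b' := ρ.injective (by rw [← (h b).fn_eq k, hp, (h b').fn_eq k'])
      obtain ⟨σ, he, -⟩ := h b
      rw [← he, ← he] at hp
      rw [σ.injective ((fibEnum φ.fn (ρ b)).injective (Subtype.ext hp))]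
    · obtain ⟨k, hk⟩ := (h (ρ.symm (φ.fn r))).exists_eq (r := r) (by simp)
      exact ⟨⟨_, k⟩, hk⟩
  exact ⟨(Equiv.ofBijective _ hb).symm, fun r => (Equiv.ofBijective _ hb).apply_symm_apply r⟩

/-- All fibres are singletons carrying identities, so the counit sends a rearrangement to the
canonical map. This evaluates `ε` on every structure morphism. -/
theorem counitMap_ofEquiv (hC : (underlyingData κ C).Laws) {m n : ℕ} {X : Fin m → C} {Y : Fin n → C}
    (e : Fin m ≃ Fin n) (h : ∀ r, X r = Y (e r)) :
    counitMap κ (FreeHom.ofEquiv (M := underlyingData κ C) (x := ⟨m, X⟩) (y := ⟨n, Y⟩) e h) =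
      (std m).canon (std n) e h := by
  refine (counitMap_eq _ (std n) (Equiv.refl _) (c := fun _ => 1) (Z := fun s _ => Y s)
    (v := fun s => (underlyingData κ C).id (Y s)) (e := fun s _ => e.symm s) (fun s => isAt_ofEquiv (x := ⟨m, X⟩) (y := ⟨n, Y⟩) hC e h (e.apply_symm_apply s))
    (e.trans (Equiv.sigmaUnique (Fin n) fun _ => Fin 1).symm) (fun r => e.symm_apply_apply r) h
    fun _ => rfl).trans ?_
  refine (congrArg (_ ≫ ·) ((congrArg₂ (· ≫ ·) (subMap_canon_one (C := C) (Y := Y) _ _)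
    (canon_refl _ _)).trans (Category.comp_id _))).trans ?_
  exact canon_comp_eq _ _ _ _ _ _ fun _ => rfl

/-- The two factors meet in the left-parenthesized product of `Y`, which has the wrong shape for
associativity of substitution. The freedom in `counitMap_eq` allows grouping the entries of `Y` by
the fibres of `ψ` instead. -/
theorem counitMap_comp (hC : (underlyingData κ C).Laws) {l m n : ℕ} {X : Fin l → C} {Y : Fin m → C}
    {Z : Fin n → C} (φ : FreeHom (underlyingData κ C) ⟨l, X⟩ ⟨m, Y⟩)
    (ψ : FreeHom (underlyingData κ C) ⟨m, Y⟩ ⟨n, Z⟩) :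
    counitMap κ (φ.comp ψ) = counitMap κ φ ≫ counitMap κ ψ := by
  have h₁ := fun t => isAt_mor hC ψ t
  have h₂ := fun s => isAt_mor hC φ s
  have h₃ := fun t => (h₁ t).comp hC fun k => h₂ (fibEnum ψ.fn t k).1
  let ρ : (Σ t, Fin (Finset.univ.filter fun s => ψ.fn s = t).card) ≃ Fin m :=
    ((Equiv.sigmaFiberEquiv ψ.fn).symm.trans
        (Equiv.sigmaCongrRight fun s => (fibEnum ψ.fn s).symm)).symm
  obtain ⟨ε, hε⟩ := exists_equiv_of_isAt (φ := φ.comp ψ) (Equiv.refl (Fin n)) h₃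
  obtain ⟨ε', hε'⟩ := exists_equiv_of_isAt (φ := φ) ρ fun p => h₂ (fibEnum ψ.fn p.1 p.2).1
  -- A nested position is determined by the source index that it names; this reduces the comparison
  -- of the two enumerations to the fact that both name `r`.
  have hi : Function.Injective fun q : Σ p : Σ t, Fin (Finset.univ.filter fun s => ψ.fn s = t).card,
      Fin (Finset.univ.filter fun r => φ.fn r = (fibEnum ψ.fn p.1 p.2).1).card =>
        (fibEnum φ.fn (fibEnum ψ.fn q.1.1 q.1.2).1 q.2).1 := fun q q' hq => by
    obtain ⟨r, rfl⟩ := ε'.surjective q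
    obtain ⟨r', rfl⟩ := ε'.surjective q'
    exact congrArg ε' ((hε' r).symm.trans (hq.trans (hε' r')))
  refine (counitMap_eq (φ.comp ψ) (std n) (Equiv.refl (Fin n)) h₃ ε hε
    (fun r => ?_) fun _ => rfl).trans ?_
  · exact (congrArg X (hε r).symm).trans ((h₃ (ε r).1).source_eq _).symm
  refine Eq.trans ?_ (congrArg (· ≫ _) (counitMap_eq φ ((std n).sub fun s => κ C _
    (fibTuple (O := C) Y ψ.fn s)) ρ (fun p => h₂ (fibEnum ψ.fn p.1 p.2).1) ε' hε'
    (fun r => (congrArg X (hε' r).symm)) fun _ => rfl)).symm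
  refine canon_subMap_comp (C := C) (std l) (std m) (std n) _
    (fun t i => κ C _ (fibTuple (O := C) X φ.fn (fibEnum ψ.fn t i).1)) _
    (fun t i => φ.mor (fibEnum ψ.fn t i).1) ψ.mor ε ε' ρ _ _ _ _ _ fun r => ?_
  refine (Equiv.sigmaAssoc _).symm.injective (hi ?_)
  exact (hε r).trans (hε' r).symm

end CounitMap

/-! ### Products of two words -/

section TensorLemmas

variable {C : Type u} [Category.{v} C] [MonoidalCategory C]

theorem tensor_conj {A A' B B' P P' Q Q' : C} (f : A ⟶ P) (f' : A' ⟶ P') (g : P ⟶ Q)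
    (g' : P' ⟶ Q') (h : Q ⟶ B) (h' : Q' ⟶ B') :
    (f ⊗ₘ f') ≫ (g ⊗ₘ g') ≫ (h ⊗ₘ h') = (f ≫ g ≫ h) ⊗ₘ (f' ≫ g' ≫ h') := by
  simp only [tensorHom_comp_tensorHom]

theorem assoc_conj {A A' A'' B B' B'' P P' Q' Q'' R R' R'' : C} (f : A ⟶ P) (f' : A' ⟶ P')
    (f'' : A'' ⟶ B'') (g : P ⟶ B) (g' : P' ⟶ B') (k : R ≅ B) (k' : Q' ≅ B') (k'' : Q'' ≅ B'')
    (l' : R' ≅ Q') (l'' : R'' ≅ Q'') :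
    ((f ⊗ₘ f') ⊗ₘ f'') ≫ ((g ⊗ₘ g') ⊗ₘ 𝟙 B'') ≫ (α_ B B' B'').hom =
      ((α_ A A' A'').hom ≫ ((f ≫ g ≫ k.inv) ⊗ₘ
        ((f' ≫ g' ≫ k'.inv ≫ l'.inv) ⊗ₘ (f'' ≫ k''.inv ≫ l''.inv)))) ≫
          (k.hom ⊗ₘ (l'.hom ⊗ₘ l''.hom)) ≫ (𝟙 B ⊗ₘ (k'.hom ⊗ₘ k''.hom)) := by
  simp only [Category.assoc, tensorHom_comp_tensorHom, Iso.inv_hom_id, Iso.inv_hom_id_assoc,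
    Category.comp_id]
  rw [tensorHom_comp_tensorHom_assoc, tensorHom_comp_tensorHom, Category.comp_id,
    associator_naturality]

theorem tensor_conj_of_comp {A A' B B' P P' Q Q' R R' S S' : C} (f : A ⟶ P) (f' : A' ⟶ P')
    {g : P ⟶ B} {g' : P' ⟶ B'} {j : P ⟶ Q} {j' : P' ⟶ Q'} {a : Q ⟶ R} {a' : Q' ⟶ R'} {b : R ⟶ S}
    {b' : R' ⟶ S'} {c : S ⟶ B} {c' : S' ⟶ B'} (h : j ≫ a ≫ b ≫ c = g)
    (h' : j' ≫ a' ≫ b' ≫ c' = g') :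
    (f ⊗ₘ f') ≫ (g ⊗ₘ g') =
      ((f ≫ j) ⊗ₘ (f' ≫ j')) ≫ ((a ⊗ₘ a') ≫ (b ⊗ₘ b')) ≫ (c ⊗ₘ c') := by
  subst h h'
  simp only [tensorHom_comp_tensorHom, Category.assoc]

theorem braid_conj [BraidedCategory C] {A A' B B' P P' : C} (f : A ⟶ P) (f' : A' ⟶ P')
    (g : P ⟶ B) (g' : P' ⟶ B') :
    (f ⊗ₘ f') ≫ (β_ P P').hom ≫ (g' ⊗ₘ g) = (β_ A A').hom ≫ ((f' ≫ g') ⊗ₘ (f ≫ g)) := by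
  rw [BraidedCategory.braiding_naturality_assoc, tensorHom_comp_tensorHom]

end TensorLemmas

/-- The map is a canonical map between products of the same objects. -/
def Word.IsStructural {α β : Type} {C : Type u} [Category.{v} C] [MonoidalCategory C]
    [SymmetricCategory C] (w : Word α) (w' : Word β) (e : α → β) (X : α → C) (Z : β → C)
    (m : w.eval X ⟶ w'.eval Z) : Prop :=
  ∃ h : ∀ a, X a = Z (e a), IsCanon w w' e (fun a => eqToHom (h a)) m

namespace Word.IsStructural

variable {α β γ δ : Type} {C : Type u} [Category.{v} C] [MonoidalCategory C]
  [SymmetricCategory C]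

theorem path {w w' : Word α} (p : Path w w') (X : α → C) :
    IsStructural w w' (fun a => a) X X (p.eval X) :=
  ⟨fun _ => rfl, .path p X⟩

theorem id (w : Word α) (X : α → C) : IsStructural w w (fun a => a) X X (𝟙 (w.eval X)) :=
  path (.id w) X

theorem comp {w : Word α} {w' : Word β} {w'' : Word γ} {e : α → β} {e' : β → γ} {X : α → C}
    {Y : β → C} {Z : γ → C} {m : w.eval X ⟶ w'.eval Y} {m' : w'.eval Y ⟶ w''.eval Z}
    (h : IsStructural w w' e X Y m) (h' : IsStructural w' w'' e' Y Z m') :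
    IsStructural w w'' (fun a => e' (e a)) X Z (m ≫ m') := by
  obtain ⟨h₁, h⟩ := h
  obtain ⟨h₂, h'⟩ := h'
  exact ⟨fun a => (h₁ a).trans (h₂ (e a)), (h.comp h').congr (fun _ => rfl) (fun _ => by simp) rfl⟩

theorem tensor {w v : Word α} {w' v' : Word β} {e : α → β} {X : α → C} {Z : β → C}
    {m : w.eval X ⟶ w'.eval Z} {n : v.eval X ⟶ v'.eval Z} (h : IsStructural w w' e X Z m)
    (h' : IsStructural v v' e X Z n) :
    IsStructural (.tensor w v) (.tensor w' v') e X Z (m ⊗ₘ n) :=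
  ⟨h.choose, h.choose_spec.tensor h'.choose_spec⟩

theorem mapIso_inv (w : Word α) (e : α → β) (Z : β → C) :
    IsStructural w (w.map e) e (fun a => Z (e a)) Z (w.mapIso e Z).inv :=
  ⟨fun _ => rfl, .mapIso_inv w e Z⟩

theorem mapIso_comp {w : Word α} {w' : Word γ} {k : α → β} {e : β → γ} {X : β → C} {Z : γ → C}
    {m : w.eval (fun a => X (k a)) ⟶ w'.eval Z} (hX : ∀ b, X b = Z (e b))
    (h : IsStructural w w' (fun a => e (k a)) (fun a => X (k a)) Z m) :
    IsStructural (w.map k) w' e X Z ((w.mapIso k X).hom ≫ m) :=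
  ⟨hX, .mapIso_comp h.choose_spec⟩

end Word.IsStructural

namespace LinWord

variable {α α' β β' γ δ : Type} {C : Type u} [Category.{v} C] [MonoidalCategory C]
  [SymmetricCategory C]

theorem isStructural_canon (w : LinWord α) (w' : LinWord β) (e : α ≃ β) {X : α → C} {Z : β → C}
    (h : ∀ a, X a = Z (e a)) : Word.IsStructural w.word w'.word e X Z (w.canon w' e h) :=
  ⟨h, isCanon_shuffle w w' e _⟩

theorem eq_canon_of_isStructural {w : LinWord α} {w' : LinWord β} {X : α → C} {Z : β → C}
    {e' : α → β} {m : w.eval X ⟶ w'.eval Z} (H : Word.IsStructural w.word w'.word e' X Z m)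
    (e : α ≃ β) (he : ∀ a, e' a = e a) (h : ∀ a, X a = Z (e a)) : m = w.canon w' e h :=
  eq_canon H.choose_spec e he h fun _ => rfl

theorem tensorIso_canon (s : LinWord α) (t : LinWord β) (s' : LinWord α') (t' : LinWord β')
    (e : α ≃ α') (e' : β ≃ β') {X : α → C} {Y : β → C} {X' : α' → C} {Y' : β' → C}
    (h : ∀ a, X a = X' (e a)) (h' : ∀ b, Y b = Y' (e' b))
    (h'' : ∀ a, Sum.elim X Y a = Sum.elim X' Y' (Equiv.sumCongr e e' a)) :
    (s.tensorIso t X Y).hom ≫ (s.canon s' e h ⊗ₘ t.canon t' e' h') =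
      (s.tensor t).canon (s'.tensor t') (Equiv.sumCongr e e') h'' ≫ (s'.tensorIso t' X' Y').hom := by
  rw [← Iso.comp_inv_eq, Category.assoc]
  refine (tensor_conj _ _ _ _ _ _).trans (eq_canon_of_isStructural (w := s.tensor t)
    (w' := s'.tensor t') (.tensor (.mapIso_comp h'' ?_) (.mapIso_comp h'' ?_)) _ (fun _ => rfl) _)
  · exact (isStructural_canon s s' e h).comp
      (.mapIso_inv s'.word Sum.inl (Sum.elim X' Y'))
  · exact (isStructural_canon t t' e' h').comp
      (.mapIso_inv t'.word Sum.inr (Sum.elim X' Y'))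

theorem tensorIso_assoc (s : LinWord α) (t : LinWord β) (r : LinWord γ) (X : α → C) (Y : β → C)
    (Z : γ → C) (h) :
    ((s.tensor t).tensorIso r (Sum.elim X Y) Z).hom ≫ ((s.tensorIso t X Y).hom ⊗ₘ 𝟙 (r.eval Z)) ≫
        (α_ (s.eval X) (t.eval Y) (r.eval Z)).hom =
      ((s.tensor t).tensor r).canon (s.tensor (t.tensor r)) (Equiv.sumAssoc α β γ)
          (X := Sum.elim (Sum.elim X Y) Z) (Z := Sum.elim X (Sum.elim Y Z)) h ≫
        (s.tensorIso (t.tensor r) X (Sum.elim Y Z)).hom ≫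
          (𝟙 (s.eval X) ⊗ₘ (t.tensorIso r Y Z).hom) := by
  refine (assoc_conj _ _ _ _ _ (s.word.mapIso Sum.inl (Sum.elim X (Sum.elim Y Z)))
    (t.word.mapIso Sum.inl (Sum.elim Y Z)) (r.word.mapIso Sum.inr (Sum.elim Y Z))
    ((t.word.map Sum.inl).mapIso Sum.inr (Sum.elim X (Sum.elim Y Z)))
    ((r.word.map Sum.inr).mapIso Sum.inr (Sum.elim X (Sum.elim Y Z)))).trans
    (congrArg (· ≫ _) (eq_canon_of_isStructural (w := (s.tensor t).tensor r)
      (w' := s.tensor (t.tensor r)) (Word.IsStructural.comp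
        (.path (.assoc _ _ _) (Sum.elim (Sum.elim X Y) Z))
        (.tensor (.mapIso_comp h ?_) (.tensor (.mapIso_comp h ?_) (.mapIso_comp h ?_)))) _
          (fun _ => rfl) h))
  · exact .mapIso_comp (fun _ => h _) (.mapIso_inv s.word Sum.inl (Sum.elim X (Sum.elim Y Z)))
  · exact .mapIso_comp (fun _ => h _) ((Word.IsStructural.mapIso_inv t.word Sum.inl
      (Sum.elim Y Z)).comp (.mapIso_inv _ Sum.inr (Sum.elim X (Sum.elim Y Z))))
  · exact (Word.IsStructural.mapIso_inv r.word Sum.inr (Sum.elim Y Z)).comp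
      (.mapIso_inv _ Sum.inr (Sum.elim X (Sum.elim Y Z)))

theorem tensorIso_braid (s : LinWord α) (t : LinWord β) (X : α → C) (Y : β → C) (h) :
    (s.tensorIso t X Y).hom ≫ (β_ (s.eval X) (t.eval Y)).hom =
      (s.tensor t).canon (t.tensor s) (Equiv.sumComm α β) (X := Sum.elim X Y) (Z := Sum.elim Y X)
        h ≫ (t.tensorIso s Y X).hom := by
  rw [← Iso.comp_inv_eq, Category.assoc]
  refine (braid_conj _ _ _ _).trans (eq_canon_of_isStructural (w := s.tensor t) (w' := t.tensor s)
    (Word.IsStructural.comp (.path (.braid _ _) (Sum.elim X Y)) (.tensor (.mapIso_comp h ?_) (.mapIso_comp h ?_))) _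
      (fun _ => rfl) _)
  · exact .mapIso_inv t.word Sum.inl (Sum.elim Y X)
  · exact .mapIso_inv s.word Sum.inr (Sum.elim Y X)

theorem tensorIso_left (t : LinWord β) (X : Fin 0 → C) (Y : β → C) (h) :
    ((std 0).tensorIso t X Y).hom ≫ (λ_ (t.eval Y)).hom =
      ((std 0).tensor t).canon t (Equiv.emptySum (Fin 0) β) (X := Sum.elim X Y) (Z := Y) h := by
  have h₁ : ((std 0).tensorIso t X Y).hom ≫ (λ_ (t.eval Y)).hom =
      (λ_ _).hom ≫ (t.word.mapIso Sum.inr (Sum.elim X Y)).hom ≫ 𝟙 (t.eval Y) :=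
    (leftUnitor_naturality' (t.word.mapIso Sum.inr (Sum.elim X Y)).hom).trans (congrArg (_ ≫ ·) (Category.comp_id _).symm)
  exact h₁.trans (eq_canon_of_isStructural (w := (std 0).tensor t) (w' := t)
    (.comp (.path (.left _) _) (.mapIso_comp h (.id _ _))) _ (fun _ => rfl) _)

theorem tensorIso_right (s : LinWord α) (X : α → C) (Y : Fin 0 → C) (h) :
    (s.tensorIso (std 0) X Y).hom ≫ (ρ_ (s.eval X)).hom =
      (s.tensor (std 0)).canon s (Equiv.sumEmpty α (Fin 0)) (X := Sum.elim X Y) (Z := X) h := by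
  have h₁ : (s.tensorIso (std 0) X Y).hom ≫ (ρ_ (s.eval X)).hom =
      (ρ_ _).hom ≫ (s.word.mapIso Sum.inl (Sum.elim X Y)).hom ≫ 𝟙 (s.eval X) :=
    (rightUnitor_naturality' (s.word.mapIso Sum.inl (Sum.elim X Y)).hom).trans (congrArg (_ ≫ ·) (Category.comp_id _).symm)
  exact h₁.trans (eq_canon_of_isStructural (w := s.tensor (std 0)) (w' := s)
    (.comp (.path (.right _) _) (.mapIso_comp h (.id _ _))) _ (fun _ => rfl) _)

/-- Relabelling before substitution only renames letters, and `J` is this renaming. It is applied to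
the two inclusions into a sum of alphabets. -/
theorem subMap_map {γ : β → Type} {i : α → β} (s : Word α) (G : ∀ b, Word (γ b))
    {Z : (Σ b, γ b) → C} {Y : β → C} (φ : ∀ b, (G b).eval (fun c => Z ⟨b, c⟩) ⟶ Y b) :
    ∃ J : (s.bind fun a => (G (i a)).map (Sigma.mk (β := fun a => γ (i a)) a)).eval
          (fun p : Σ a, γ (i a) => Z ⟨i p.1, p.2⟩) ⟶
        ((s.map i).bind fun b => (G b).map (Sigma.mk b)).eval Z,
      Word.IsStructural _ _ (fun p => ⟨i p.1, p.2⟩) _ _ J ∧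
      J ≫ ((s.map i).bindIso _ Z).hom ≫
        (s.map i).evalMap (fun b => ((G b).mapIso (Sigma.mk b) Z).hom ≫ φ b) ≫
          (s.mapIso i Y).hom =
        (s.bindIso _ _).hom ≫ s.evalMap fun a =>
          ((G (i a)).mapIso (Sigma.mk (β := fun a => γ (i a)) a)
            (fun p : Σ a, γ (i a) => Z ⟨i p.1, p.2⟩)).hom ≫ φ (i a) := by
  refine ⟨(s.bindIso _ _).hom ≫ (s.evalMap (fun a =>
    ((G (i a)).mapIso (Sigma.mk (β := fun a => γ (i a)) a)
      (fun p : Σ a, γ (i a) => Z ⟨i p.1, p.2⟩)).hom ≫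
    ((G (i a)).mapIso (Sigma.mk (i a)) Z).inv) ≫
      (s.mapIso i fun b => ((G b).map (Sigma.mk b)).eval Z).inv) ≫
      ((s.map i).bindIso _ Z).inv, ⟨fun _ => rfl, ?_⟩, ?_⟩
  · refine .bind (φ := fun a =>
      ((G (i a)).mapIso (Sigma.mk (β := fun a => γ (i a)) a)
        (fun p : Σ a, γ (i a) => Z ⟨i p.1, p.2⟩)).hom ≫ ((G (i a)).mapIso (Sigma.mk (i a)) Z).inv)
      (((Word.IsCanon.evalMap s _).comp (.mapIso_inv s i _)).congr (fun _ => rfl)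
        (fun a => ?_) rfl) fun a => ?_
    · simp
    · exact .mapIso_comp (.mapIso_inv _ _ _)
  · simp only [Category.assoc, Iso.inv_hom_id_assoc, Word.evalMap_mapIso]
    simp [Word.evalMap_comp]

/-- Substitution distributes over the product of two words; the canonical map is the tensor product
of the two renamings from `subMap_map`. -/
theorem tensorIso_subMap {γ : α ⊕ β → Type} (s : LinWord α) (t : LinWord β)
    (G : ∀ b, LinWord (γ b)) {Z : (Σ b, γ b) → C} {X : α → C} {Y : β → C}
    (φ : ∀ b, (G b).eval (fun c => Z ⟨b, c⟩) ⟶ Sum.elim X Y b) (h) :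
    ((s.sub fun a => G (.inl a)).tensorIso (t.sub fun b => G (.inr b))
        (fun p => Z ⟨.inl p.1, p.2⟩) (fun p => Z ⟨.inr p.1, p.2⟩)).hom ≫
      (s.subMap (fun a => G (.inl a)) (Z := fun p => Z ⟨.inl p.1, p.2⟩) (fun a => φ (.inl a)) ⊗ₘ
        t.subMap (fun b => G (.inr b)) (Z := fun p => Z ⟨.inr p.1, p.2⟩) (fun b => φ (.inr b))) =
    ((s.sub fun a => G (.inl a)).tensor (t.sub fun b => G (.inr b))).canon ((s.tensor t).sub G)
        (Equiv.sumSigmaDistrib γ).symm h ≫ (s.tensor t).subMap G φ ≫ (s.tensorIso t X Y).hom := by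
  obtain ⟨J, hJ, e⟩ := subMap_map (i := Sum.inl) s.word (fun b => (G b).word) φ
  obtain ⟨J', hJ', e'⟩ := subMap_map (i := Sum.inr) t.word (fun b => (G b).word) φ
  refine (tensor_conj_of_comp _ _ e e').trans (congrArg (· ≫ _) (eq_canon_of_isStructural
    (w := (s.sub fun a => G (.inl a)).tensor (t.sub fun b => G (.inr b)))
    (w' := (s.tensor t).sub G) (.tensor (.mapIso_comp h ?_) (.mapIso_comp h ?_)) _
      (fun _ => rfl) h))
  · exact hJ
  · exact hJ'

/-- The canonical isomorphism from the product of two products to a product of all factors. -/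
def mulMap (s : LinWord α) (t : LinWord β) (w : LinWord γ) (ρ : α ⊕ β ≃ γ) {X : α → C} {Y : β → C}
    {Z : γ → C} (h : ∀ a, Sum.elim X Y a = Z (ρ a)) : s.eval X ⊗ t.eval Y ⟶ w.eval Z :=
  (s.tensorIso t X Y).inv ≫ (s.tensor t).canon w ρ h

theorem tensorIso_mulMap (s : LinWord α) (t : LinWord β) (w : LinWord γ) (ρ : α ⊕ β ≃ γ) {X : α → C}
    {Y : β → C} {Z : γ → C} (h : ∀ a, Sum.elim X Y a = Z (ρ a)) :
    (s.tensorIso t X Y).hom ≫ s.mulMap t w ρ h = (s.tensor t).canon w ρ h :=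
  Iso.hom_inv_id_assoc _ _

theorem isIso_mulMap (s : LinWord α) (t : LinWord β) (w : LinWord γ) (ρ : α ⊕ β ≃ γ) {X : α → C}
    {Y : β → C} {Z : γ → C} (h : ∀ a, Sum.elim X Y a = Z (ρ a)) : IsIso (s.mulMap t w ρ h) := by
  rw [mulMap]
  infer_instance

theorem mulMap_comp_canon (s : LinWord α) (t : LinWord β) (w : LinWord γ) (w' : LinWord δ)
    (ρ : α ⊕ β ≃ γ) (e : γ ≃ δ) (ρ' : α ⊕ β ≃ δ) {X : α → C} {Y : β → C} {Z : γ → C} {Z' : δ → C}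
    (h : ∀ a, Sum.elim X Y a = Z (ρ a)) (he : ∀ c, Z c = Z' (e c))
    (h' : ∀ a, Sum.elim X Y a = Z' (ρ' a)) (hρ : ∀ a, e (ρ a) = ρ' a) :
    s.mulMap t w ρ h ≫ w.canon w' e he = s.mulMap t w' ρ' h' :=
  (Category.assoc _ _ _).trans (congrArg (_ ≫ ·) (canon_comp_eq _ _ _ _ _ _ hρ))

theorem canon_tensor_mulMap (s : LinWord α) (t : LinWord β) (s' : LinWord α') (t' : LinWord β')
    (w : LinWord γ) (e : α ≃ α') (e' : β ≃ β') (ρ : α ⊕ β ≃ γ) (ρ' : α' ⊕ β' ≃ γ) {X : α → C}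
    {Y : β → C} {X' : α' → C} {Y' : β' → C} {Z : γ → C} (hX : ∀ a, X a = X' (e a))
    (hY : ∀ b, Y b = Y' (e' b)) (h : ∀ a, Sum.elim X Y a = Z (ρ a))
    (h' : ∀ a, Sum.elim X' Y' a = Z (ρ' a)) (hρ : ∀ a, ρ' (Sum.map e e' a) = ρ a) :
    (s.canon s' e hX ⊗ₘ t.canon t' e' hY) ≫ s'.mulMap t' w ρ' h' = s.mulMap t w ρ h := by
  have h'' : ∀ a, Sum.elim X Y a = Sum.elim X' Y' (Equiv.sumCongr e e' a) := by
    rintro (a | b)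
    · exact hX a
    · exact hY b
  rw [← cancel_epi (s.tensorIso t X Y).hom, tensorIso_mulMap,
    comp_eq_comp_assoc (tensorIso_canon s t s' t' e e' hX hY h''), tensorIso_mulMap]
  exact canon_comp_eq _ _ _ _ _ _ hρ

/-- After cancelling the isomorphisms that separate the three factors, both sides are canonical
maps, and `he` compares their bijections. -/
theorem mulMap_assoc {ι ι' κ κ' : Type} (s : LinWord α) (t : LinWord β) (r : LinWord γ)
    (p : LinWord ι) (p' : LinWord ι') (q : LinWord κ) (q' : LinWord κ') (ρ : α ⊕ β ≃ ι)
    (ρ' : β ⊕ γ ≃ ι') (σ : ι ⊕ γ ≃ κ) (σ' : α ⊕ ι' ≃ κ') (e : κ ≃ κ') {X : α → C} {Y : β → C}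
    {Z : γ → C} {P : ι → C} {P' : ι' → C} {Q : κ → C} {Q' : κ' → C} (h₁ : ∀ a, Sum.elim X Y a = P (ρ a))
    (h₁' : ∀ a, Sum.elim Y Z a = P' (ρ' a)) (h₂ : ∀ a, Sum.elim P Z a = Q (σ a))
    (h₂' : ∀ a, Sum.elim X P' a = Q' (σ' a)) (h : ∀ a, Q a = Q' (e a))
    (he : ∀ a, e (σ (Sum.map ρ id a)) = σ' (Sum.map id ρ' (Equiv.sumAssoc α β γ a))) :
    (s.mulMap t p ρ h₁ ⊗ₘ 𝟙 (r.eval Z)) ≫ p.mulMap r q σ h₂ ≫ q.canon q' e h =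
      (α_ (s.eval X) (t.eval Y) (r.eval Z)).hom ≫ (𝟙 (s.eval X) ⊗ₘ t.mulMap r p' ρ' h₁') ≫
        s.mulMap p' q' σ' h₂' := by
  have h₃ : ∀ a, Sum.elim (Sum.elim X Y) Z a =
      Q' (((Equiv.sumCongr ρ (Equiv.refl γ)).trans (σ.trans e)) a) := by
    rintro (a | c)
    · exact (h₁ a).trans ((h₂ (.inl (ρ a))).trans (h _))
    · exact (h₂ (.inr c)).trans (h _)
  have h₄ : ∀ a, Sum.elim X (Sum.elim Y Z) a =
      Q' (((Equiv.sumCongr (Equiv.refl α) ρ').trans σ') a) := by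
    rintro (a | c)
    · exact h₂' (.inl a)
    · exact (h₁' c).trans (h₂' (.inr (ρ' c)))
  have e₁ := canon_tensor_mulMap (s.tensor t) r p r q' ρ (Equiv.refl γ)
    ((Equiv.sumCongr ρ (Equiv.refl γ)).trans (σ.trans e)) (σ.trans e) (X := Sum.elim X Y) (X' := P)
    (Y := Z) (Y' := Z) h₁ (fun _ => rfl) h₃ (fun a => (h₂ a).trans (h _)) fun _ => rfl
  have e₂ := canon_tensor_mulMap s (t.tensor r) s p' q' (Equiv.refl α) ρ'
    ((Equiv.sumCongr (Equiv.refl α) ρ').trans σ') σ' (X := X) (X' := X) (Y := Sum.elim Y Z)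
    (Y' := P') (fun _ => rfl) h₁' h₄ h₂' fun _ => rfl
  rw [show r.canon r (Equiv.refl γ) (X := Z) (Z := Z) (fun _ => rfl) = 𝟙 _ from canon_refl r _] at e₁
  rw [show s.canon s (Equiv.refl α) (X := X) (Z := X) (fun _ => rfl) = 𝟙 _ from canon_refl s _] at e₂
  have e₃ := tensorIso_assoc s t r X Y Z (by rintro ((a | b) | c) <;> rfl)
  rw [mulMap_comp_canon p r q q' σ e (σ.trans e) h₂ h
    (fun a => (h₂ a).trans (h _)) fun _ => rfl]
  rw [← cancel_epi ((s.tensorIso t X Y).hom ⊗ₘ 𝟙 (r.eval Z)), ← cancel_epi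
    ((s.tensor t).tensorIso r (Sum.elim X Y) Z).hom, tensorHom_comp_tensorHom_assoc,
    tensorIso_mulMap, Category.comp_id, e₁, tensorIso_mulMap, reassoc_of% e₃,
    tensorHom_comp_tensorHom_assoc, tensorIso_mulMap, Category.comp_id, e₂, tensorIso_mulMap]
  exact (canon_comp_eq _ _ _ _ _ _ fun a => (he a).symm).symm

theorem left_mulMap (t : LinWord β) (w : LinWord γ) (ρ : Fin 0 ⊕ β ≃ γ) (e : γ ≃ β) {X : Fin 0 → C}
    {Y : β → C} {Z : γ → C} (h : ∀ a, Sum.elim X Y a = Z (ρ a)) (h' : ∀ c, Z c = Y (e c))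
    (he : ∀ b, e (ρ (.inr b)) = b) :
    (λ_ (t.eval Y)).hom = (𝟙 (𝟙_ C) ⊗ₘ 𝟙 (t.eval Y)) ≫ (std 0).mulMap t w ρ h ≫ w.canon t e h' := by
  refine Eq.trans ?_ ((Category.id_comp _).symm.trans
    (congrArg (· ≫ _) (id_tensorHom_id _ _).symm))
  refine Eq.trans ?_ (mulMap_comp_canon (std 0) t w t ρ e (ρ.trans e) h h'
    (fun a => (h a).trans (h' _)) fun _ => rfl).symm
  refine ((Iso.inv_comp_eq _).2 (Eq.trans ?_ (tensorIso_left t X Y ?_).symm)).symm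
  · refine canon_congr _ _ _ (Equiv.ext ?_)
    rintro (a | b)
    · exact a.elim0
    · exact he b

theorem right_mulMap (s : LinWord α) (w : LinWord γ) (ρ : α ⊕ Fin 0 ≃ γ) (e : γ ≃ α) {X : α → C}
    {Y : Fin 0 → C} {Z : γ → C} (h : ∀ a, Sum.elim X Y a = Z (ρ a)) (h' : ∀ c, Z c = X (e c))
    (he : ∀ b, e (ρ (.inl b)) = b) :
    (ρ_ (s.eval X)).hom = (𝟙 (s.eval X) ⊗ₘ 𝟙 (𝟙_ C)) ≫ s.mulMap (std 0) w ρ h ≫ w.canon s e h' := by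
  refine Eq.trans ?_ ((Category.id_comp _).symm.trans
    (congrArg (· ≫ _) (id_tensorHom_id _ _).symm))
  refine Eq.trans ?_ (mulMap_comp_canon s (std 0) w s ρ e (ρ.trans e) h h'
    (fun a => (h a).trans (h' _)) fun _ => rfl).symm
  refine ((Iso.inv_comp_eq _).2 (Eq.trans ?_ (tensorIso_right s X Y ?_).symm)).symm
  · refine canon_congr _ _ _ (Equiv.ext ?_)
    rintro (a | b)
    · exact he a
    · exact b.elim0

theorem mulMap_braid (s : LinWord α) (t : LinWord β) (w : LinWord γ) (w' : LinWord δ)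
    (ρ : α ⊕ β ≃ γ) (ρ' : β ⊕ α ≃ δ) (e : γ ≃ δ) {X : α → C} {Y : β → C} {Z : γ → C} {Z' : δ → C}
    (h : ∀ a, Sum.elim X Y a = Z (ρ a)) (h' : ∀ a, Sum.elim Y X a = Z' (ρ' a))
    (hZ : ∀ c, Z c = Z' (e c)) (he : ∀ a, e (ρ a) = ρ' a.swap) :
    s.mulMap t w ρ h ≫ w.canon w' e hZ =
      (β_ (s.eval X) (t.eval Y)).hom ≫ t.mulMap s w' ρ' h' := by
  rw [mulMap, Category.assoc, Iso.inv_comp_eq, ← Category.assoc, tensorIso_braid (h := by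
    rintro (a | b) <;> rfl), Category.assoc, tensorIso_mulMap]
  exact canon_square _ _ _ _ _ _ _ _ he

end LinWord

/-! ### Naturality of the structure maps of the counit. -/

namespace LinWord

variable {α α' β β' γ δ : Type} {C : Type u} [Category.{v} C] [MonoidalCategory C]
  [SymmetricCategory C]

/-- Multiplying two sorted products is sorting the joint source and evaluating on the product of the
two target words. The hypotheses `h` and `h'` say that the joint sorting restricts to the given
ones. -/
theorem subMap_tensor_mulMap {γ : β ⊕ β' → Type} (s : LinWord α) (s' : LinWord α') (t : LinWord β)
    (t' : LinWord β') (v : LinWord δ) {ι : Type} (w : LinWord ι) (G : ∀ b, LinWord (γ b))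
    {X : α → C} {X' : α' → C} {Z : ∀ b, γ b → C} {Y : β → C} {Y' : β' → C} {V : δ → C} {W : ι → C}
    (φ : ∀ b, (G b).eval (Z b) ⟶ Sum.elim Y Y' b) (E : α ≃ Σ b, γ (.inl b))
    (E' : α' ≃ Σ b, γ (.inr b)) (σ : α ⊕ α' ≃ δ) (ρ : β ⊕ β' ≃ ι) (ε : δ ≃ Σ b, γ b)
    (hE : ∀ r, X r = Z (.inl (E r).1) (E r).2) (hE' : ∀ r, X' r = Z (.inr (E' r).1) (E' r).2)
    (hσ : ∀ a, Sum.elim X X' a = V (σ a)) (hρ : ∀ a, Sum.elim Y Y' a = W (ρ a))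
    (hε : ∀ r, V r = Z (ε r).1 (ε r).2) (h : ∀ r, ε (σ (.inl r)) = ⟨.inl (E r).1, (E r).2⟩)
    (h' : ∀ r, ε (σ (.inr r)) = ⟨.inr (E' r).1, (E' r).2⟩) :
    ((s.canon (t.sub fun b => G (.inl b)) E (Z := fun p => Z (.inl p.1) p.2) hE ≫
          t.subMap (fun b => G (.inl b)) (Z := fun p => Z (.inl p.1) p.2) (fun b => φ (.inl b))) ⊗ₘ
        (s'.canon (t'.sub fun b => G (.inr b)) E' (Z := fun p => Z (.inr p.1) p.2) hE' ≫
          t'.subMap (fun b => G (.inr b)) (Z := fun p => Z (.inr p.1) p.2)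
            (fun b => φ (.inr b)))) ≫ t.mulMap t' w ρ hρ =
      s.mulMap s' v σ hσ ≫ v.canon ((t.tensor t').sub G) ε (Z := fun p => Z p.1 p.2) hε ≫
        (t.tensor t').subMap G (Z := fun p => Z p.1 p.2) φ ≫ (t.tensor t').canon w ρ hρ := by
  have hZ : ∀ a, Sum.elim (fun p : Σ b, γ (.inl b) => Z (.inl p.1) p.2)
      (fun p : Σ b, γ (.inr b) => Z (.inr p.1) p.2) a = (fun p : Σ b, γ b => Z p.1 p.2)
        ((Equiv.sumSigmaDistrib γ).symm a) := by
    rintro (a | b) <;> rfl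
  have h₁ : (t.subMap (fun b => G (.inl b)) (Z := fun p => Z (.inl p.1) p.2)
        (fun b => φ (.inl b)) ⊗ₘ
      t'.subMap (fun b => G (.inr b)) (Z := fun p => Z (.inr p.1) p.2) (fun b => φ (.inr b))) ≫
        t.mulMap t' w ρ hρ = (t.sub fun b => G (.inl b)).mulMap (t'.sub fun b => G (.inr b))
          ((t.tensor t').sub G) (Equiv.sumSigmaDistrib γ).symm (Z := fun p => Z p.1 p.2) hZ ≫
            (t.tensor t').subMap G (Z := fun p => Z p.1 p.2) φ ≫ (t.tensor t').canon w ρ hρ := by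
    have e := tensorIso_subMap t t' G (Z := fun p => Z p.1 p.2) φ hZ
    refine (cancel_epi (tensorIso _ _ _ _).hom).1 ?_
    refine (Category.assoc _ _ _).symm.trans ((congrArg (· ≫ _) e).trans ?_)
    refine (Category.assoc _ _ _).trans ((congrArg (_ ≫ ·) (Category.assoc _ _ _)).trans ?_)
    refine (congrArg (fun q => _ ≫ _ ≫ q) (tensorIso_mulMap t t' w ρ hρ)).trans ?_
    exact (comp_eq_comp₂' (tensorIso_mulMap _ _ _ _ _) _).symm
  have h₂ : ∀ a, Sum.elim X X' a = (fun p : Σ b, γ b => Z p.1 p.2) ((σ.trans ε) a) :=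
    fun a => (hσ a).trans (hε _)
  have h₃ := canon_tensor_mulMap s s' (t.sub fun b => G (.inl b)) (t'.sub fun b => G (.inr b))
    ((t.tensor t').sub G) E E' (σ.trans ε) (Equiv.sumSigmaDistrib γ).symm
    (X := X) (Y := X') (Z := fun p => Z p.1 p.2) (X' := fun p => Z (.inl p.1) p.2)
    (Y' := fun p => Z (.inr p.1) p.2) hE hE' h₂ hZ (by
      rintro (a | b)
      · exact (h a).symm
      · exact (h' b).symm)
  rw [← tensorHom_comp_tensorHom, Category.assoc, h₁, reassoc_of% h₃,
    comp_eq_comp₂'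
      (mulMap_comp_canon s s' v ((t.tensor t').sub G) σ ε (σ.trans ε) hσ hε h₂ fun _ => rfl)]

end LinWord

section Counit

open LinWord FreeHom

variable {κ : Choices.{u, v}} {C : SymMonCat.{u, v}}

theorem counitMap_tensorHom (hC : (underlyingData κ C).Laws) {m n m' n' : ℕ} {X : Fin m → C}
    {Y : Fin n → C} {X' : Fin m' → C} {Y' : Fin n' → C}
    (φ : FreeHom (underlyingData κ C) ⟨m, X⟩ ⟨n, Y⟩)
    (ψ : FreeHom (underlyingData κ C) ⟨m', X'⟩ ⟨n', Y'⟩) (h h') :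
    (counitMap κ φ ⊗ₘ counitMap κ ψ) ≫ (std n).mulMap (std n') (std (n + n')) finSumFinEquiv
        (X := Y) (Y := Y') (Z := Fin.append (α := C) Y Y') h =
      (std m).mulMap (std m') (std (m + m')) finSumFinEquiv (X := X) (Y := X')
        (Z := Fin.append (α := C) X X') h' ≫ counitMap κ (φ.tensorHom ψ) := by
  -- The fibres of the concatenated morphism are enumerated by those of `φ` and `ψ`, indexed by the
  -- letters of `(std n).tensor (std n')`; the target product is then already split.
  let c : Fin n ⊕ Fin n' → ℕ := Sum.elim (fun s => (Finset.univ.filter fun r => φ.fn r = s).card)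
    (fun s => (Finset.univ.filter fun r => ψ.fn r = s).card)
  let Z : ∀ b, Fin (c b) → C := fun b => match b with
    | .inl s => fibTuple (O := C) X φ.fn s
    | .inr s => fibTuple (O := C) X' ψ.fn s
  let e : ∀ b, Fin (c b) → Fin (m + m') := fun b => match b with
    | .inl s => fun k => Fin.castAdd m' (fibEnum φ.fn s k).1
    | .inr s => fun k => Fin.natAdd m (fibEnum ψ.fn s k).1
  let v : ∀ b, (κ C (c b) (Z b)).eval (Z b) ⟶ Sum.elim Y Y' b := fun b => match b with
    | .inl s => φ.mor s
    | .inr s => ψ.mor s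
  have hv : ∀ b, IsAt (M := underlyingData κ C) (φ.tensorHom ψ) (finSumFinEquiv b) (x' := Z b)
      (y' := Sum.elim Y Y' b) (e b) (v b)
    | .inl s => (isAt_mor hC φ s).tensor_left hC ψ
    | .inr s => (isAt_mor hC ψ s).tensor_right hC φ
  obtain ⟨ε, hε⟩ := exists_equiv_of_isAt (φ := φ.tensorHom ψ) finSumFinEquiv hv
  let E := (Equiv.sigmaFiberEquiv φ.fn).symm.trans
    (Equiv.sigmaCongrRight fun s => (fibEnum φ.fn s).symm)
  let E' := (Equiv.sigmaFiberEquiv ψ.fn).symm.trans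
    (Equiv.sigmaCongrRight fun s => (fibEnum ψ.fn s).symm)
  have hE : ∀ r, (fibEnum φ.fn (E r).1 (E r).2).1 = r := fun r => E.symm_apply_apply r
  have hE' : ∀ r, (fibEnum ψ.fn (E' r).1 (E' r).2).1 = r := fun r => E'.symm_apply_apply r
  have hεe : ∀ (r) (p : Σ b, Fin (c b)), e p.1 p.2 = r → ε r = p := fun r p hp => by
    obtain ⟨r', rfl⟩ := ε.surjective p
    rw [← hp, hε]
  refine (subMap_tensor_mulMap (C := C) (std m) (std m') (std n) (std n') (std (m + m'))
    (std (n + n')) (fun b => κ C (c b) (Z b)) v E E' finSumFinEquiv finSumFinEquiv ε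
    (fun r => congrArg X (hE r).symm) (fun r => congrArg X' (hE' r).symm) h' h
    (fun r => ?_) (fun r => hεe _ ⟨.inl _, _⟩ (congrArg (Fin.castAdd m') (hE r)))
    fun r => hεe _ ⟨.inr _, _⟩ (congrArg (Fin.natAdd m) (hE' r))).trans ?_
  · exact (congrArg (Fin.append (α := C) X X') (hε r).symm).trans
      ((hv (ε r).1).source_eq (ε r).2).symm
  · exact congrArg (_ ≫ ·) (counitMap_eq _ _ _ hv ε hε _ _).symm

end Counit

section CounitLaws

open LinWord FreeHom

variable {κ : Choices.{u, v}}

theorem append_eq_elim {O : Type u} {m n : ℕ} (X : Fin m → O) (Y : Fin n → O) (a : Fin m ⊕ Fin n) :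
    Sum.elim X Y a = Fin.append X Y (finSumFinEquiv a) := by
  rcases a with a | b
  · exact (Fin.append_left X Y a).symm
  · exact (Fin.append_right X Y b).symm

/-- Structure morphisms of the source become canonical maps by `counitMap_ofEquiv`, so the coherence
laws are those of `mulMap`, with bijections compared on values of indices. -/
theorem counitData_laws (hU : UnderlyingLaws κ) (hL : FreeLaws.{u, v}) (C : SymMonCat.{u, v}) :
    (counitData κ hU hL C).Laws where
  map_id x := (counitMap_ofEquiv (hU.obj C) (Equiv.refl _) fun _ => rfl).trans (canon_refl _ _)
  map_comp φ ψ := counitMap_comp (hU.obj C) φ ψ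
  mul_nat φ ψ := counitMap_tensorHom (hU.obj C) φ ψ _ _
  assoc x y z := by
    have h : ∀ r, Fin.append (α := C) (Fin.append (α := C) x.2 y.2) z.2 r =
        Fin.append (α := C) x.2 (Fin.append (α := C) y.2 z.2)
          (finCongr (Nat.add_assoc x.1 y.1 z.1) r) :=
      fun r => congrFun (Fin.append_assoc (α := C) x.2 y.2 z.2) r
    refine (congrArg (fun q => _ ≫ _ ≫ q) (counitMap_ofEquiv (hU.obj C)
      (finCongr (Nat.add_assoc x.1 y.1 z.1)) h)).trans ?_
    refine mulMap_assoc (C := C) (std x.1) (std y.1) (std z.1) (std (x.1 + y.1)) (std (y.1 + z.1))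
      (std (x.1 + y.1 + z.1)) (std (x.1 + (y.1 + z.1))) finSumFinEquiv finSumFinEquiv
      finSumFinEquiv finSumFinEquiv _ (append_eq_elim (O := C) x.2 y.2) (append_eq_elim (O := C) _ _)
      (append_eq_elim (O := C) _ _) (append_eq_elim (O := C) _ _) h ?_
    rintro ((a | b) | c) <;> refine Fin.ext ?_ <;> simp [Nat.add_assoc]
  left_unit x := by
    have h : ∀ r, Fin.append (α := C) Fin.elim0 x.2 r = x.2 (finCongr (Nat.zero_add x.1) r) :=
      fun r => congrFun (Fin.elim0_append (α := C) x.2) r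
    refine Eq.trans ?_ (congrArg (fun q => _ ≫ _ ≫ q) (counitMap_ofEquiv (hU.obj C)
      (finCongr (Nat.zero_add x.1)) h)).symm
    exact left_mulMap (C := C) (std x.1) (std (0 + x.1)) finSumFinEquiv _
      (append_eq_elim (O := C) _ _) h fun b => Fin.ext (by simp)
  right_unit x := by
    have h : ∀ r, Fin.append (α := C) x.2 Fin.elim0 r = x.2 (finCongr (Nat.add_zero x.1) r) :=
      fun r => congrFun (Fin.append_elim0 (α := C) x.2) r
    refine Eq.trans ?_ (congrArg (fun q => _ ≫ _ ≫ q) (counitMap_ofEquiv (hU.obj C)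
      (finCongr (Nat.add_zero x.1)) h)).symm
    exact right_mulMap (C := C) (std x.1) (std (x.1 + 0)) finSumFinEquiv _
      (append_eq_elim (O := C) _ _) h fun b => Fin.ext rfl
  braided x y := by
    have h : ∀ r, Fin.append (α := C) x.2 y.2 r = Fin.append (α := C) y.2 x.2 (finAddFlip r) := by
      intro r
      induction r using Fin.addCases with
      | left r =>
        rw [finAddFlip_apply_castAdd]
        exact (Fin.append_left (α := C) x.2 y.2 r).trans (Fin.append_right (α := C) y.2 x.2 r).symm
      | right r =>
        rw [finAddFlip_apply_natAdd]
        exact (Fin.append_right (α := C) x.2 y.2 r).trans (Fin.append_left (α := C) y.2 x.2 r).symm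
    refine (congrArg (_ ≫ ·) (counitMap_ofEquiv (hU.obj C) finAddFlip h)).trans ?_
    refine mulMap_braid (C := C) (std x.1) (std y.1) (std (x.1 + y.1)) (std (y.1 + x.1))
      finSumFinEquiv finSumFinEquiv finAddFlip (append_eq_elim (O := C) _ _)
      (append_eq_elim (O := C) _ _) h ?_
    rintro (a | b) <;> simp

theorem isStrong_counit (hU : UnderlyingLaws κ) (hL : FreeLaws.{u, v})
    (hε : ∀ C : SymMonCat.{u, v}, (counitData κ hU hL C).Laws) (C : SymMonCat.{u, v}) :
    IsStrong (counit κ hU hL hε C) :=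
  ⟨inferInstanceAs (IsIso (𝟙 (𝟙_ C))), fun x y =>
    isIso_mulMap (C := C) (std (x : FreeObj (underlyingData κ C)).1)
      (std (y : FreeObj (underlyingData κ C)).1) _ _ (append_eq_elim (O := C) _ _)⟩

end CounitLaws

/-! ### The comparison -/

section Comparison

open LinWord FreeHom

variable {κ : Choices.{u, v}} (hU : UnderlyingLaws κ) (hL : FreeLaws.{u, v})
    (hε : ∀ C : SymMonCat.{u, v}, (counitData κ hU hL C).Laws)

theorem counitMap_mapMulti {C D : SymMonCat.{u, v}} (F : LaxBraidedFunctor C D) {m n : ℕ}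
    {X : Fin m → C} {Y : Fin n → C} (φ : FreeHom (underlyingData κ C) ⟨m, X⟩ ⟨n, Y⟩) :
    counitMap κ (C := D) (X := fun i => F.obj (X i)) (Y := fun i => F.obj (Y i))
        (FreeHom.mapMulti (underlyingMapData κ F) φ) ≫ (std n).word.lax F Y =
      (std m).word.lax F X ≫ F.map (counitMap κ φ) := by
  -- Read backwards: moves the change from the products chosen in `D` to those chosen in `C` out of
  -- the components, after which the comparison map of `F` passes through everything.
  have e₁ := canon_subMap_right (C := D) (std n)
    (fun s => κ D _ (fibTuple (O := D) (fun i => F.obj (X i)) φ.fn s))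
    (fun s => κ C _ (fibTuple (O := C) X φ.fn s)) (fun _ => Equiv.refl _)
    (X := fun p => F.obj (fibTuple (O := C) X φ.fn p.1 p.2))
    (Z := fun p => F.obj (fibTuple (O := C) X φ.fn p.1 p.2)) (Y := fun i => F.obj (Y i))
    (fun _ => rfl)
    (fun s => (κ C _ (fibTuple (O := C) X φ.fn s)).word.lax F (fibTuple (O := C) X φ.fn s) ≫
      F.map (φ.mor s))
  have e₂ := subMap_lax F (std n) (fun s => κ C _ (fibTuple (O := C) X φ.fn s))
    (Z := fun p => fibTuple (O := C) X φ.fn p.1 p.2) (Y := Y) φ.mor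
  let E := (Equiv.sigmaFiberEquiv φ.fn).symm.trans
    (Equiv.sigmaCongrRight fun s => (fibEnum φ.fn s).symm)
  have hE : ∀ r, X r = fibTuple (O := C) X φ.fn (E r).1 (E r).2 :=
    fun r => congrArg X (E.symm_apply_apply r).symm
  have e₃ := canon_lax F (std m) ((std n).sub fun s => κ C _ (fibTuple (O := C) X φ.fn s)) E
    (X := X) (Z := fun p => fibTuple (O := C) X φ.fn p.1 p.2) hE fun r => congrArg F.obj (hE r)
  refine (Category.assoc _ _ _).trans ?_
  refine (congrArg (fun q => _ ≫ q ≫ _) e₁.symm).trans ?_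
  refine (congrArg (_ ≫ ·) ((Category.assoc _ _ _).trans (congrArg (_ ≫ ·) e₂))).trans ?_
  refine Eq.trans ?_ (congrArg (_ ≫ ·) (F.map_comp _ _)).symm
  refine Eq.trans ?_ (comp_eq_comp_assoc (C := D) e₃ _)
  exact comp_eq_comp₂' (C := D) (canon_comp_eq _ _ _ _ _ _ fun _ => rfl) _

theorem comparisonLaws : ComparisonLaws κ hU hL hε :=
  fun F _ _ φ => counitMap_mapMulti F φ

end Comparison

/-! ### The comparison is monoidal, coherent, and inherits strength and strictness. -/

theorem tensor_conj_inv {C : Type u} [Category.{v} C] [MonoidalCategory C] {A A' B B' P P' : C}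
    (f : A ⟶ B) (f' : A' ⟶ B') (k : P ≅ B) (k' : P' ≅ B') :
    ((f ⊗ₘ f') ≫ (k.inv ⊗ₘ k'.inv)) ≫ (k.hom ⊗ₘ k'.hom) = f ⊗ₘ f' := by
  simp only [tensorHom_comp_tensorHom, Category.assoc, Iso.inv_hom_id, Category.comp_id]

namespace LinWord

variable {α β γ : Type}

/-- A family on `α ⊕ β` is not definitionally `Sum.elim` of its restrictions; the canonical map
along the identity bridges the two. It is needed for `F.obj` applied to a `Sum.elim`. -/
theorem tensorIso_eq {C : Type u} [Category.{v} C] [MonoidalCategory C] [SymmetricCategory C]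
    (s : LinWord α) (t : LinWord β) (V : α ⊕ β → C) (h) :
    (s.tensorIso t (fun a => V (.inl a)) (fun b => V (.inr b))).hom =
      (s.tensor t).canon (s.tensor t) (Equiv.refl _) (Z := V) h ≫
        ((s.word.mapIso Sum.inl V).hom ⊗ₘ (t.word.mapIso Sum.inr V).hom) := by
  have : (s.tensor t).canon (s.tensor t) (Equiv.refl _) (Z := V) h =
      (s.tensorIso t (fun a => V (.inl a)) (fun b => V (.inr b))).hom ≫
        ((s.word.mapIso Sum.inl V).inv ⊗ₘ (t.word.mapIso Sum.inr V).inv) := by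
    refine Eq.symm ((tensorHom_comp_tensorHom _ _ _ _).trans (eq_canon_of_isStructural
      (w := s.tensor t) (w' := s.tensor t) (X := Sum.elim (fun a => V (.inl a)) fun b => V (.inr b))
      (Z := V) (e' := fun a => a) (.tensor (.mapIso_comp h ?_) (.mapIso_comp h ?_)) _
        (fun _ => rfl) _))
    · exact .mapIso_inv s.word Sum.inl V
    · exact .mapIso_inv t.word Sum.inr V
  refine Eq.symm ((congrArg (· ≫ _) this).trans ?_)
  exact tensor_conj_inv _ _ (s.word.mapIso Sum.inl V) (t.word.mapIso Sum.inr V)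

theorem canon_zero {C : Type u} [Category.{v} C] [MonoidalCategory C] [SymmetricCategory C]
    {X Z : Fin 0 → C} (h) :
    (std 0).canon (std 0) (Equiv.refl (Fin 0)) (X := X) (Z := Z) h = 𝟙 (𝟙_ C) := by
  obtain rfl : X = Z := Subsingleton.elim _ _
  exact canon_refl _ _

/-- The compatibility of `ξ` with products. On the split product, `Word.lax` of a tensor word is `μ`
after the two smaller comparison maps, and it commutes with the canonical map to `w`. -/
theorem mulMap_lax {C D : SymMonCat.{u, v}} (F : LaxBraidedFunctor C D) (s : LinWord α)
    (t : LinWord β) (w : LinWord γ) (ρ : α ⊕ β ≃ γ) {X : α → C} {Y : β → C} {Z : γ → C}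
    (h : ∀ a, Sum.elim X Y a = Z (ρ a))
    (h' : ∀ a, Sum.elim (fun a => F.obj (X a)) (fun b => F.obj (Y b)) a = F.obj (Z (ρ a))) :
    s.mulMap t w ρ (Z := fun c => F.obj (Z c)) h' ≫ w.word.lax F Z =
      (s.word.lax F X ⊗ₘ t.word.lax F Y) ≫
        Functor.LaxMonoidal.μ F.toFunctor (s.eval X) (t.eval Y) ≫ F.map (s.mulMap t w ρ h) := by
  have h₀ : ∀ a, Sum.elim (fun a => F.obj (X a)) (fun b => F.obj (Y b)) a =
      F.obj (Sum.elim X Y (Equiv.refl _ a)) := by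
    rintro (a | b) <;> rfl
  have e₁ := canon_lax F (s.tensor t) w ρ h fun a => congrArg F.obj (h a)
  have e₂ := tensorIso_eq s t (fun a => F.obj (Sum.elim X Y a)) h₀
  have e₃ := tensor_mul F.toFunctor (Word.mapIso_lax F s.word Sum.inl (Sum.elim X Y))
    (Word.mapIso_lax F t.word Sum.inr (Sum.elim X Y))
  refine (cancel_epi (s.tensorIso t (fun a => F.obj (X a)) fun b => F.obj (Y b)).hom).1 ?_
  refine (comp_eq_comp₂' (tensorIso_mulMap s t w ρ _) _).trans ?_
  refine (congrArg (· ≫ _) (canon_comp_eq (s.tensor t) (s.tensor t) w (e := Equiv.refl _)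
    h₀ (fun a => congrArg F.obj (h a)) h' fun _ => rfl).symm).trans ?_
  refine (Category.assoc _ _ _).trans ((congrArg (_ ≫ ·) e₁).trans ?_)
  refine Eq.symm ((congrArg (· ≫ _) e₂).trans ((Category.assoc _ _ _).trans
    (congrArg (_ ≫ ·) ?_)))
  refine (comp_eq_comp₃ (C := D) (e₃.trans (Category.assoc _ _ _)) _).trans ?_
  refine Eq.trans ?_ (Category.assoc _ _ _).symm
  refine congrArg (_ ≫ ·) (congrArg (_ ≫ ·) ?_)
  refine (F.map_comp _ _).symm.trans (congrArg F.map ?_)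
  exact tensorIso_mulMap s t w ρ h

end LinWord

section Comparison

open LinWord FreeHom

variable {κ : Choices.{u, v}} (hU : UnderlyingLaws κ) (hL : FreeLaws.{u, v})
    (hε : ∀ C : SymMonCat.{u, v}, (counitData κ hU hL C).Laws) (hξ : ComparisonLaws κ hU hL hε)

theorem isMonoidal_comparison {C D : SymMonCat.{u, v}} (F : C ⟶ D) :
    NatTrans.IsMonoidal (comparison κ hU hL hε hξ F) where
  unit := by
    let F' : LaxBraidedFunctor C D := F
    refine (congrArg (· ≫ _) ((Category.id_comp _).trans ((counitMap_ofEquiv (hU.obj D)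
      (X := Fin.elim0) (Y := fun i => F'.obj (Fin.elim0 i)) (Equiv.refl (Fin 0))
        fun r => r.elim0).trans (canon_zero _)))).trans ((Category.id_comp _).trans ?_)
    exact (Category.comp_id _).symm.trans (congrArg (_ ≫ ·) (F'.toFunctor.map_id _).symm)
  tensor x y := by
    let F' : LaxBraidedFunctor C D := F
    let x' : FreeObj (underlyingData κ C) := x
    let y' : FreeObj (underlyingData κ C) := y
    have h₁ : ∀ r, Fin.append (α := D) (fun i => F'.obj (x'.2 i)) (fun i => F'.obj (y'.2 i)) r =
        F'.obj (Fin.append (α := C) x'.2 y'.2 r) := fun r => by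
      induction r using Fin.addCases with
      | left r =>
        exact (Fin.append_left _ _ _).trans (congrArg F'.obj (Fin.append_left _ _ _).symm)
      | right r =>
        exact (Fin.append_right _ _ _).trans (congrArg F'.obj (Fin.append_right _ _ _).symm)
    have h₂ := append_eq_elim (O := D) (fun i => F'.obj (x'.2 i)) (fun i => F'.obj (y'.2 i))
    -- The structure maps of `L U F` move nothing, so the counit turns them into a canonical map
    -- along the identity, which merges with `mulMap`.
    refine (congrArg (· ≫ _) ((congrArg (_ ≫ ·) (counitMap_ofEquiv (hU.obj D)
      (Equiv.refl (Fin (x'.1 + y'.1))) h₁)).trans (mulMap_comp_canon (C := D) (std x'.1) (std y'.1) _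
        (std (x'.1 + y'.1)) finSumFinEquiv (Equiv.refl _) finSumFinEquiv h₂ h₁
        (fun a => (h₂ a).trans (h₁ _)) fun _ => rfl))).trans ?_
    exact mulMap_lax F' (std x'.1) (std y'.1) (std (x'.1 + y'.1)) finSumFinEquiv
      (append_eq_elim (O := C) x'.2 y'.2) _

theorem comparison_id (C : SymMonCat.{u, v}) (x : (free hL).obj ((underlying κ hU).obj C)) (h) :
    (comparison κ hU hL hε hξ (𝟙 C)).app x = eqToHom h :=
  Word.lax_id _ _

theorem comparison_comp {C D E : SymMonCat.{u, v}} (F : C ⟶ D) (G : D ⟶ E)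
    (x : (free hL).obj ((underlying κ hU).obj C)) (h) :
    (comparison κ hU hL hε hξ (F ≫ G)).app x = eqToHom h ≫
      (comparison κ hU hL hε hξ G).app ((LaxBraidedFunctor.toFunctor
        ((free hL).map ((underlying κ hU).map F))).obj x) ≫
          (LaxBraidedFunctor.toFunctor G).map ((comparison κ hU hL hε hξ F).app x) :=
  (Word.lax_comp F G _ _).trans (Category.id_comp _).symm

theorem isIso_comparison {C D : SymMonCat.{u, v}} (F : C ⟶ D) (hF : IsStrong F)
    (x : (free hL).obj ((underlying κ hU).obj C)) : IsIso ((comparison κ hU hL hε hξ F).app x) :=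
  Word.isIso_lax F hF _ _

theorem comparison_eq_eqToHom {C D : SymMonCat.{u, v}} (F : C ⟶ D) (hF : IsStrict F)
    (x : (free hL).obj ((underlying κ hU).obj C)) :
    ∃ h, (comparison κ hU hL hε hξ F).app x = eqToHom h :=
  Word.lax_eq_eqToHom F hF _ _

end Comparison

/-! ### The triangle identities -/

section EqToHom

variable {α β γ : Type} {C : Type u} [Category.{v} C] [MonoidalCategory C]

theorem exists_tensorHom_eq_eqToHom {A A' B B' : C} {f : A ⟶ A'} {g : B ⟶ B'}
    (hf : ∃ h, f = eqToHom h) (hg : ∃ h, g = eqToHom h) : ∃ h, f ⊗ₘ g = eqToHom h := by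
  obtain ⟨rfl, rfl⟩ := hf
  obtain ⟨rfl, rfl⟩ := hg
  exact ⟨rfl, id_tensorHom_id _ _⟩

theorem exists_comp_eq_eqToHom {A A' A'' : C} {f : A ⟶ A'} {g : A' ⟶ A''}
    (hf : ∃ h, f = eqToHom h) (hg : ∃ h, g = eqToHom h) : ∃ h, f ≫ g = eqToHom h := by
  obtain ⟨rfl, rfl⟩ := hf
  obtain ⟨rfl, rfl⟩ := hg
  exact ⟨rfl, Category.id_comp _⟩

theorem Word.mapIso_inv_eq_eqToHom (w : Word α) (e : α → β) (Z : β → C) :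
    ∃ h, (w.mapIso e Z).inv = eqToHom h := by
  induction w with
  | unit => exact ⟨rfl, rfl⟩
  | leaf a => exact ⟨rfl, rfl⟩
  | tensor s t hs ht => exact exists_tensorHom_eq_eqToHom hs ht

theorem Word.map_map (w : Word α) (e : α → β) (e' : β → γ) :
    (w.map e).map e' = w.map fun a => e' (e a) := by
  induction w with
  | unit => rfl
  | leaf a => rfl
  | tensor s t hs ht => exact congrArg₂ Word.tensor hs ht

theorem Word.map_std (n : ℕ) (l : Fin n → α) (e : α → β) :
    (Word.std n l).map e = Word.std n fun k => e (l k) := by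
  induction n with
  | zero => rfl
  | succ n ih =>
    cases n with
    | zero => rfl
    | succ n => exact congrArg (Word.tensor · _) (ih _)

variable [SymmetricCategory C]

/-- If the words agree after relabelling, the relabelling alone is a canonical map, and by coherence
it is the chosen one. -/
theorem LinWord.canon_eq_eqToHom (w : LinWord α) (w' : LinWord β) (e : α ≃ β) {X : α → C}
    {Z : β → C} (h : ∀ a, X a = Z (e a)) (hw : w.word.map e = w'.word) :
    ∃ h', w.canon w' e h = eqToHom h' := by
  obtain rfl : X = fun a => Z (e a) := funext h
  obtain ⟨w', h₁, h₂⟩ := w'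
  obtain rfl : w.word.map e = w' := hw
  have h' := eq_canon_of_isStructural (w := w) (w' := ⟨w.word.map e, h₁, h₂⟩)
    (Word.IsStructural.mapIso_inv w.word e Z) e (fun _ => rfl) h
  obtain ⟨h'', h₃⟩ := Word.mapIso_inv_eq_eqToHom w.word e Z
  exact ⟨h'', h'.symm.trans h₃⟩

theorem LinWord.mulMap_eq_eqToHom (s : LinWord α) (t : LinWord β) (w : LinWord γ) (ρ : α ⊕ β ≃ γ)
    {X : α → C} {Y : β → C} {Z : γ → C} (h : ∀ a, Sum.elim X Y a = Z (ρ a))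
    (hw : (s.tensor t).word.map ρ = w.word) : ∃ h', s.mulMap t w ρ h = eqToHom h' :=
  exists_comp_eq_eqToHom (exists_tensorHom_eq_eqToHom
    (Word.mapIso_inv_eq_eqToHom s.word Sum.inl (Sum.elim X Y))
    (Word.mapIso_inv_eq_eqToHom t.word Sum.inr (Sum.elim X Y))) (canon_eq_eqToHom _ _ _ _ hw)

/-- Appending one letter to a nonempty left-parenthesized word gives the next such word. For the
empty word this fails, as a unit would remain in front. -/
theorem LinWord.map_std_tensor_std_one (n : ℕ) :
    ((std (n + 1)).tensor (std 1)).word.map finSumFinEquiv = (std (n + 1 + 1)).word :=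
  congrArg (Word.tensor · _) ((Word.map_map _ _ _).trans (Word.map_std _ _ _))

end EqToHom

/-! ### The triangle identity for the underlying multicategory. -/

section RightTriangle

open LinWord FreeHom

variable {κ : Choices.{u, v}} (hU : UnderlyingLaws κ) (hL : FreeLaws.{u, v})
    (hε : ∀ C : SymMonCat.{u, v}, (counitData κ hU hL C).Laws)

/-- The left-parenthesized product of singletons grows by one letter at a time, and there the
structure map of the counit is an identity because the words agree on the nose. -/
theorem lax_counit_std (C : SymMonCat.{u, v}) {α : Type} (n : ℕ) (l : Fin n → α)
    (X : α → (free hL).obj ((underlying κ hU).obj C)) (x : Fin n → C)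
    (hX : ∀ i, X (l i) = (⟨1, fun _ => x i⟩ : FreeObj (underlyingData κ C))) :
    ∃ h, (Word.std n l).lax (counit κ hU hL hε C) X = eqToHom h := by
  induction n with
  | zero => exact ⟨rfl, rfl⟩
  | succ n ih =>
    cases n with
    | zero => exact ⟨rfl, rfl⟩
    | succ n =>
      -- Stated for variable objects, so that the equality of the value of a word with a tuple can
      -- be substituted.
      have h₁ : ∀ A B : (free hL).obj ((underlying κ hU).obj C),
          A = (⟨n + 1, fun i => x i.castSucc⟩ : FreeObj (underlyingData κ C)) →
          B = (⟨1, fun _ => x (Fin.last _)⟩ : FreeObj (underlyingData κ C)) →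
          ∃ h, Functor.LaxMonoidal.μ (counit κ hU hL hε C).toFunctor A B = eqToHom h := by
        rintro _ _ rfl rfl
        exact mulMap_eq_eqToHom (C := C) (std (n + 1)) (std 1) (std (n + 1 + 1)) finSumFinEquiv
          (X := fun i => x i.castSucc) (Y := fun _ => x (Fin.last _))
          (append_eq_elim (O := C) _ _) (map_std_tensor_std_one n)
      exact exists_comp_eq_eqToHom (exists_tensorHom_eq_eqToHom (ih _ _ fun i => hX _) ⟨rfl, rfl⟩)
        (h₁ _ _ (eval_std_single hL ((underlying κ hU).obj C) (n + 1) _ X _ fun i => hX _) (hX _))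

/-- There is a single fibre, with all indices in order, so `counitMap_eq` may use the word `one` for
the target and nothing is sorted. -/
theorem counitMap_ofMulti {C : SymMonCat.{u, v}} (hC : (underlyingData κ C).Laws) {n : ℕ}
    {x : Fin n → C} {y : C}
    (φ : κ.prod C x ⟶ y) :
    counitMap κ (X := x) (Y := fun _ => y) (ofMulti (M := underlyingData κ C) φ) =
      (std n).canon (C := C) (κ C n x) (Equiv.refl _) (fun _ => rfl) ≫ φ := by
  have h := counitMap_eq (X := x) (Y := fun _ => y) (ofMulti (M := underlyingData κ C) φ) one
    (Equiv.refl (Fin 1)) (c := fun _ => n) (Z := fun _ => x) (Y' := fun _ => y)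
    (e := fun _ k => k) (v := fun _ => φ)
    (fun b => by rw [Subsingleton.elim b 0]; exact isAt_ofMulti hC φ)
    ((Equiv.sigmaEquivProd (Fin 1) (Fin n)).trans (Equiv.uniqueProd (Fin n) (Fin 1))).symm
    (fun _ => rfl) (fun _ => rfl) fun _ => rfl
  refine h.trans ?_
  have h₁ : one.canon (C := C) (std 1) (Equiv.refl (Fin 1)) (X := fun _ => y) (Z := fun _ => y)
      (fun _ => rfl) = 𝟙 y := canon_refl (std 1) _
  refine (congrArg (fun q => _ ≫ _ ≫ q) h₁).trans ?_
  refine (congrArg (_ ≫ ·) (Category.comp_id _)).trans ?_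
  refine (congrArg (_ ≫ ·) (one_subMap (C := C) (κ C n x) (Z := fun p => x p.2)
    (Y := fun _ => y) (fun _ => φ) fun _ => rfl)).trans ?_
  exact comp_eq_comp₂' (C := C) (canon_comp_eq _ _ _ _ _ _ fun _ => rfl) _

/-- Eliminates the product `w'` chosen in the source category of `F`; in the triangle this is the
one chosen in `L U C`. -/
theorem canon_lax_map {A D : SymMonCat.{u, v}} (F : LaxBraidedFunctor A D) {α : Type}
    (w w' s : LinWord α) {X : α → A} {Y : A} (q : s.eval X ⟶ Y) :
    w.canon (X := fun a => F.obj (X a)) (Z := fun a => F.obj (X a)) w' (Equiv.refl α)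
        (fun _ => rfl) ≫ w'.word.lax F X ≫
      F.map (w'.canon s (Equiv.refl α) (fun _ => rfl) ≫ q) =
    w.canon (X := fun a => F.obj (X a)) (Z := fun a => F.obj (X a)) s (Equiv.refl α)
        (fun _ => rfl) ≫ s.word.lax F X ≫ F.map q := by
  have h := canon_lax F w' s (Equiv.refl α) (X := X) (Z := X) (fun _ => rfl) fun _ => rfl
  refine (congrArg (fun q => _ ≫ _ ≫ q) (F.map_comp _ _)).trans ?_
  refine (congrArg (_ ≫ ·) (comp_eq_comp_assoc h.symm _)).trans ?_
  exact comp_eq_comp₂' (canon_comp_eq _ _ _ _ _ _ fun _ => rfl) _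

theorem unit_counit (hη : UnitLaws κ hU hL) (C : SymMonCat.{u, v}) :
    (unit κ hU hL hη).app ((underlying κ hU).obj C) ≫
      (underlying κ hU).map (counit κ hU hL hε C) = 𝟙 ((underlying κ hU).obj C) := by
  refine Multifunctor.eq_of_map _ _ rfl fun {n x y} (φ : κ.prod C x ⟶ y) => ?_
  have h₁ := eval_std_single hL ((underlying κ hU).obj C) n _root_.id
    (fun i => single hL (M := (underlying κ hU).obj C) (x i)) x fun _ => rfl
  have h₂ := canon_lax_map (counit κ hU hL hε C) (κ C n x)
    (κ _ n fun i => single hL (M := (underlying κ hU).obj C) (x i)) (std n)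
    (X := fun i => single hL (M := (underlying κ hU).obj C) (x i))
    (eqToHom h₁ ≫ ofMulti (M := underlyingData κ C) φ)
  refine h₂.trans ?_
  have h₃ : ∃ h, (std n).word.lax (counit κ hU hL hε C)
      (fun i => single hL (M := (underlying κ hU).obj C) (x i)) ≫
        (counit κ hU hL hε C).map (eqToHom h₁) = eqToHom h :=
    exists_comp_eq_eqToHom (lax_counit_std hU hL hε C n _ _ x fun _ => rfl)
      ⟨_, eqToHom_map (counit κ hU hL hε C).toFunctor h₁⟩
  obtain ⟨_, h₃⟩ := h₃
  refine (congrArg (fun q => _ ≫ _ ≫ q) ((counit κ hU hL hε C).map_comp _ _)).trans ?_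
  refine (congrArg (_ ≫ ·) (comp_eq_comp₂' h₃ _)).trans ?_
  refine (congrArg (_ ≫ ·) (Category.id_comp _)).trans ?_
  refine (congrArg (_ ≫ ·) (counitMap_ofMulti (hU.obj C) φ)).trans ?_
  -- What remains is `φ` after going from the chosen product to the left-parenthesized one and back.
  exact (comp_eq_comp₂' (C := C) (canon_canon_symm _ _ _ _ _) φ).trans (Category.id_comp _)

end RightTriangle

/-! ### The triangle identity for the generated symmetric monoidal category. -/

section LeftTriangle

open LinWord FreeHom

variable {κ : Choices.{u, v}} {hL : FreeLaws.{u, v}} {M : Multicat.{u, v}}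

theorem ValueAt.comp_eqToHom {x y z : (free hL).obj M} {φ : x ⟶ y} {s n : ℕ} {a : Fin n → M.Obj}
    {b : M.Obj} {e : Fin n → ℕ} {v : M.Hom a b} (h : ValueAt φ s e v) (h' : y = z) :
    ValueAt (φ ≫ eqToHom h') s e v := by
  subst h'
  rwa [eqToHom_refl, Category.comp_id]

theorem ext_valueAt {x y : (free hL).obj M} {φ ψ : x ⟶ y}
    (h : ∀ s, s < len y → ∃ (n : ℕ) (a : Fin n → M.Obj) (b : M.Obj) (e : Fin n → ℕ)
      (v : M.Hom a b), ValueAt φ s e v ∧ ValueAt ψ s e v) : φ = ψ := by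
  refine ext_isAt M.laws fun s => ?_
  obtain ⟨n, a, b, e, v, ⟨_, _, h₁⟩, _, _, h₂⟩ := h s s.2
  exact ⟨_, _, _, _, _, h₁, h₂⟩

/-- A tuple as an object of the free symmetric monoidal category. -/
abbrev tuple (hL : FreeLaws.{u, v}) {m : ℕ} (X : Fin m → M.Obj) : (free hL).obj M :=
  (⟨m, X⟩ : FreeObj M.toMultiData)

/-- Over each target entry the image under the unit represents the original component, and the
sorting map brings its inputs back to their places in `X`; the `eqToHom`s do not move entries. -/
theorem counitMap_mapMulti_unit {m n : ℕ} {X : Fin m → M.Obj} {Y : Fin n → M.Obj}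
    (φ : tuple hL X ⟶ tuple hL Y)
    (hX : (std m).eval (fun i => single hL (X i)) = tuple hL X)
    (hY : (std n).eval (fun i => single hL (Y i)) = tuple hL Y) :
    counitMap κ (C := (free hL).obj M) (X := fun i => single hL (X i))
        (Y := fun i => single hL (Y i)) (FreeHom.mapMulti (unitData κ hL M) φ) =
      eqToHom hX ≫ φ ≫ eqToHom hY.symm := by
  refine ext_valueAt fun s hs => ?_
  have hn : s < n := by
    rw [len_eval] at hs
    exact hs.trans_eq (Word.pos_std n _root_.id fun _ => rfl).1
  obtain ⟨e, h₁, h₂⟩ := represents_unitData (hL := hL) κ (FreeHom.mor φ ⟨s, hn⟩)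
  obtain ⟨e', h₃, h₄⟩ := valueAt_subMap (std n)
    (fun s => κ ((free hL).obj M) _ (fibTuple (O := (free hL).obj M) (fun i => single hL (X i)) (FreeHom.fn φ) s))
    (Z := fun p => fibTuple (O := (free hL).obj M) (fun i => single hL (X i)) (FreeHom.fn φ) p.1 p.2)
    (Y := fun i => single hL (Y i)) (fun s => (unitData κ hL M).map (FreeHom.mor φ s)) (c := ⟨s, hn⟩) h₁
    ((Word.pos_std n _root_.id fun _ => rfl).2 ⟨s, hn⟩)
  refine ⟨_, _, _, fun k => (fibEnum (FreeHom.fn φ) ⟨s, hn⟩ k).1, FreeHom.mor φ ⟨s, hn⟩, ?_, ?_⟩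
  · refine h₃.moves_comp fun k => ?_
    refine (carries_canon _ _ _ _).movesTo (std m).nodup (Equiv.injective _)
      ((Word.pos_std m _root_.id fun _ => rfl).2 (fibEnum (FreeHom.fn φ) ⟨s, hn⟩ k).1) ?_
    have h₅ := h₄ k k 0 (h₂ k)
    -- Writes the letter as the image under the sorting bijection of the member `k` of the fibre,
    -- the form that `Carries.movesTo` asks for.
    rwa [← Equiv.apply_symm_apply ((Equiv.sigmaFiberEquiv (FreeHom.fn φ)).symm.trans
      (Equiv.sigmaCongrRight fun s => (fibEnum (FreeHom.fn φ) s).symm)) ⟨⟨s, hn⟩, k⟩] at h₅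
  · refine (rigid_eqToHom hX).valueAt_comp (ValueAt.comp_eqToHom ?_ hY.symm)
    exact ⟨hn, fun k => (fibEnum (FreeHom.fn φ) ⟨s, hn⟩ k).1.2, isAt_mor M.laws φ ⟨s, hn⟩⟩

theorem rigid_canon {α β : Type} (w : LinWord α) (w' : LinWord β) (e : α ≃ β)
    {X : α → (free hL).obj M} {Z : β → (free hL).obj M} (h : ∀ a, X a = Z (e a))
    (hl : len (w.eval X) = len (w'.eval Z))
    (hp : ∀ a i r, w'.word.Pos (fun a => len (Z a)) (e a) i r →
      w.word.Pos (fun a => len (X a)) a i r) : Rigid (w.canon w' e h) := by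
  refine ⟨hl, fun s hs => ?_⟩
  obtain ⟨r, h₁, a, i, h₂, h₃⟩ := carries_canon w w' e h s hs
  obtain rfl := h₂.unique w.nodup (hp _ _ _ h₃)
  exact h₁

/-- All blocks have length one, so the entry of the letter `k` in a left-parenthesized word is at
position `k`, and concatenation of the index sets preserves positions. -/
theorem rigid_mulMap_std {m n : ℕ} {X : Fin m → (free hL).obj M} {Y : Fin n → (free hL).obj M}
    {Z : Fin (m + n) → (free hL).obj M} (hX : ∀ i, len (X i) = 1) (hY : ∀ i, len (Y i) = 1)
    (hZ : ∀ i, len (Z i) = 1) (h : ∀ a, Sum.elim X Y a = Z (finSumFinEquiv a)) :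
    Rigid ((std m).mulMap (std n) (std (m + n)) finSumFinEquiv h) := by
  have h₁ := Word.pos_std (ℓ := fun i => len (X i)) m _root_.id hX
  have h₂ := Word.pos_std (ℓ := fun i => len (Y i)) n _root_.id hY
  have h₃ := Word.pos_std (ℓ := fun i => len (Z i)) (m + n) _root_.id hZ
  have h₄ : ((std m).word.map Sum.inl).size (fun a => len (Sum.elim X Y a)) = m :=
    (Word.size_bind _ _ _).trans h₁.1
  have h₅ : ((std n).word.map Sum.inr).size (fun a => len (Sum.elim X Y a)) = n :=
    (Word.size_bind _ _ _).trans h₂.1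
  refine ((rigid_bindIso_inv (std m).word _ _).tensor (rigid_bindIso_inv (std n).word _ _)).comp
    (rigid_canon _ _ _ _ ?_ ?_)
  · rw [len_eval, len_eval]
    exact (congrArg₂ (· + ·) h₄ h₅).trans h₃.1.symm
  · intro a i r hr
    obtain rfl : i = 0 := Nat.lt_one_iff.1 (hr.lt.trans_eq (hZ _))
    obtain rfl := hr.unique (std (m + n)).nodup (h₃.2 _)
    rcases a with a | a
    · exact Or.inl ((h₁.2 a).map (ℓ := fun a => len (Sum.elim X Y a)) (e := Sum.inl))
    · exact Or.inr ⟨a, (h₂.2 a).map (ℓ := fun a => len (Sum.elim X Y a)) (e := Sum.inr),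
        congrArg (· + _) h₄.symm⟩

theorem heq_eqToHom {C : Type u} [Category.{v} C] {A A' B B' : C} {f : A ⟶ B} {g : A' ⟶ B'}
    (hf : ∃ h, f = eqToHom h) (hg : ∃ h, g = eqToHom h) (hA : A = A') : HEq f g := by
  obtain ⟨rfl, rfl⟩ := hf
  obtain ⟨rfl, rfl⟩ := hg
  subst hA
  rfl

/-- Structure maps that are identities carry no information beyond their source and target. -/
theorem IsStrict.eq {C D : SymMonCat.{u, v}} {F G : LaxBraidedFunctor C D} (hF : IsStrict F)
    (hG : IsStrict G) (h : F.toFunctor = G.toFunctor) : F = G :=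
  laxBraided_ext F G h (heq_eqToHom hF.1 hG.1 rfl) fun X Y =>
    heq_eqToHom (hF.2 X Y) (hG.2 X Y) (by rw [h])

theorem mulMap_std_eq_eqToHom {m n : ℕ} (X : Fin m → M.Obj) (Y : Fin n → M.Obj) (h) :
    ∃ h', (std m).mulMap (std n) (std (m + n)) finSumFinEquiv (X := fun i => single hL (X i))
      (Y := fun i => single hL (Y i)) (Z := Fin.append (fun i => single hL (X i))
        fun i => single hL (Y i)) h = eqToHom h' := by
  obtain ⟨hl, hr⟩ := rigid_mulMap_std (hL := hL)
    (X := fun i => single hL (X i)) (Y := fun i => single hL (Y i))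
    (Z := Fin.append (fun i => single hL (X i)) fun i => single hL (Y i))
    (fun _ => rfl) (fun _ => rfl) (Fin.addCases (fun i => congrArg len (Fin.append_left _ _ i))
      fun i => congrArg len (Fin.append_right _ _ i)) h
  refine exists_eq_eqToHom hL M hl _ fun r s hrs => ?_
  obtain ⟨hr', _, h'⟩ := hr s s.2
  rwa [show r = ⟨s, hr'⟩ from Fin.ext hrs]

theorem mul_counit (hU : UnderlyingLaws κ) (hL : FreeLaws.{u, v})
    (hε : ∀ C : SymMonCat.{u, v}, (counitData κ hU hL C).Laws) (C : SymMonCat.{u, v}) {m n : ℕ}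
    (X : Fin m → C) (Y : Fin n → C) :
    Functor.LaxMonoidal.μ (counit κ hU hL hε C).toFunctor
      (tuple (M := (underlying κ hU).obj C) hL X) (tuple (M := (underlying κ hU).obj C) hL Y) =
      (std m).mulMap (std n) (std (m + n)) finSumFinEquiv (C := C) (append_eq_elim X Y) :=
  rfl

theorem mul_counit_map_unit (hU : UnderlyingLaws κ) (hη : UnitLaws κ hU hL)
    (hε : ∀ C : SymMonCat.{u, v}, (counitData κ hU hL C).Laws) (x y : (free hL).obj M) :
    ∃ h, Functor.LaxMonoidal.μ (counit κ hU hL hε ((free hL).obj M)).toFunctor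
      (((free hL).map ((unit κ hU hL hη).app M)).obj x)
      (((free hL).map ((unit κ hU hL hη).app M)).obj y) = eqToHom h := by
  obtain ⟨h, h'⟩ := mulMap_std_eq_eqToHom (hL := hL) (Sigma.snd (x : FreeObj M.toMultiData))
    (Sigma.snd (y : FreeObj M.toMultiData)) (append_eq_elim (O := (free hL).obj M) _ _)
  exact ⟨h, (mul_counit hU hL hε ((free hL).obj M)
    (fun i => single hL (Sigma.snd (x : FreeObj M.toMultiData) i))
    (fun i => single hL (Sigma.snd (y : FreeObj M.toMultiData) i))).trans h'⟩

/-- The counit is strong and need not be strict, but on lists of singletons its structure maps move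
nothing; strictness of `L η` supplies the rest. -/
theorem isStrict_map_unit_counit (hU : UnderlyingLaws κ) (hL : FreeLaws.{u, v})
    (hη : UnitLaws κ hU hL) (hε : ∀ C : SymMonCat.{u, v}, (counitData κ hU hL C).Laws)
    (M : Multicat.{u, v}) : IsStrict ((free hL).map ((unit κ hU hL hη).app M) ≫
      counit κ hU hL hε ((free hL).obj M)) := by
  have h := isStrict_free hL ((unit κ hU hL hη).app M)
  have hm : ∀ {A B : (free hL).obj ((underlying κ hU).obj ((free hL).obj M))} {f : A ⟶ B},
      (∃ h, f = eqToHom h) → ∃ h, (counit κ hU hL hε ((free hL).obj M)).map f = eqToHom h := by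
    rintro _ _ _ ⟨h, rfl⟩
    exact ⟨_, eqToHom_map _ h⟩
  exact ⟨exists_comp_eq_eqToHom ⟨rfl, rfl⟩ (hm h.1), fun x y =>
    exists_comp_eq_eqToHom (mul_counit_map_unit hU hη hε x y) (hm (h.2 x y))⟩

/-- Both sides are strict, so it is enough to compare them on objects, where a tuple is the product
of its entries, and on morphisms. -/
theorem map_unit_counit (hU : UnderlyingLaws κ) (hL : FreeLaws.{u, v}) (hη : UnitLaws κ hU hL)
    (hε : ∀ C : SymMonCat.{u, v}, (counitData κ hU hL C).Laws) (M : Multicat.{u, v}) :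
    (free hL).map ((unit κ hU hL hη).app M) ≫ counit κ hU hL hε ((free hL).obj M) =
      𝟙 ((free hL).obj M) := by
  have ho : ∀ x : (free hL).obj M, (counit κ hU hL hε ((free hL).obj M)).obj
      (((free hL).map ((unit κ hU hL hη).app M)).obj x) = x := fun x =>
    eval_std_single hL M (Sigma.fst (x : FreeObj M.toMultiData)) _root_.id
      (fun i => single hL (Sigma.snd (x : FreeObj M.toMultiData) i)) _ fun _ => rfl
  exact (isStrict_map_unit_counit hU hL hη hε M).eq ⟨⟨rfl, rfl⟩, fun _ _ => ⟨rfl, rfl⟩⟩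
    (CategoryTheory.Functor.ext ho fun x y φ => counitMap_mapMulti_unit (κ := κ) φ (ho x) (ho y))

end LeftTriangle

end SymMult

end

theorem theorem2p6 (κ : Choices.{u, v}) :
    ∃ (hU : UnderlyingLaws κ) (hL : FreeLaws.{u, v}) (hη : UnitLaws κ hU hL)
      (hε : ∀ C : SymMonCat.{u, v}, (counitData κ hU hL C).Laws)
      (hξ : ComparisonLaws κ hU hL hε),
      IsWeakAdjunction (free hL) (underlying κ hU) (unit κ hU hL hη) (counit κ hU hL hε)
        (comparison κ hU hL hε hξ) ∧
      (∀ M : Multicat.{u, v}, IsPermutative ((free hL).obj M)) ∧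
      (∀ {M N : Multicat.{u, v}} (F : M ⟶ N), IsStrict ((free hL).map F)) ∧
      (∀ C : SymMonCat.{u, v}, IsStrong (counit κ hU hL hε C)) ∧
      (∀ {C D : SymMonCat.{u, v}} (F : C ⟶ D), IsStrong F →
        ∀ x, IsIso ((comparison κ hU hL hε hξ F).app x)) ∧
      (∀ {C D : SymMonCat.{u, v}} (F : C ⟶ D), IsStrict F →
        ∀ x, ∃ h, (comparison κ hU hL hε hξ F).app x = eqToHom h) :=
  ⟨underlyingLaws κ, freeLaws, unitLaws κ _ _, fun C => counitData_laws _ _ C,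
    comparisonLaws _ _ _,
    { left_triangle := fun M => map_unit_counit _ _ _ _ M
      right_triangle := fun C => unit_counit _ _ _ _ C
      comparison_monoidal := fun F => isMonoidal_comparison _ _ _ _ F
      comparison_id := fun C x => comparison_id _ _ _ _ C x _
      comparison_comp := fun F G x => comparison_comp _ _ _ _ F G x _ },
    fun M => isPermutative_free _ M, fun F => isStrict_free _ F,
    fun C => isStrong_counit _ _ _ C, fun F hF x => isIso_comparison _ _ _ _ F hF x,
    fun F hF x => comparison_eq_eqToHom _ _ _ _ F hF x⟩
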